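/- Fix a critical exponent $\alpha>1$ and put $\theta_\alpha=1+\frac{\log 2}{\log(3\alpha)}$. **Lorenz maps.** A Lorenz map $f:[0,1]\setminus\{c\}\to[0,1]$ with critical point $\operatorname{crit}(f)=c\in(0,1)$ is given by $f=\phi_-\circ q$ on $[0,c)$ and $f=\phi_+\circ q$ on $(c,1]$, where $q(x)=u\bigl(1-(\tfrac{c-x}{c})^\alpha\bigr)$ for $x<c$, $q(x)=1+v\bigl(-1+(\tfrac{x-c}{1-c})^\alpha\bigr)$ for $x>c$, $u,v\in[0,1]$, and the diffeomorphic parts $\phi_\pm$ are increasing $C^3$ diffeomorphisms of $[0,1]$ with Schwarzian derivative $\le 0$; moreover $0$ and $1$ are the only fixed points of $f$. Its critical values are $f_\pm(c)=\lim_{x\to c^\pm}f(x)$. It is nontrivial if $f_+(c)<c<f_-(c)$, and full if $f_-(c)=1$ and $f_+(c)=0$. It is $\varepsilon$-close to standard maps if $\phi_\pm$, $\phi_\pm'$, $\phi_\pm''$ are within $\varepsilon$ of $x$, $1$, $0$ on $[0,1]$. **Renormalization.** For integers $a,b\ge1$, $f$ is $(a,b)$-renormalizable with renormalization $\mathcal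 Rf$ if there is an interval $C=[l,r]\subsetneq[0,1]$ with $l<c<r$ such that the first-return map to $C$ is $f^{a+1}$ on $C\cap[0,c)$ and $f^{b+1}$ on $C\cap(c,1]$, the intermediate iterates of $C\cap[0,c)$ lie to the right of $c$, those of $C\cap(c,1]$ to the left of $c$, both outside the interior of $C$, and this first-return map, affinely rescaled to $[0,1]$, is a nontrivial Lorenz map $\mathcal Rf$ (with the same exponent $\alpha$). **Families.** An analytic family is a family $(F_\lambda)_{\lambda\in U}$ of Lorenz maps over a compact, simply connected, semianalytic set $U\subset\mathbb R^2$, such that $c,u,v$ extend real-analytically in $\lambda$ to a neighbourhood of $U$ and $\phi_\pm(\lambda,x)$ extend real-analytically in $(\lambda,x)$ to a neighbourhood of $U\times[0,1]$; every $F_\lambda$ satisfies $F_{\lambda,+}(c)\le c\le F_{\lambda,-}(c)$, and is nontrivial when $\lambda$ is interior to $U$. A full vertex of type $(a,b)$ is a parameter $\lambda\in U$ for which $F_\lambda$ is $(a,b)$-renormalizable and $\mathcal RF_\lambda$ is full; we write $f_{a,b}=F_\lambda$ for any such $\lambda$. **Statement.** There is $\varepsilon>0$, depending only on $\alpha$,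 such that the following holds for every analytic family all of whose maps are $\varepsilon$-close to standard maps and which contains exactly one full map $\hat f$ (that is, exactly one $\hat\lambda\in U$ with $F_{\hat\lambda}$ full); put $\hat c=\operatorname{crit}(\hat f)$. (A) If $\hat c\ge\frac23$, there are $\theta>\theta_\alpha>1$ and integers $N,n,m$ such that for every $a\ge N$ the integers $\lfloor\theta a\rfloor-n$ and $\lfloor\theta a\rfloor-m$ are at least $1$, and 1. if $b=\lfloor\theta a\rfloor-n$, then $\frac18\le\operatorname{crit}(\mathcal Rf_{a,b})\le\frac13$ for every full vertex of type $(a,b)$; 2. if $b=\lfloor\theta a\rfloor-m$, then $\operatorname{crit}(\mathcal Rf_{a,b})\ge\frac23$ for every full vertex of type $(a,b)$. (B) If $\hat c\le\frac13$, there are $\theta>\theta_\alpha>1$ and integers $N,n,m$ such that for every $b\ge N$ the integers $\lfloor\theta b\rfloor-n$ and $\lfloor\theta b\rfloor-m$ are at least $1$, and 1. if $a=\lfloor\theta b\rfloor-n$, then $\frac23\le\operatorname{crit}(\mathcal Rf_{a,b})\le\frac78$ for every full vertex of type $(a,b)$; 2. if $a=\lfloor\theta b\rfloor-m$, then $\operatorname{crit}(\mathcal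 Rf_{a,b})\le\frac13$ for every full vertex of type $(a,b)$. -/

import Mathlib

open Set Filter Topology

noncomputable section

/-- The data of a Lorenz map on `[0,1]`: critical point `c`, the numbers `u`, `v` that fix the
critical values of the standard part, and the two diffeomorphic parts. -/
structure LorenzData where
  c : ℝ
  u : ℝ
  v : ℝ
  phiL : ℝ → ℝ
  phiR : ℝ → ℝ

/-- The Schwarzian derivative of `φ` on `[0,1]` (one-sided derivatives at the end points). -/
def schwarzian (φ : ℝ → ℝ) (x : ℝ) : ℝ :=
  iteratedDerivWithin 3 φ (Icc 0 1) x / iteratedDerivWithin 1 φ (Icc 0 1) x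
    - 3 / 2 * (iteratedDerivWithin 2 φ (Icc 0 1) x / iteratedDerivWithin 1 φ (Icc 0 1) x) ^ 2

/-- `φ` restricts to an increasing `C^3` diffeomorphism of `[0,1]` without positive Schwarzian
derivative. Equality to zero is allowed, so that the identity qualifies. -/
structure IsDiffeoPart (φ : ℝ → ℝ) : Prop where
  contDiffOn : ContDiffOn ℝ 3 φ (Icc 0 1)
  map_zero : φ 0 = 0
  map_one : φ 1 = 1
  deriv_pos : ∀ x ∈ Icc (0 : ℝ) 1, 0 < iteratedDerivWithin 1 φ (Icc 0 1) x
  schwarzian_nonpos : ∀ x ∈ Icc (0 : ℝ) 1, schwarzian φ x ≤ 0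

/-- The `C^2` distance on `[0,1]` from `φ` to the identity is at most `ε`. -/
def IsC2CloseToId (ε : ℝ) (φ : ℝ → ℝ) : Prop :=
  ∀ x ∈ Icc (0 : ℝ) 1, |φ x - x| ≤ ε ∧ |iteratedDerivWithin 1 φ (Icc 0 1) x - 1| ≤ ε ∧
    |iteratedDerivWithin 2 φ (Icc 0 1) x| ≤ ε

namespace LorenzData

/-- The standard Lorenz map with critical exponent `α`. Its value at `c` itself is irrelevant. -/
def std (α : ℝ) (f : LorenzData) (x : ℝ) : ℝ :=
  if x < f.c then f.u * (1 - ((f.c - x) / f.c) ^ α)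
  else 1 + f.v * (-1 + ((x - f.c) / (1 - f.c)) ^ α)

/-- The Lorenz map on `[0,1] \ {c}`. Its value at `c` itself is irrelevant. -/
def map (α : ℝ) (f : LorenzData) (x : ℝ) : ℝ :=
  if x < f.c then f.phiL (f.std α x) else f.phiR (f.std α x)

/-- The left critical value, the limit of the map at `c` from the left. -/
def critValL (f : LorenzData) : ℝ := f.phiL f.u

/-- The right critical value, the limit of the map at `c` from the right. -/
def critValR (f : LorenzData) : ℝ := f.phiR (1 - f.v)

/-- `f` is a Lorenz map with critical exponent `α`, whose only fixed points are `0` and `1`. -/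
structure IsLorenz (α : ℝ) (f : LorenzData) : Prop where
  c_mem : f.c ∈ Ioo (0 : ℝ) 1
  u_mem : f.u ∈ Icc (0 : ℝ) 1
  v_mem : f.v ∈ Icc (0 : ℝ) 1
  phiL : IsDiffeoPart f.phiL
  phiR : IsDiffeoPart f.phiR
  fixed : ∀ x ∈ Icc (0 : ℝ) 1, x ≠ f.c → f.map α x = x → x = 0 ∨ x = 1

def IsNontrivial (f : LorenzData) : Prop := f.critValR < f.c ∧ f.c < f.critValL

/-- Both branches are onto `[0,1]`. -/
def IsFull (f : LorenzData) : Prop := f.critValL = 1 ∧ f.critValR = 0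

def IsCloseToStandard (ε : ℝ) (f : LorenzData) : Prop :=
  IsC2CloseToId ε f.phiL ∧ IsC2CloseToId ε f.phiR

/-- `f` is `(a,b)`-renormalizable (of monotone type) with renormalization `g`: for a closed
interval `C = [l,r]`, properly contained in `[0,1]` and with `c` in its interior, the first-return
map to `C` is `f^(a+1)` on `C ∩ [0,c)` and `f^(b+1)` on `C ∩ (c,1]`, with the intermediate iterates
to the right and to the left of `c` respectively, and it becomes the nontrivial Lorenz map `g` when
`C` is affinely rescaled to `[0,1]`.  The intermediate iterates avoid the interior of `C`; an end
point of `C` may be hit by them, as happens for `a = b = 1`, where the two end points form a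
single cycle. -/
def IsRenormalization (α : ℝ) (a b : ℕ) (f g : LorenzData) : Prop :=
  1 ≤ a ∧ 1 ≤ b ∧ g.IsLorenz α ∧ g.IsNontrivial ∧
    ∃ l r : ℝ, 0 ≤ l ∧ l < f.c ∧ f.c < r ∧ r ≤ 1 ∧ r - l < 1 ∧
      g.c = (f.c - l) / (r - l) ∧
      (∀ x ∈ Ico l f.c,
        (∀ i : ℕ, 1 ≤ i → i ≤ a → f.c < (f.map α)^[i] x ∧ (f.map α)^[i] x ∉ Ioo l r) ∧
        (f.map α)^[a + 1] x = l + (r - l) * g.map α ((x - l) / (r - l))) ∧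
      (∀ x ∈ Ioc f.c r,
        (∀ i : ℕ, 1 ≤ i → i ≤ b → (f.map α)^[i] x < f.c ∧ (f.map α)^[i] x ∉ Ioo l r) ∧
        (f.map α)^[b + 1] x = l + (r - l) * g.map α ((x - l) / (r - l)))

end LorenzData

/-- A semianalytic subset of the plane: near every point it is a finite union of sets
`{f = 0, g₁ > 0, …, g_k > 0}` with real analytic `f, g₁, …, g_k`. -/
def IsSemianalytic (S : Set (ℝ × ℝ)) : Prop :=
  ∀ p : ℝ × ℝ, ∃ W ∈ 𝓝 p, ∃ (m k : ℕ) (f : Fin m → ℝ × ℝ → ℝ) (g : Fin m → Fin k → ℝ × ℝ → ℝ),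
    (∀ i, AnalyticOnNhd ℝ (f i) W) ∧ (∀ i j, AnalyticOnNhd ℝ (g i j) W) ∧
    ∀ x ∈ W, x ∈ S ↔ ∃ i, f i x = 0 ∧ ∀ j, 0 < g i j x

/-- An analytic family of Lorenz maps with parameter domain `U`.  Only the values of `F` on `U`
are Lorenz maps; those off `U` serve to express that the data extend analytically to a
neighbourhood of `U` (of `U × [0,1]` for the diffeomorphic parts).  Maps with trivial branches
are allowed on the boundary of `U`; all others are nontrivial. -/
structure IsAnalyticFamily (α : ℝ) (U : Set (ℝ × ℝ)) (F : ℝ × ℝ → LorenzData) : Prop where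
  isCompact : IsCompact U
  simplyConnected : SimplyConnectedSpace U
  semianalytic : IsSemianalytic U
  isLorenz : ∀ p ∈ U, (F p).IsLorenz α
  critVal_le : ∀ p ∈ U, (F p).critValR ≤ (F p).c ∧ (F p).c ≤ (F p).critValL
  nontrivial : ∀ p ∈ interior U, (F p).IsNontrivial
  analytic_c : AnalyticOnNhd ℝ (fun p => (F p).c) U
  analytic_u : AnalyticOnNhd ℝ (fun p => (F p).u) U
  analytic_v : AnalyticOnNhd ℝ (fun p => (F p).v) U
  analytic_phiL :
    AnalyticOnNhd ℝ (fun z : (ℝ × ℝ) × ℝ => (F z.1).phiL z.2) (U ×ˢ Icc (0 : ℝ) 1)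
  analytic_phiR :
    AnalyticOnNhd ℝ (fun z : (ℝ × ℝ) × ℝ => (F z.1).phiR z.2) (U ×ˢ Icc (0 : ℝ) 1)

/-- `p` is the unique parameter in `U` whose map is full. -/
def IsUniqueFullParam (U : Set (ℝ × ℝ)) (F : ℝ × ℝ → LorenzData) (p : ℝ × ℝ) : Prop :=
  p ∈ U ∧ (F p).IsFull ∧ ∀ p' ∈ U, (F p').IsFull → p' = p

/-- `p` belongs to the `(a,b)`-archipelago, the set of parameters in `U` whose map is
`(a,b)`-renormalizable, and the renormalization `g` at `p` is full. The full vertex of any full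
island of type `(a,b)` is such a parameter. -/
def IsFullVertex (α : ℝ) (U : Set (ℝ × ℝ)) (F : ℝ × ℝ → LorenzData) (a b : ℕ)
    (p : ℝ × ℝ) (g : LorenzData) : Prop :=
  p ∈ U ∧ (F p).IsRenormalization α a b g ∧ g.IsFull

/-- `θ_α = 1 + log 2 / log (3 α)`. -/
def thetaCrit (α : ℝ) : ℝ := 1 + Real.log 2 / Real.log (3 * α)

end

/-!
At a full map the fixed points `0` and `1` are repelling, with multipliers `μ₀` and `μ₁`, and the
two branches can be linearized there, uniformly in the parameter. For a full vertex of type `(a, b)`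
the end points of the return interval `[l, r]` have orbits that spend almost all of their `a`
(resp. `b`) steps near `1` (resp. `0`), so `1 - f l` and `f r` are exponentially small. A
full vertex is therefore a parameter at which an analytic function vanishing on the semianalytic
parameter set only at the full map is exponentially small in `a` and `b`; by a Łojasiewicz
inequality, obtained from Weierstrass division, the parameter is itself exponentially close to the
full map. So the multipliers at the vertex may be replaced by `μ₀` and `μ₁` even when raised to the
powers `a` and `b`, and the log-odds `log (x / (1 - x))` of the critical point `x` of the
renormalization satisfy `α * log (x / (1 - x)) = b * log μ₀ - a * log μ₁ + κ + o(1)`.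

Take `θ = log μ₁ / log μ₀` and `b = ⌊θ * a⌋ - n`: the log-odds then stay in a window of length
`log μ₀ / α` whose position is chosen by `n`. If the critical point of the full map is at least
`2 / 3`, then `μ₀` is nearly at most `3 / 2 * α` and `μ₁` nearly at least `3 * α`, which yields both
`θ > θ_α` and a window short enough to fit. Reflection in `1 / 2` exchanges (A) and (B).
-/

noncomputable section

/-! ### Weierstrass division for absolutely summable power series -/

/-- The ring of power series over a normed ring whose coefficients are absolutely summable. -/
def SummableSeries (R : Type*) [NormedCommRing R] : Subring (PowerSeries R) where
  carrier := {p | Summable fun n => ‖PowerSeries.coeff n p‖}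
  mul_mem' {p q} hp hq := by
    simpa only [mem_ofPred_eq, PowerSeries.coeff_mul] using
      summable_norm_sum_mul_antidiagonal_of_summable_norm hp hq
  one_mem' := by
    refine summable_of_ne_finset_zero (s := {0}) fun n hn => ?_
    rw [PowerSeries.coeff_one, if_neg (by simpa using hn), norm_zero]
  add_mem' {p q} hp hq := by
    refine Summable.of_nonneg_of_le (fun _ => norm_nonneg _) (fun n => ?_) (hp.add hq)
    rw [map_add]
    exact norm_add_le _ _
  zero_mem' := by simp [summable_zero]
  neg_mem' {p} hp := by simpa only [mem_ofPred_eq, map_neg, norm_neg] using hp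

namespace SummableSeries

variable {R : Type*} [NormedCommRing R]

/-- The coefficients of an absolutely summable power series. -/
def coeff (n : ℕ) : SummableSeries R →+ R :=
  (PowerSeries.coeff (R := R) n).toAddMonoidHom.comp (SummableSeries R).subtype.toAddMonoidHom

theorem summable_norm (p : SummableSeries R) : Summable fun n => ‖coeff n p‖ := p.2

/-- The power series with given absolutely summable coefficients. -/
def mk (a : ℕ → R) (ha : Summable fun n => ‖a n‖) : SummableSeries R :=
  ⟨PowerSeries.mk a, by
    change Summable _
    simpa only [PowerSeries.coeff_mk] using ha⟩

@[simp] theorem coeff_mk (a : ℕ → R) (ha : Summable fun n => ‖a n‖) (n : ℕ) :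
    coeff n (mk a ha) = a n := PowerSeries.coeff_mk n a

@[ext] theorem ext {p q : SummableSeries R} (h : ∀ n, coeff n p = coeff n q) : p = q :=
  Subtype.ext (PowerSeries.ext h)

theorem coeff_mul (n : ℕ) (p q : SummableSeries R) :
    coeff n (p * q) = ∑ k ∈ Finset.HasAntidiagonal.antidiagonal n, coeff k.1 p * coeff k.2 q :=
  PowerSeries.coeff_mul n _ _

theorem coeff_one (n : ℕ) : coeff n (1 : SummableSeries R) = if n = 0 then 1 else 0 :=
  PowerSeries.coeff_one n

instance : NormedCommRing (SummableSeries R) :=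
  { (inferInstance : CommRing (SummableSeries R)),
    (AddGroupNorm.toNormedAddCommGroup
      { toFun := fun p => ∑' n, ‖coeff n p‖
        map_zero' := by simp
        add_le' := fun p q => by
          rw [← (summable_norm p).tsum_add (summable_norm q)]
          refine (summable_norm (p + q)).tsum_le_tsum (fun n => ?_)
            ((summable_norm p).add (summable_norm q))
          rw [map_add]
          exact norm_add_le _ _
        neg' := fun p => by simp
        eq_zero_of_map_eq_zero' := fun p hp => by
          ext n
          have h := (summable_norm p).hasSum
          rw [hp, hasSum_zero_iff_of_nonneg fun n => norm_nonneg _] at h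
          simpa using congrFun h n } : NormedAddCommGroup (SummableSeries R)) with
    norm_mul_le := fun p q => by
      change ∑' n, ‖coeff n (p * q)‖ ≤ (∑' n, ‖coeff n p‖) * ∑' n, ‖coeff n q‖
      have h := summable_norm_sum_mul_antidiagonal_of_summable_norm
        (f := fun n => ‖coeff n p‖) (g := fun n => ‖coeff n q‖)
        (by simpa using summable_norm p) (by simpa using summable_norm q)
      rw [tsum_mul_tsum_eq_tsum_sum_antidiagonal_of_summable_norm
        (by simpa using summable_norm p) (by simpa using summable_norm q)]
      refine (summable_norm (p * q)).tsum_le_tsum (fun n => ?_) h.of_norm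
      rw [coeff_mul]
      exact (norm_sum_le _ _).trans (Finset.sum_le_sum fun k _ => norm_mul_le _ _) }

theorem norm_def (p : SummableSeries R) : ‖p‖ = ∑' n, ‖coeff n p‖ := rfl

instance [NormOneClass R] : NormOneClass (SummableSeries R) where
  norm_one := by
    rw [norm_def, tsum_eq_single 0 fun n hn => by rw [coeff_one, if_neg hn, norm_zero], coeff_one,
      if_pos rfl, norm_one]

instance [CompleteSpace R] : CompleteSpace (SummableSeries R) := by
  let Φ : SummableSeries R → lp (fun _ : ℕ => R) 1 := fun p =>
    ⟨fun n => coeff n p, memℓp_gen (by simpa using summable_norm p)⟩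
  have hiso : Isometry Φ := by
    refine Isometry.of_dist_eq fun p q => ?_
    rw [dist_eq_norm, dist_eq_norm, lp.norm_eq_tsum_rpow (by simp), norm_def]
    simp only [ENNReal.toReal_one, Real.rpow_one, div_one, map_sub, Φ]
    rfl
  have hsurj : Function.Surjective Φ := fun f => by
    have hf : Summable fun n => ‖f n‖ := by
      simpa using (lp.memℓp f).summable (by simp)
    exact ⟨mk f hf, Subtype.ext (funext fun n => coeff_mk _ _ n)⟩
  exact (hiso.isUniformInducing.completeSpace_congr hsurj).2 inferInstance

/-- Constant power series. -/
def const : R →+* SummableSeries R :=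
  (PowerSeries.C (R := R)).codRestrict (SummableSeries R) fun a => by
    refine summable_of_ne_finset_zero (s := {0}) fun n hn => ?_
    rw [PowerSeries.coeff_C, if_neg (by simpa using hn), norm_zero]

theorem coeff_const (n : ℕ) (a : R) : coeff n (const a) = if n = 0 then a else 0 :=
  PowerSeries.coeff_C n a

theorem norm_const (a : R) : ‖(const a : SummableSeries R)‖ = ‖a‖ := by
  rw [norm_def, tsum_eq_single 0 fun n hn => by rw [coeff_const, if_neg hn, norm_zero],
    coeff_const, if_pos rfl]

/-- The monomial `Y ^ d`. -/
def monomial (d : ℕ) : SummableSeries R :=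
  ⟨(PowerSeries.X : PowerSeries R) ^ d, by
    refine summable_of_ne_finset_zero (s := {d}) fun n hn => ?_
    rw [PowerSeries.coeff_X_pow, if_neg (by simpa using hn), norm_zero]⟩

theorem coeff_monomial (n d : ℕ) :
    coeff n (monomial d : SummableSeries R) = if n = d then 1 else 0 :=
  PowerSeries.coeff_X_pow n d

theorem coeff_const_mul (n : ℕ) (a : R) (p : SummableSeries R) :
    coeff n (const a * p) = a * coeff n p :=
  PowerSeries.coeff_C_mul n _ a

theorem coeff_mul_monomial (n d : ℕ) (p : SummableSeries R) :
    coeff (n + d) (p * monomial d) = coeff n p :=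
  PowerSeries.coeff_mul_X_pow (p : PowerSeries R) d n

/-- The series obtained by deleting the terms of degree less than `d` and dividing by `Y ^ d`. -/
def shift (d : ℕ) : SummableSeries R →+ SummableSeries R where
  toFun p := mk (fun n => coeff (n + d) p) ((summable_nat_add_iff d).2 (summable_norm p))
  map_zero' := by ext; simp
  map_add' p q := by ext; simp

@[simp] theorem coeff_shift (n d : ℕ) (p : SummableSeries R) :
    coeff n (shift d p) = coeff (n + d) p := by
  unfold shift
  exact coeff_mk (fun n => coeff (n + d) p) ((summable_nat_add_iff d).2 (summable_norm p)) n

theorem norm_shift_le (d : ℕ) (p : SummableSeries R) : ‖shift d p‖ ≤ ‖p‖ := by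
  rw [norm_def, norm_def]
  simp only [coeff_shift]
  exact tsum_comp_le_tsum_of_inj (summable_norm p) (fun _ => norm_nonneg _)
    (add_left_injective d)

theorem shift_mul_monomial (d : ℕ) (p : SummableSeries R) : shift d (p * monomial d) = p := by
  ext n
  rw [coeff_shift, coeff_mul_monomial]

theorem shift_mul_monomial_add_sum (d : ℕ) (p : SummableSeries R) :
    shift d p * monomial d + ∑ j ∈ Finset.range d, const (coeff j p) * monomial j = p := by
  ext n
  have hsum : coeff n (∑ j ∈ Finset.range d, const (coeff j p) * monomial j)
      = if n < d then coeff n p else 0 := by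
    simp only [map_sum, coeff_const_mul, coeff_monomial, mul_ite, mul_one, mul_zero,
      Finset.sum_ite_eq, Finset.mem_range]
  rw [map_add, hsum]
  split_ifs with h
  · have : coeff n (shift d p * monomial d) = 0 := by
      rw [coeff_mul]
      refine Finset.sum_eq_zero fun k hk => ?_
      have := Finset.HasAntidiagonal.mem_antidiagonal.1 hk
      rw [coeff_monomial, if_neg (by omega), mul_zero]
    rw [this, zero_add]
  · obtain ⟨k, rfl⟩ := Nat.exists_eq_add_of_le' (not_lt.1 h)
    rw [coeff_mul_monomial, coeff_shift, add_zero]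

theorem exists_eq_mul_add_sum [CompleteSpace R] {d : ℕ} {Q : SummableSeries R}
    (hQ : ‖Q - monomial d‖ < 1) (G : SummableSeries R) :
    ∃ (k : SummableSeries R) (r : ℕ → R),
      G = k * Q + ∑ j ∈ Finset.range d, const (r j) * monomial j := by
  -- The quotient is the fixed point of the contraction that divides `G - k * W` by `Y ^ d`.
  set W := Q - monomial d with hW
  let T : SummableSeries R → SummableSeries R := fun k => shift d (G - k * W)
  have hT : ContractingWith ‖W‖₊ T := by
    refine ⟨by exact_mod_cast hQ, LipschitzWith.of_dist_le_mul fun k k' => ?_⟩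
    have hsub : T k - T k' = shift d ((k' - k) * W) := by
      simp only [T, sub_mul, map_sub]; abel
    rw [dist_eq_norm, dist_eq_norm, hsub, coe_nnnorm, mul_comm, norm_sub_rev k k']
    exact (norm_shift_le _ _).trans (norm_mul_le _ _)
  obtain ⟨k, hk⟩ : ∃ k, T k = k := ⟨_, hT.fixedPoint_isFixedPt⟩
  have hshift : shift d (G - k * Q) = 0 := by
    have hQW : G - k * Q = (G - k * W) - k * monomial d := by rw [hW]; ring
    rw [hQW, map_sub, shift_mul_monomial]
    exact sub_eq_zero.2 hk
  refine ⟨k, fun j => coeff j (G - k * Q), ?_⟩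
  have h := shift_mul_monomial_add_sum d (G - k * Q)
  rw [hshift, zero_mul, zero_add] at h
  rw [h, add_sub_cancel]

theorem exists_monic_eval₂_eq_mul [CompleteSpace R] {d : ℕ} {Q : SummableSeries R}
    (hQ : ‖Q - monomial d‖ < 1) (h : SummableSeries R) :
    ∃ χ : Polynomial R, χ.Monic ∧ ∃ k, χ.eval₂ const h = k * Q := by
  let I : Ideal (SummableSeries R) := Ideal.span {Q}
  let f : R →+* SummableSeries R ⧸ I := (Ideal.Quotient.mk I).comp const
  have hfin : f.Finite := by
    classical
    let := f.toAlgebra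
    refine ⟨⟨(Finset.range d).image fun j => Ideal.Quotient.mk I (monomial j), ?_⟩⟩
    rw [eq_top_iff]
    rintro x -
    obtain ⟨G, rfl⟩ := Ideal.Quotient.mk_surjective x
    obtain ⟨k, r, hG⟩ := exists_eq_mul_add_sum hQ G
    have hkQ : Ideal.Quotient.mk I (k * Q) = 0 :=
      Ideal.Quotient.eq_zero_iff_mem.2 (Ideal.mul_mem_left _ _ (Ideal.mem_span_singleton_self Q))
    rw [hG, map_add, hkQ, zero_add, map_sum]
    refine Submodule.sum_mem _ fun j hj => ?_
    rw [map_mul]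
    exact Submodule.smul_mem _ (r j) (Submodule.subset_span (by
      simp only [Finset.coe_image, mem_image]
      exact ⟨j, by simpa using hj, rfl⟩))
  obtain ⟨χ, hχ, h0⟩ := hfin.to_isIntegral (Ideal.Quotient.mk I h)
  refine ⟨χ, hχ, ?_⟩
  have : Ideal.Quotient.mk I (χ.eval₂ const h) = 0 := by
    rw [Polynomial.hom_eval₂]; exact h0
  rw [Ideal.Quotient.eq_zero_iff_mem, Ideal.mem_span_singleton'] at this
  obtain ⟨k, hk⟩ := this
  exact ⟨k, hk.symm⟩

section eval

variable [NormOneClass R]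

theorem summable_norm_coeff_mul_pow (p : SummableSeries R) {x : R} (hx : ‖x‖ ≤ 1) :
    Summable fun n => ‖coeff n p * x ^ n‖ := by
  refine Summable.of_nonneg_of_le (fun _ => norm_nonneg _) (fun n => ?_) (summable_norm p)
  refine (norm_mul_le _ _).trans (mul_le_of_le_one_right (norm_nonneg _) ?_)
  exact (norm_pow_le _ _).trans (pow_le_one₀ (norm_nonneg _) hx)

variable [CompleteSpace R]

/-- Evaluation of an absolutely summable power series at a point of the unit ball. -/
def eval (x : R) (hx : ‖x‖ ≤ 1) : SummableSeries R →+* R where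
  toFun p := ∑' n, coeff n p * x ^ n
  map_zero' := by simp
  map_one' := by
    rw [tsum_eq_single 0 fun n hn => by rw [coeff_one, if_neg hn, zero_mul]]
    simp [coeff_one]
  map_add' p q := by
    rw [← (summable_norm_coeff_mul_pow p hx).of_norm.tsum_add
      (summable_norm_coeff_mul_pow q hx).of_norm]
    simp only [map_add, add_mul]
  map_mul' p q := by
    rw [tsum_mul_tsum_eq_tsum_sum_antidiagonal_of_summable_norm
      (summable_norm_coeff_mul_pow p hx) (summable_norm_coeff_mul_pow q hx)]
    refine tsum_congr fun n => ?_
    rw [coeff_mul, Finset.sum_mul]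
    refine Finset.sum_congr rfl fun k hk => ?_
    rw [← Finset.HasAntidiagonal.mem_antidiagonal.1 hk, pow_add]
    ring

theorem eval_apply (x : R) (hx : ‖x‖ ≤ 1) (p : SummableSeries R) :
    eval x hx p = ∑' n, coeff n p * x ^ n := rfl

theorem eval_const (x : R) (hx : ‖x‖ ≤ 1) (a : R) : eval x hx (const a) = a := by
  rw [eval_apply, tsum_eq_single 0 fun n hn => by rw [coeff_const, if_neg hn, zero_mul]]
  simp [coeff_const]

theorem norm_eval_le (x : R) (hx : ‖x‖ ≤ 1) (p : SummableSeries R) : ‖eval x hx p‖ ≤ ‖p‖ := by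
  refine (norm_tsum_le_tsum_norm (summable_norm_coeff_mul_pow p hx)).trans
    ((summable_norm_coeff_mul_pow p hx).tsum_le_tsum (fun n => ?_) (summable_norm p))
  refine (norm_mul_le _ _).trans (mul_le_of_le_one_right (norm_nonneg _) ?_)
  exact (norm_pow_le _ _).trans (pow_le_one₀ (norm_nonneg _) hx)

theorem eval_monomial (x : R) (hx : ‖x‖ ≤ 1) (d : ℕ) :
    eval x hx (monomial d) = x ^ d := by
  rw [eval_apply, tsum_eq_single d fun n hn => by rw [coeff_monomial, if_neg hn, zero_mul]]
  simp [coeff_monomial]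

end eval

theorem exists_eq_mul_monomial {p : SummableSeries R} (hp : p ≠ 0) :
    ∃ (m : ℕ) (q : SummableSeries R), coeff 0 q ≠ 0 ∧ p = q * monomial m := by
  classical
  have hex : ∃ n, coeff n p ≠ 0 := by
    by_contra! h
    exact hp (ext h)
  refine ⟨Nat.find hex, shift (Nat.find hex) p, ?_, ?_⟩
  · rw [coeff_shift, zero_add]
    exact Nat.find_spec hex
  · have hsum : ∑ j ∈ Finset.range (Nat.find hex), const (coeff j p) * monomial j = 0 :=
      Finset.sum_eq_zero fun j hj => by
        rw [not_not.1 (Nat.find_min hex (Finset.mem_range.1 hj)), map_zero, zero_mul]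
    simpa only [hsum, add_zero] using (shift_mul_monomial_add_sum (Nat.find hex) p).symm

theorem eval_sub_coeff_zero [NormOneClass R] [CompleteSpace R] (x : R) (hx : ‖x‖ ≤ 1)
    (p : SummableSeries R) : eval x hx p - coeff 0 p = eval x hx (shift 1 p) * x := by
  have h := congrArg (eval x hx) (shift_mul_monomial_add_sum 1 p)
  simp only [Finset.range_one, Finset.sum_singleton, map_add, map_mul, eval_const, eval_monomial,
    pow_one, pow_zero, mul_one] at h
  rw [← h, add_sub_cancel_right]

theorem exists_le_abs_eval {p : SummableSeries ℝ} (hp : p ≠ 0) :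
    ∃ (m : ℕ) (c δ : ℝ), 0 < c ∧ 0 < δ ∧ ∀ (x : ℝ) (hx : ‖x‖ ≤ 1), |x| ≤ δ →
      c * |x| ^ m ≤ |eval x hx p| := by
  obtain ⟨m, q, hq0, rfl⟩ := exists_eq_mul_monomial hp
  have := abs_pos.2 hq0
  set M := ‖shift 1 q‖ + 1
  have hM0 : 0 < M := by positivity
  refine ⟨m, |coeff 0 q| / 2, |coeff 0 q| / (2 * M), by positivity, by positivity,
    fun x hx hxδ => ?_⟩
  have hsub : |eval x hx q - coeff 0 q| ≤ |coeff 0 q| / 2 := by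
    rw [eval_sub_coeff_zero, abs_mul]
    have hM : |eval x hx (shift 1 q)| ≤ M := (norm_eval_le x hx _).trans (by simp [M])
    calc _ ≤ M * (|coeff 0 q| / (2 * M)) :=
          mul_le_mul hM hxδ (abs_nonneg _) (by positivity)
      _ = _ := by field_simp
  rw [map_mul, eval_monomial, abs_mul, abs_pow]
  refine mul_le_mul_of_nonneg_right ?_ (by positivity)
  have := abs_sub_abs_le_abs_sub (coeff 0 q) (eval x hx q)
  rw [abs_sub_comm] at this
  linarith

end SummableSeries

/-! ### Real analytic functions of two variables as double power series -/

/-- The coefficient of `x ^ i * y ^ (n - i)` in the binary form `p n (z, …, z)`, `z = (x, y)`,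
defined by the term of degree `n` of a formal multilinear series. -/
def binaryFormCoeff (p : FormalMultilinearSeries ℝ (ℝ × ℝ) ℝ) (n i : ℕ) : ℝ :=
  ∑ S ∈ Finset.powersetCard i (Finset.univ : Finset (Fin n)),
    p n (S.piecewise (fun _ => ((1 : ℝ), (0 : ℝ))) (fun _ => ((0 : ℝ), (1 : ℝ))))

theorem abs_binaryFormCoeff_le (p : FormalMultilinearSeries ℝ (ℝ × ℝ) ℝ) (n i : ℕ) :
    |binaryFormCoeff p n i| ≤ n.choose i * ‖p n‖ := by
  classical
  refine (Finset.abs_sum_le_sum_abs _ _).trans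
    ((Finset.sum_le_sum (g := fun _ => ‖p n‖) fun S _ => ?_).trans (by simp))
  refine ((p n).le_opNorm _).trans (mul_le_of_le_one_right (norm_nonneg _) ?_)
  refine Finset.prod_le_one (fun _ _ => norm_nonneg _) fun i _ => ?_
  by_cases hi : i ∈ S <;> simp [hi, Prod.norm_def]

theorem apply_piecewise_eq {n : ℕ} (q : (ℝ × ℝ) [×n]→L[ℝ] ℝ) (S : Finset (Fin n)) (x y : ℝ) :
    q (S.piecewise (fun _ => (x, (0 : ℝ))) (fun _ => ((0 : ℝ), y))) =
      q (S.piecewise (fun _ => ((1 : ℝ), (0 : ℝ))) (fun _ => ((0 : ℝ), (1 : ℝ)))) *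
        x ^ S.card * y ^ (n - S.card) := by
  classical
  have hsmul : S.piecewise (fun _ => (x, (0 : ℝ))) (fun _ => ((0 : ℝ), y)) = fun k =>
      (if k ∈ S then x else y) •
        S.piecewise (fun _ => ((1 : ℝ), (0 : ℝ))) (fun _ => ((0 : ℝ), (1 : ℝ))) k := by
    funext k
    by_cases hk : k ∈ S <;> simp [hk]
  have hprod : ∏ k, (if k ∈ S then x else y) = x ^ S.card * y ^ (n - S.card) := by
    rw [Finset.prod_ite, Finset.prod_const, Finset.prod_const, Finset.filter_not,
      Finset.filter_univ_mem, Finset.card_sdiff_of_subset (Finset.subset_univ S), Finset.card_univ,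
      Fintype.card_fin]
  rw [hsmul, ContinuousMultilinearMap.map_smul_univ, hprod, smul_eq_mul]
  ring

theorem apply_diag_eq_sum_binaryFormCoeff (p : FormalMultilinearSeries ℝ (ℝ × ℝ) ℝ) (n : ℕ)
    (x y : ℝ) :
    p n (fun _ => (x, y)) = ∑ z ∈ Finset.HasAntidiagonal.antidiagonal n,
      binaryFormCoeff p n z.1 * x ^ z.1 * y ^ z.2 := by
  classical
  have hadd : (fun _ : Fin n => (x, y)) = (fun _ => (x, (0 : ℝ))) + fun _ => ((0 : ℝ), y) := by
    ext <;> simp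
  rw [hadd, ContinuousMultilinearMap.map_add_univ, ← Finset.powerset_univ, Finset.sum_powerset,
    Finset.Nat.sum_antidiagonal_eq_sum_range_succ_mk, Finset.card_univ, Fintype.card_fin]
  refine Finset.sum_congr rfl fun i _ => ?_
  rw [binaryFormCoeff, Finset.sum_mul, Finset.sum_mul]
  refine Finset.sum_congr rfl fun S hS => ?_
  rw [apply_piecewise_eq, (Finset.mem_powersetCard.1 hS).2]

theorem summable_abs_binaryFormCoeff_mul_pow {p : FormalMultilinearSeries ℝ (ℝ × ℝ) ℝ} {s : ℝ}
    (hs : 0 ≤ s) (hp : Summable fun n => ‖p n‖ * s ^ n) :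
    Summable fun z : ℕ × ℕ =>
      |binaryFormCoeff p (z.1 + z.2) z.1| * (s / 2) ^ (z.1 + z.2) := by
  rw [← Finset.HasAntidiagonal.sigmaAntidiagonalEquivProd.summable_iff,
    summable_sigma_of_nonneg fun z => by dsimp; positivity]
  refine ⟨fun n => (hasSum_fintype _).summable, ?_⟩
  refine Summable.of_nonneg_of_le (fun n => tsum_nonneg fun z => by dsimp; positivity)
    (fun n => ?_) hp
  rw [tsum_fintype]
  calc ∑ z : Finset.HasAntidiagonal.antidiagonal n, _
      ≤ ∑ z : Finset.HasAntidiagonal.antidiagonal n,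
          (n.choose z.1.1 : ℝ) * (‖p n‖ * (s / 2) ^ n) := by
        refine Finset.sum_le_sum fun z _ => ?_
        have hz := Finset.HasAntidiagonal.mem_antidiagonal.1 z.2
        simp only [Function.comp, Finset.HasAntidiagonal.sigmaAntidiagonalEquivProd_apply, hz]
        rw [← mul_assoc]
        exact mul_le_mul_of_nonneg_right (abs_binaryFormCoeff_le _ _ _) (by positivity)
    _ = ∑ z ∈ Finset.HasAntidiagonal.antidiagonal n,
          (n.choose z.1 : ℝ) * (‖p n‖ * (s / 2) ^ n) :=
        Finset.sum_coe_sort (Finset.HasAntidiagonal.antidiagonal n)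
          fun z => (n.choose z.1 : ℝ) * (‖p n‖ * (s / 2) ^ n)
    _ = 2 ^ n * (‖p n‖ * (s / 2) ^ n) := by
        rw [← Finset.sum_mul, Finset.Nat.sum_antidiagonal_eq_sum_range_succ_mk]
        congr 1
        exact_mod_cast Nat.sum_range_choose n
    _ = ‖p n‖ * s ^ n := by
        rw [div_pow]; field_simp

theorem hasSum_binaryFormCoeff {p : FormalMultilinearSeries ℝ (ℝ × ℝ) ℝ} {ρ x y t : ℝ}
    (hp : Summable fun z : ℕ × ℕ => |binaryFormCoeff p (z.1 + z.2) z.1| * ρ ^ (z.1 + z.2))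
    (hx : |x| ≤ ρ) (hy : |y| ≤ ρ) (ht : HasSum (fun n => p n fun _ => (x, y)) t) :
    HasSum (fun z : ℕ × ℕ => binaryFormCoeff p (z.1 + z.2) z.1 * x ^ z.1 * y ^ z.2) t := by
  rw [← Finset.HasAntidiagonal.sigmaAntidiagonalEquivProd.hasSum_iff]
  refine HasSum.sigma_of_hasSum ht (fun n => ?_)
    (Finset.HasAntidiagonal.sigmaAntidiagonalEquivProd.summable_iff.2 ?_)
  · rw [apply_diag_eq_sum_binaryFormCoeff, ← Finset.sum_coe_sort]
    convert hasSum_fintype _ using 2 with z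
    have hz := Finset.HasAntidiagonal.mem_antidiagonal.1 z.2
    simp only [Function.comp, Finset.HasAntidiagonal.sigmaAntidiagonalEquivProd_apply, hz]
  · refine Summable.of_norm (Summable.of_nonneg_of_le (fun _ => norm_nonneg _) (fun z => ?_) hp)
    rw [norm_mul, norm_mul, norm_pow, norm_pow, Real.norm_eq_abs, Real.norm_eq_abs,
      Real.norm_eq_abs, pow_add, mul_assoc]
    have hρ : 0 ≤ ρ := (abs_nonneg x).trans hx
    gcongr

theorem exists_forall_hasSum_double_series {f : ℝ × ℝ → ℝ} (hf : AnalyticAt ℝ f 0) :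
    ∃ a : ℕ × ℕ → ℝ, ∀ᶠ ρ in 𝓝[>] (0 : ℝ),
      (Summable fun z : ℕ × ℕ => |a z| * ρ ^ (z.1 + z.2)) ∧
      ∀ x y : ℝ, |x| ≤ ρ → |y| ≤ ρ →
        HasSum (fun z : ℕ × ℕ => a z * x ^ z.1 * y ^ z.2) (f (x, y)) := by
  obtain ⟨p, r, hp⟩ := hf
  obtain ⟨s, hs0, hsr⟩ := ENNReal.lt_iff_exists_nnreal_btwn.1 hp.r_pos
  have hs : 0 < (s : ℝ) := by exact_mod_cast hs0
  have hsum := summable_abs_binaryFormCoeff_mul_pow hs.le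
    (p.summable_norm_mul_pow (hsr.trans_le hp.r_le))
  refine ⟨fun z => binaryFormCoeff p (z.1 + z.2) z.1, ?_⟩
  filter_upwards [Ioc_mem_nhdsGT (half_pos hs)] with ρ hρ
  have hsumρ : Summable fun z : ℕ × ℕ =>
      |binaryFormCoeff p (z.1 + z.2) z.1| * ρ ^ (z.1 + z.2) :=
    Summable.of_nonneg_of_le (fun _ => mul_nonneg (abs_nonneg _) (pow_nonneg hρ.1.le _))
      (fun z => mul_le_mul_of_nonneg_left (pow_le_pow_left₀ hρ.1.le hρ.2 _) (abs_nonneg _)) hsum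
  refine ⟨hsumρ, fun x y hx hy => hasSum_binaryFormCoeff hsumρ hx hy ?_⟩
  have hmem : (x, y) ∈ Metric.eball (0 : ℝ × ℝ) r := by
    rw [Metric.mem_eball, edist_zero_right, ← ofReal_norm]
    refine lt_of_le_of_lt ?_ hsr
    rw [← ENNReal.ofReal_coe_nnreal]
    exact ENNReal.ofReal_le_ofReal
      (max_le (hx.trans (by linarith [hρ.2])) (hy.trans (by linarith [hρ.2])))
  simpa only [zero_add] using hp.hasSum hmem

namespace SummableSeries

/-- The element of the iterated algebra with prescribed coefficients. -/
def ofDouble (b : ℕ × ℕ → ℝ) (hb : Summable fun z => |b z|) :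
    SummableSeries (SummableSeries ℝ) :=
  have h := (summable_prod_of_nonneg (f := fun z : ℕ × ℕ => |b z.swap|) fun z => abs_nonneg _).1
    ((Equiv.prodComm ℕ ℕ).summable_iff.2 hb)
  mk (fun j => mk (fun i => b (i, j)) (h.1 j)) (by
    simp only [norm_def, coeff_mk]
    exact h.2)

theorem coeff_coeff_ofDouble (b : ℕ × ℕ → ℝ) (hb : Summable fun z => |b z|) (i j : ℕ) :
    coeff i (coeff j (ofDouble b hb)) = b (i, j) := by
  rw [ofDouble, coeff_mk, coeff_mk]

theorem norm_ofDouble (b : ℕ × ℕ → ℝ) (hb : Summable fun z => |b z|) :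
    ‖ofDouble b hb‖ = ∑' z, |b z| := by
  rw [← (Equiv.prodComm ℕ ℕ).tsum_eq fun z => |b z|]
  refine Eq.trans ?_ (Summable.tsum_prod ((Equiv.prodComm ℕ ℕ).summable_iff.2 hb)).symm
  simp only [norm_def, coeff_coeff_ofDouble]
  rfl

/-- Evaluation of a double power series at a point of the unit square. -/
def evalTwo (x y : ℝ) (hx : ‖x‖ ≤ 1) (hy : ‖y‖ ≤ 1) :
    SummableSeries (SummableSeries ℝ) →+* ℝ :=
  (eval x hx).comp (eval (const y) ((norm_const y).trans_le hy))

theorem evalTwo_const (x y : ℝ) (hx : ‖x‖ ≤ 1) (hy : ‖y‖ ≤ 1) (p : SummableSeries ℝ) :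
    evalTwo x y hx hy (const p) = eval x hx p := by
  rw [evalTwo, RingHom.comp_apply, eval_const]

theorem evalTwo_ofDouble (x y : ℝ) (hx : ‖x‖ ≤ 1) (hy : ‖y‖ ≤ 1) (b : ℕ × ℕ → ℝ)
    (hb : Summable fun z => |b z|) :
    evalTwo x y hx hy (ofDouble b hb) = ∑' z : ℕ × ℕ, b z * x ^ z.1 * y ^ z.2 := by
  have hcont : Continuous (eval x hx) :=
    AddMonoidHomClass.continuous_of_bound (eval x hx) 1 fun p => by
      simpa using norm_eval_le x hx p
  have hsum := (summable_norm_coeff_mul_pow (ofDouble b hb) (x := const y)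
    ((norm_const y).trans_le hy)).of_norm
  rw [evalTwo, RingHom.comp_apply, eval_apply (const y), hsum.map_tsum (eval x hx) hcont]
  have hsum2 : Summable fun z : ℕ × ℕ => b z.swap * x ^ z.2 * y ^ z.1 := by
    refine Summable.of_norm (Summable.of_nonneg_of_le (fun _ => norm_nonneg _) (fun z => ?_)
      ((Equiv.prodComm ℕ ℕ).summable_iff.2 hb))
    rw [norm_mul, norm_mul, norm_pow, norm_pow, mul_assoc]
    exact mul_le_of_le_one_right (norm_nonneg _)
      (mul_le_one₀ (pow_le_one₀ (norm_nonneg _) hx) (by positivity)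
        (pow_le_one₀ (norm_nonneg _) hy))
  rw [← (Equiv.prodComm ℕ ℕ).tsum_eq fun z : ℕ × ℕ => b z * x ^ z.1 * y ^ z.2]
  refine Eq.trans ?_ (Summable.tsum_prod hsum2).symm
  refine tsum_congr fun j => ?_
  rw [map_mul, map_pow, eval_const, eval_apply, ← tsum_mul_right]
  simp only [coeff_coeff_ofDouble, Prod.swap_prod_mk]

end SummableSeries

/-! ### Values of an analytic function on the zero set of another one -/

theorem exists_fst_eq_zero_coeff_ne_zero {Q : ℝ × ℝ → ℝ} {a : ℕ × ℕ → ℝ} {ρ : ℝ} (hρ : 0 < ρ)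
    (ha : ∀ x y : ℝ, |x| ≤ ρ → |y| ≤ ρ →
      HasSum (fun z : ℕ × ℕ => a z * x ^ z.1 * y ^ z.2) (Q (x, y)))
    (hreg : ¬ ∀ᶠ y in 𝓝 (0 : ℝ), Q (0, y) = 0) : ∃ j, a (0, j) ≠ 0 := by
  by_contra! hzero
  refine hreg (Metric.eventually_nhds_iff.2 ⟨ρ, hρ, fun y hy => ?_⟩)
  refine (ha 0 y (by simpa using hρ.le) (by simpa [Real.dist_eq] using hy.le)).unique ?_
  convert hasSum_zero with z
  obtain ⟨i, j⟩ := z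
  rcases Nat.eq_zero_or_pos i with rfl | hi
  · simp [hzero j]
  · simp [hi.ne']

theorem summable_abs_mul_pow_mul_pow {a : ℕ × ℕ → ℝ} {r ρ σ : ℝ}
    (ha : Summable fun z : ℕ × ℕ => |a z| * r ^ (z.1 + z.2)) (hρ : 0 ≤ ρ) (hρr : ρ ≤ r)
    (hσ : 0 ≤ σ) (hσr : σ ≤ r) : Summable fun z : ℕ × ℕ => |a z * (ρ ^ z.1 * σ ^ z.2)| := by
  refine Summable.of_nonneg_of_le (fun _ => abs_nonneg _) (fun z => ?_) ha
  rw [abs_mul, abs_of_nonneg (by positivity : 0 ≤ ρ ^ z.1 * σ ^ z.2), pow_add]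
  have hr : 0 ≤ r := hρ.trans hρr
  gcongr

/-- With `σ = t * r` and `ρ = t ^ (d + 1) * r`, every term other than that of index `(0, d)` gains a
factor `t ^ (d + 1)`, against `t ^ d` for that one. -/
theorem exists_scaling {a : ℕ × ℕ → ℝ} {r : ℝ} {d : ℕ} (hr : 0 < r)
    (ha : Summable fun z : ℕ × ℕ => |a z| * r ^ (z.1 + z.2)) (hd : a (0, d) ≠ 0)
    (hlt : ∀ j < d, a (0, j) = 0) :
    ∃ ρ σ κ : ℝ, 0 < ρ ∧ ρ ≤ r ∧ 0 < σ ∧ σ ≤ r ∧ 0 ≤ κ ∧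
      κ * ∑' z : ℕ × ℕ, |a z| * r ^ (z.1 + z.2) < |a (0, d)| * σ ^ d ∧
      ∀ z ≠ (0, d), |a z| * (ρ ^ z.1 * σ ^ z.2) ≤ κ * (|a z| * r ^ (z.1 + z.2)) := by
  have := abs_pos.2 hd
  set S := ∑' z : ℕ × ℕ, |a z| * r ^ (z.1 + z.2)
  have hleS : |a (0, d)| * r ^ d ≤ S := by
    simpa using ha.le_tsum (0, d) fun _ _ => by positivity
  have hS : 0 < S := lt_of_lt_of_le (by positivity) hleS
  set t : ℝ := |a (0, d)| * r ^ d / (2 * S) with ht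
  have ht0 : 0 < t := by positivity
  have ht1 : t ≤ 1 := by rw [ht, div_le_one (by positivity)]; linarith
  refine ⟨t ^ (d + 1) * r, t * r, t ^ (d + 1), by positivity,
    mul_le_of_le_one_left hr.le (pow_le_one₀ ht0.le ht1), by positivity,
    mul_le_of_le_one_left hr.le ht1, by positivity, ?_, ?_⟩
  · have htS : t * S = |a (0, d)| * r ^ d / 2 := by rw [ht]; field_simp
    calc t ^ (d + 1) * S = t ^ d * (|a (0, d)| * r ^ d / 2) := by rw [← htS]; ring
      _ < t ^ d * (|a (0, d)| * r ^ d) := by gcongr; exact half_lt_self (by positivity)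
      _ = |a (0, d)| * (t * r) ^ d := by ring
  · rintro ⟨i, j⟩ hz
    by_cases haz : a (i, j) = 0
    · simp [haz]
    have hexp : d + 1 ≤ (d + 1) * i + j := by
      rcases Nat.eq_zero_or_pos i with rfl | hi
      · have : d ≤ j := not_lt.1 fun h => haz (hlt j h)
        have : j ≠ d := fun h => hz (by rw [h])
        omega
      · exact (Nat.le_mul_of_pos_right _ hi).trans (Nat.le_add_right _ _)
    calc |a (i, j)| * ((t ^ (d + 1) * r) ^ i * (t * r) ^ j)
        = |a (i, j)| * r ^ (i + j) * t ^ ((d + 1) * i + j) := by ring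
      _ ≤ |a (i, j)| * r ^ (i + j) * t ^ (d + 1) :=
          mul_le_mul_of_nonneg_left (pow_le_pow_of_le_one ht0.le ht1 hexp) (by positivity)
      _ = _ := mul_comm _ _

namespace SummableSeries

theorem norm_ofDouble_sub_monomial_le {b g : ℕ × ℕ → ℝ} (hb : Summable fun z => |b z|) {d : ℕ}
    (hd : b (0, d) = 1) (hg : Summable g) (h0 : 0 ≤ g (0, d)) (hbg : ∀ z ≠ (0, d), |b z| ≤ g z) :
    ‖ofDouble b hb - monomial d‖ ≤ ∑' z, g z := by
  classical
  let e : ℕ × ℕ → ℝ := fun z => if z = (0, d) then 0 else b z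
  have he : ∀ z, |e z| ≤ g z := fun z => by
    by_cases hz : z = (0, d)
    · simpa only [e, if_pos hz, abs_zero] using hz ▸ h0
    · simpa only [e, if_neg hz] using hbg z hz
  have hes : Summable fun z => |e z| := Summable.of_nonneg_of_le (fun _ => abs_nonneg _) he hg
  have heq : ofDouble b hb - monomial d = ofDouble e hes := by
    ext j i
    rw [map_sub, map_sub, coeff_coeff_ofDouble, coeff_coeff_ofDouble, coeff_monomial]
    by_cases hj : j = d
    · by_cases hi : i = 0
      · simp [e, hi, hj, hd, coeff_one]
      · simp [e, hi, hj, coeff_one]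
    · simp [e, hj]
  rw [heq, norm_ofDouble]
  exact hes.tsum_le_tsum he hg

theorem evalTwo_ofDouble_scaled {a : ℕ × ℕ → ℝ} {ρ σ x y t : ℝ} (hρ : 0 < ρ) (hσ : 0 < σ)
    (ha : Summable fun z : ℕ × ℕ => |a z * (ρ ^ z.1 * σ ^ z.2)|) (hx : ‖x / ρ‖ ≤ 1)
    (hy : ‖y / σ‖ ≤ 1) (ht : HasSum (fun z : ℕ × ℕ => a z * x ^ z.1 * y ^ z.2) t) :
    evalTwo (x / ρ) (y / σ) hx hy (ofDouble _ ha) = t := by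
  rw [evalTwo_ofDouble, ← ht.tsum_eq]
  refine tsum_congr fun z => ?_
  rw [div_pow, div_pow]
  have := (pow_pos hρ z.1).ne'
  have := (pow_pos hσ z.2).ne'
  field_simp

theorem evalTwo_comp_const (x y : ℝ) (hx : ‖x‖ ≤ 1) (hy : ‖y‖ ≤ 1) :
    (evalTwo x y hx hy).comp const = eval x hx :=
  RingHom.ext fun p => evalTwo_const x y hx hy p

theorem exists_abs_eval_coeff_zero_le (χ : Polynomial (SummableSeries ℝ)) :
    ∃ C : ℝ, 0 < C ∧ ∀ (x : ℝ) (hx : ‖x‖ ≤ 1) (H : ℝ), χ.eval₂ (eval x hx) H = 0 →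
      |eval x hx (χ.coeff 0)| ≤ C * |H| := by
  set ψ := χ.divX
  set B : ℝ := ∑ n ∈ Finset.range (ψ.natDegree + 1), ‖ψ.coeff n‖
  have hB : 0 ≤ B := Finset.sum_nonneg fun _ _ => norm_nonneg _
  refine ⟨B + ‖χ.coeff 0‖ + 1, by positivity, fun x hx H hroot => ?_⟩
  rcases le_or_gt |H| 1 with hH | hH
  · have hψ : |ψ.eval₂ (eval x hx) H| ≤ B := by
      rw [Polynomial.eval₂_eq_sum_range]
      refine (Finset.abs_sum_le_sum_abs _ _).trans (Finset.sum_le_sum fun n _ => ?_)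
      rw [abs_mul, abs_pow]
      exact (mul_le_of_le_one_right (abs_nonneg _) (pow_le_one₀ (abs_nonneg _) hH)).trans
        (norm_eval_le _ hx _)
    rw [← Polynomial.divX_mul_X_add χ, Polynomial.eval₂_add, Polynomial.eval₂_mul,
      Polynomial.eval₂_X, Polynomial.eval₂_C] at hroot
    rw [eq_neg_of_add_eq_zero_right hroot, abs_neg, abs_mul]
    gcongr
    linarith [norm_nonneg (χ.coeff 0)]
  · have h0 : |eval x hx (χ.coeff 0)| ≤ ‖χ.coeff 0‖ := norm_eval_le x hx _
    nlinarith [norm_nonneg (χ.coeff 0)]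

theorem exists_eq_zero_or_le_abs_of_eval₂_eq_zero {χ : Polynomial (SummableSeries ℝ)}
    (hχ : χ ≠ 0) :
    ∃ (M : ℕ) (c δ : ℝ), 0 < c ∧ 0 < δ ∧ ∀ (x : ℝ) (hx : ‖x‖ ≤ 1), |x| ≤ δ → ∀ H : ℝ,
      χ.eval₂ (eval x hx) H = 0 → H = 0 ∨ c * |x| ^ M ≤ |H| := by
  obtain ⟨χ', hχ', hndvd⟩ := Polynomial.exists_eq_pow_rootMultiplicity_mul_and_not_dvd χ hχ 0
  rw [Polynomial.C_0, sub_zero] at hχ' hndvd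
  have h0 : χ'.coeff 0 ≠ 0 := fun h => hndvd (Polynomial.X_dvd_iff.2 h)
  obtain ⟨M, c, δ, hc, hδ, hlow⟩ := exists_le_abs_eval h0
  obtain ⟨C, hC, hup⟩ := exists_abs_eval_coeff_zero_le χ'
  refine ⟨M, c / C, δ, by positivity, hδ,
    fun x hx hxδ H hroot => or_iff_not_imp_left.2 fun hH => ?_⟩
  rw [hχ', Polynomial.eval₂_mul, Polynomial.eval₂_X_pow] at hroot
  have hroot' := (mul_eq_zero.1 hroot).resolve_left (pow_ne_zero _ hH)
  rw [div_mul_eq_mul_div, div_le_iff₀' hC]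
  exact (hlow x hx hxδ).trans (hup x hx H hroot')

theorem exists_norm_ofDouble_sub_monomial_lt_one {a : ℕ × ℕ → ℝ} {r : ℝ} (hr : 0 < r)
    (ha : Summable fun z : ℕ × ℕ => |a z| * r ^ (z.1 + z.2)) (hreg : ∃ j, a (0, j) ≠ 0) :
    ∃ (d : ℕ) (ρ σ q : ℝ), 0 < ρ ∧ ρ ≤ r ∧ 0 < σ ∧ σ ≤ r ∧
      ∃ hs : Summable fun z : ℕ × ℕ => |a z / q * (ρ ^ z.1 * σ ^ z.2)|,
        ‖ofDouble _ hs - monomial d‖ < 1 := by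
  classical
  have hd := Nat.find_spec hreg
  obtain ⟨ρ, σ, κ, hρ, hρr, hσ, hσr, hκ, hκS, hκz⟩ := exists_scaling hr ha hd
    fun j hj => not_not.1 (Nat.find_min hreg hj)
  set d := Nat.find hreg
  set q := a (0, d) * σ ^ d with hq
  have hq0 : 0 < |q| := abs_pos.2 (mul_ne_zero hd (pow_pos hσ d).ne')
  have hs : Summable fun z : ℕ × ℕ => |a z / q * (ρ ^ z.1 * σ ^ z.2)| := by
    refine ((summable_abs_mul_pow_mul_pow ha hρ.le hρr hσ.le hσr).div_const |q|).congr fun z => ?_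
    rw [← abs_div]
    ring_nf
  refine ⟨d, ρ, σ, q, hρ, hρr, hσ, hσr, hs, ?_⟩
  calc ‖ofDouble _ hs - monomial d‖
      ≤ ∑' z : ℕ × ℕ, κ / |q| * (|a z| * r ^ (z.1 + z.2)) := by
        refine norm_ofDouble_sub_monomial_le hs ?_ (ha.mul_left _) (by positivity) fun z hz => ?_
        · rw [pow_zero, one_mul, div_mul_eq_mul_div, ← hq, div_self (abs_pos.1 hq0)]
        · rw [abs_mul, abs_div, abs_of_pos (by positivity : 0 < ρ ^ z.1 * σ ^ z.2),
            div_mul_eq_mul_div, div_mul_eq_mul_div]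
          exact div_le_div_of_nonneg_right (hκz z hz) hq0.le
    _ = κ * (∑' z : ℕ × ℕ, |a z| * r ^ (z.1 + z.2)) / |q| := by
        rw [tsum_mul_left, div_mul_eq_mul_div]
    _ < 1 := by
        rwa [div_lt_one hq0, hq, abs_mul, abs_of_pos (pow_pos hσ d)]

end SummableSeries

open SummableSeries in
/-- By Weierstrass division, `h` is integral over the series in `x` modulo `Q`; the lower bound is
that for the constant term of its monic equation. -/
theorem exists_eventually_eq_zero_or_le_abs {Q h : ℝ × ℝ → ℝ} (hQ : AnalyticAt ℝ Q 0)
    (hh : AnalyticAt ℝ h 0) (hreg : ¬ ∀ᶠ y in 𝓝 (0 : ℝ), Q (0, y) = 0) :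
    ∃ (M : ℕ) (c : ℝ), 0 < c ∧
      ∀ᶠ z in 𝓝 (0 : ℝ × ℝ), Q z = 0 → h z = 0 ∨ c * |z.1| ^ M ≤ |h z| := by
  obtain ⟨a, ha⟩ := exists_forall_hasSum_double_series hQ
  obtain ⟨b, hb⟩ := exists_forall_hasSum_double_series hh
  obtain ⟨r, ⟨⟨ha, haQ⟩, hb, hbh⟩, hr⟩ := ((ha.and hb).and self_mem_nhdsWithin).exists
  obtain ⟨d, ρ, σ, q, hρ, hρr, hσ, hσr, hs, hnorm⟩ :=
    exists_norm_ofDouble_sub_monomial_lt_one hr ha (exists_fst_eq_zero_coeff_ne_zero hr haQ hreg)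
  have hsb := summable_abs_mul_pow_mul_pow hb hρ.le hρr hσ.le hσr
  obtain ⟨χ, hχ, k, hk⟩ := exists_monic_eval₂_eq_mul hnorm (ofDouble _ hsb)
  obtain ⟨M, c, δ, hc, hδ, hroot⟩ := exists_eq_zero_or_le_abs_of_eval₂_eq_zero hχ.ne_zero
  refine ⟨M, c / ρ ^ M, by positivity, ?_⟩
  have hball : ∀ᶠ z in 𝓝 (0 : ℝ × ℝ), |z.1| ≤ min ρ (δ * ρ) ∧ |z.2| ≤ σ := by
    filter_upwards [Metric.closedBall_mem_nhds (0 : ℝ × ℝ)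
      (by positivity : 0 < min (min ρ (δ * ρ)) σ)] with z hz
    rw [mem_closedBall_zero_iff] at hz
    exact ⟨(norm_fst_le z).trans (hz.trans (min_le_left _ _)),
      (norm_snd_le z).trans (hz.trans (min_le_right _ _))⟩
  filter_upwards [hball] with ⟨x, y⟩ ⟨hxmin, hyσ⟩ hQz
  obtain ⟨hxρ, hxδ⟩ := le_min_iff.1 hxmin
  have hX : ‖x / ρ‖ ≤ 1 := by
    rwa [Real.norm_eq_abs, abs_div, abs_of_pos hρ, div_le_one hρ]
  have hY : ‖y / σ‖ ≤ 1 := by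
    rwa [Real.norm_eq_abs, abs_div, abs_of_pos hσ, div_le_one hσ]
  have hevQ : evalTwo _ _ hX hY (ofDouble _ hs) = 0 := by
    refine evalTwo_ofDouble_scaled hρ hσ hs hX hY ?_
    have := (haQ x y (hxρ.trans hρr) (hyσ.trans hσr)).div_const q
    rw [hQz, zero_div] at this
    exact this.congr_fun fun z => by ring
  have hevh : evalTwo _ _ hX hY (ofDouble _ hsb) = h (x, y) :=
    evalTwo_ofDouble_scaled hρ hσ hsb hX hY (hbh x y (hxρ.trans hρr) (hyσ.trans hσr))
  have hzero : χ.eval₂ (eval (x / ρ) hX) (h (x, y)) = 0 := by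
    have := congrArg (evalTwo _ _ hX hY) hk
    rwa [Polynomial.hom_eval₂, evalTwo_comp_const, map_mul, hevQ, mul_zero, hevh] at this
  have := hroot (x / ρ) hX (by rwa [abs_div, abs_of_pos hρ, div_le_iff₀ hρ]) _ hzero
  rwa [abs_div, abs_of_pos hρ, div_pow, ← mul_div_assoc, ← div_mul_eq_mul_div] at this

/-! ### A Łojasiewicz inequality on closed semianalytic subsets of the plane -/

section Analytic

variable {E : Type*} [NormedAddCommGroup E] [NormedSpace ℝ E]

theorem eventually_eq_zero_or_of_mul_eq_zero {f g : E → ℝ} {z : E} (hf : AnalyticAt ℝ f z)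
    (hg : AnalyticAt ℝ g z) (h : ∀ᶠ w in 𝓝 z, f w * g w = 0) :
    (∀ᶠ w in 𝓝 z, f w = 0) ∨ ∀ᶠ w in 𝓝 z, g w = 0 := by
  refine or_iff_not_imp_left.2 fun hf0 => ?_
  obtain ⟨r, hr, hball⟩ := Metric.eventually_nhds_iff_ball.1
    (h.and (hf.eventually_analyticAt.and hg.eventually_analyticAt))
  obtain ⟨w, hw, hfw⟩ : ∃ w ∈ Metric.ball z r, f w ≠ 0 := by
    by_contra! hcon
    exact hf0 (by filter_upwards [Metric.ball_mem_nhds z hr] using hcon)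
  have hgw : g =ᶠ[𝓝 w] 0 := by
    filter_upwards [(hball w hw).2.1.continuousAt.eventually_ne hfw,
      Metric.isOpen_ball.mem_nhds hw] with w' h1 h2
    exact (mul_eq_zero.1 (hball w' h2).1).resolve_left h1
  have hzero := AnalyticOnNhd.eqOn_zero_of_preconnected_of_eventuallyEq_zero
    (fun w' hw' => (hball w' hw').2.2) (convex_ball z r).isPreconnected hw hgw
  filter_upwards [Metric.ball_mem_nhds z hr] with w' hw' using hzero hw'

theorem exists_eventually_eq_zero_of_prod_eq_zero {ι : Type*} {J : Finset ι} {f : ι → E → ℝ} {z : E}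
    (hf : ∀ i ∈ J, AnalyticAt ℝ (f i) z) (h : ∀ᶠ w in 𝓝 z, ∏ i ∈ J, f i w = 0) :
    ∃ i ∈ J, ∀ᶠ w in 𝓝 z, f i w = 0 := by
  classical
  induction J using Finset.induction_on with
  | empty => simpa using h.exists
  | insert i J hi ih =>
    simp only [Finset.prod_insert hi] at h
    have hJ : ∀ j ∈ J, AnalyticAt ℝ (f j) z := fun j hj => hf j (Finset.mem_insert_of_mem hj)
    rcases eventually_eq_zero_or_of_mul_eq_zero (hf i (Finset.mem_insert_self i J))
      (Finset.analyticAt_fun_prod J hJ) h with h1 | h1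
    · exact ⟨i, Finset.mem_insert_self i J, h1⟩
    · obtain ⟨j, hj, hfj⟩ := ih hJ h1
      exact ⟨j, Finset.mem_insert_of_mem hj, hfj⟩

theorem not_eventually_smul_eq_zero {P : E → ℝ} {r : ℝ}
    (hP : ∀ z ∈ Metric.ball (0 : E) r, AnalyticAt ℝ P z) {q : E} (hq : q ∈ Metric.ball (0 : E) r)
    (hPq : P q ≠ 0) : ¬ ∀ᶠ t in 𝓝 (0 : ℝ), P (t • q) = 0 := fun h => by
  have han : AnalyticOnNhd ℝ (fun t : ℝ => P (t • q)) (Icc 0 1) := fun t ht => by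
    refine (hP (t • q) ?_).comp (f := fun t : ℝ => t • q) (analyticAt_id.smul analyticAt_const)
    rw [mem_ball_zero_iff] at hq ⊢
    rw [norm_smul, Real.norm_eq_abs, abs_of_nonneg ht.1]
    exact (mul_le_of_le_one_left (norm_nonneg _) ht.2).trans_lt hq
  have := han.eqOn_zero_of_preconnected_of_eventuallyEq_zero isPreconnected_Icc
    (left_mem_Icc.2 zero_le_one) h (right_mem_Icc.2 zero_le_one)
  exact hPq (by simpa only [one_smul, Pi.zero_apply] using this)

end Analytic

theorem exists_abs_le_and_deriv_eq_zero {T : Set ℝ} (hT : IsClosed T) {f f' : ℝ → ℝ} {a b : ℝ}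
    (hf : ∀ y ∈ Icc a b, HasDerivAt f (f' y) y) {y₀ : ℝ} (hy₀ : y₀ ∈ Icc a b) (hy₀T : y₀ ∈ T) :
    ∃ y ∈ Icc a b, y ∈ T ∧ |f y| ≤ |f y₀| ∧
      (y = a ∨ y = b ∨ T ∉ 𝓝 y ∨ f y = 0 ∨ f' y = 0) := by
  have hcont : ContinuousOn (fun y => |f y|) (Icc a b ∩ T) := fun y hy =>
    (hf y hy.1).continuousAt.continuousWithinAt.abs
  obtain ⟨y, ⟨hy, hyT⟩, hmin⟩ :=
    (isCompact_Icc.inter_right hT).exists_isMinOn ⟨y₀, hy₀, hy₀T⟩ hcont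
  refine ⟨y, hy, hyT, hmin ⟨hy₀, hy₀T⟩, ?_⟩
  by_contra! h
  obtain ⟨ha, hb, hnhds, hfy, hf'y⟩ := h
  have hloc : IsLocalMin (fun y => f y ^ 2) y := by
    filter_upwards [hnhds, Icc_mem_nhds (hy.1.lt_of_ne' ha) (hy.2.lt_of_ne hb)] with x hxT hx
    exact sq_le_sq.2 (hmin ⟨hx, hxT⟩)
  have hzero : 2 * f y * f' y = 0 := by
    simpa using hloc.hasDerivAt_eq_zero ((hf y hy).pow 2)
  exact mul_ne_zero (mul_ne_zero two_ne_zero hfy) hf'y hzero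

section SecondVariable

variable {h : ℝ × ℝ → ℝ}

theorem eventually_hasDerivAt_snd {p : ℝ × ℝ} (hh : AnalyticAt ℝ h p) :
    ∀ᶠ z in 𝓝 p, HasDerivAt (fun y => h (z.1, y)) (fderiv ℝ h z (0, 1)) z.2 := by
  filter_upwards [hh.eventually_analyticAt] with z hz
  exact hz.differentiableAt.hasFDerivAt.comp_hasDerivAt z.2
    ((hasDerivAt_const z.2 z.1).prodMk (hasDerivAt_id z.2))

theorem analyticAt_fderiv_snd {p : ℝ × ℝ} (hh : AnalyticAt ℝ h p) :
    AnalyticAt ℝ (fun z => fderiv ℝ h z (0, 1)) p :=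
  ((ContinuousLinearMap.apply ℝ ℝ ((0 : ℝ), (1 : ℝ))).analyticAt _).comp hh.fderiv

theorem eventually_eq_zero_of_fderiv_snd_eq_zero (hh : AnalyticAt ℝ h 0) (h0 : h 0 = 0)
    (hD : ∀ᶠ y in 𝓝 (0 : ℝ), fderiv ℝ h (0, y) (0, 1) = 0) : ∀ᶠ y in 𝓝 (0 : ℝ), h (0, y) = 0 := by
  have haxis : Tendsto (fun y : ℝ => ((0 : ℝ), y)) (𝓝 0) (𝓝 0) :=
    (by fun_prop : Continuous fun y : ℝ => ((0 : ℝ), y)).tendsto 0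
  have hderiv : ∀ᶠ y in 𝓝 (0 : ℝ), HasDerivAt (fun y => h (0, y)) 0 y := by
    filter_upwards [haxis.eventually (eventually_hasDerivAt_snd hh), hD] with y hy hy0
    rwa [hy0] at hy
  obtain ⟨r, hr, hball⟩ := Metric.eventually_nhds_iff_ball.1 hderiv
  filter_upwards [Metric.ball_mem_nhds (0 : ℝ) hr] with y hy
  have := (convex_ball (0 : ℝ) r).norm_image_sub_le_of_norm_hasDerivWithin_le
    (f := fun y => h (0, y)) (f' := fun _ => 0) (C := 0)
    (fun x hx => (hball x hx).hasDerivWithinAt) (by simp) (Metric.mem_ball_self hr) hy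
  simpa [show h (0, 0) = 0 from h0] using this

theorem exists_pos_eventually_le_abs {y : ℝ} (hh : ContinuousAt h (0, y)) (hy : h (0, y) ≠ 0) :
    ∃ c : ℝ, 0 < c ∧ ∀ᶠ z in 𝓝 (0 : ℝ × ℝ), c ≤ |h (z.1, y)| := by
  have hpos : 0 < |h (0, y)| := abs_pos.2 hy
  have hcont : ContinuousAt (fun z : ℝ × ℝ => |h (z.1, y)|) 0 :=
    (hh.comp_of_eq (f := fun z : ℝ × ℝ => (z.1, y)) (by fun_prop) rfl).abs
  exact ⟨|h (0, y)| / 2, by positivity, hcont.eventually_const_le (half_lt_self hpos)⟩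

theorem exists_eventually_le_abs_of_fderiv_eq_zero {Q : ℝ × ℝ → ℝ} (hQ : AnalyticAt ℝ Q 0)
    (hh : AnalyticAt ℝ h 0) (hQreg : ¬ ∀ᶠ y in 𝓝 (0 : ℝ), Q (0, y) = 0)
    (hhreg : ¬ ∀ᶠ y in 𝓝 (0 : ℝ), h (0, y) = 0) (h0 : h 0 = 0) :
    ∃ (M : ℕ) (c : ℝ), 0 < c ∧ ∀ᶠ z in 𝓝 (0 : ℝ × ℝ),
      Q z = 0 ∨ fderiv ℝ h z (0, 1) = 0 → h z = 0 ∨ c * |z.1| ^ M ≤ |h z| := by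
  have hD := analyticAt_fderiv_snd hh
  have haxis : AnalyticAt ℝ (fun y : ℝ => ((0 : ℝ), y)) 0 := analyticAt_const.prod analyticAt_id
  obtain ⟨M, c, hc, hM⟩ := exists_eventually_eq_zero_or_le_abs (hQ.mul hD) hh fun hev =>
    (eventually_eq_zero_or_of_mul_eq_zero (hQ.comp_of_eq haxis rfl) (hD.comp_of_eq haxis rfl)
      hev).elim hQreg fun hD0 => hhreg (eventually_eq_zero_of_fderiv_snd_eq_zero hh h0 hD0)
  exact ⟨M, c, hc, hM.mono fun z hz hQD => hz (mul_eq_zero.2 hQD)⟩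

theorem exists_lt_eventually_le_abs_of_abs_eq (hh : AnalyticAt ℝ h 0)
    (hhreg : ¬ ∀ᶠ y in 𝓝 (0 : ℝ), h (0, y) = 0) {r : ℝ} (hr : 0 < r) :
    ∃ δ c : ℝ, 0 < δ ∧ δ < r ∧ 0 < c ∧
      ∀ᶠ z in 𝓝 (0 : ℝ × ℝ), ∀ y : ℝ, |y| = δ → c ≤ |h (z.1, y)| := by
  have haxis : AnalyticAt ℝ (fun y : ℝ => ((0 : ℝ), y)) 0 := analyticAt_const.prod analyticAt_id
  have hne : ∀ᶠ y in 𝓝 (0 : ℝ), y ≠ 0 → h (0, y) ≠ 0 := eventually_nhdsWithin_iff.1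
    ((hh.comp_of_eq haxis rfl).eventually_eq_zero_or_eventually_ne_zero.resolve_left hhreg)
  have hcont : ∀ᶠ y in 𝓝 (0 : ℝ), ContinuousAt h (0, y) :=
    (haxis.continuousAt.eventually hh.eventually_analyticAt).mono fun _ => AnalyticAt.continuousAt
  obtain ⟨s, hs, hball⟩ := Metric.eventually_nhds_iff_ball.1 (hne.and hcont)
  obtain ⟨δ, hδ, hδr⟩ := exists_between (lt_min hr hs)
  obtain ⟨hδr, hδs⟩ := lt_min_iff.1 hδr
  have hside : ∀ y : ℝ, |y| = δ → ∃ c : ℝ, 0 < c ∧ ∀ᶠ z in 𝓝 (0 : ℝ × ℝ), c ≤ |h (z.1, y)| :=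
    fun y hy =>
      have hy' := hball y (mem_ball_zero_iff.2 (hy.trans_lt hδs))
      exists_pos_eventually_le_abs hy'.2 (hy'.1 (abs_pos.1 (hδ.trans_eq hy.symm)))
  obtain ⟨c₁, hc₁, hs₁⟩ := hside δ (abs_of_pos hδ)
  obtain ⟨c₂, hc₂, hs₂⟩ := hside (-δ) (by rw [abs_neg, abs_of_pos hδ])
  refine ⟨δ, min c₁ c₂, hδ, hδr, lt_min hc₁ hc₂, ?_⟩
  filter_upwards [hs₁, hs₂] with z hz₁ hz₂ y hy
  rcases eq_or_eq_neg_of_abs_eq hy with rfl | rfl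
  · exact (min_le_left _ _).trans hz₁
  · exact (min_le_right _ _).trans hz₂

/-- On every vertical segment in `S` the minimum of `|h|` is attained at an end of the segment, on
the zero set of `Q` or at a critical point, and Weierstrass division handles the last two. -/
theorem exists_eventually_mul_abs_fst_pow_le {S : Set (ℝ × ℝ)} (hS : IsClosed S)
    {Q : ℝ × ℝ → ℝ} (hQ : AnalyticAt ℝ Q 0) (hh : AnalyticAt ℝ h 0)
    (hQreg : ¬ ∀ᶠ y in 𝓝 (0 : ℝ), Q (0, y) = 0) (hhreg : ¬ ∀ᶠ y in 𝓝 (0 : ℝ), h (0, y) = 0)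
    (h0 : h 0 = 0) (hloc : ∀ᶠ z in 𝓝 (0 : ℝ × ℝ), z ∈ S → Q z = 0 ∨ S ∈ 𝓝 z)
    (hne : ∀ᶠ z in 𝓝 (0 : ℝ × ℝ), z ∈ S → h z = 0 → z = 0) :
    ∃ (M : ℕ) (c : ℝ), 0 < c ∧ ∀ᶠ z in 𝓝 (0 : ℝ × ℝ), z ∈ S → c * |z.1| ^ M ≤ |h z| := by
  obtain ⟨M, c, hc, hM⟩ := exists_eventually_le_abs_of_fderiv_eq_zero hQ hh hQreg hhreg h0
  obtain ⟨r, hr, hball⟩ := Metric.eventually_nhds_iff_ball.1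
    (hM.and (hloc.and (hne.and (eventually_hasDerivAt_snd hh))))
  obtain ⟨δ, c₁, hδ, hδr, hc₁, hside⟩ := exists_lt_eventually_le_abs_of_abs_eq hh hhreg hr
  have hbox : ∀ {x y : ℝ}, |x| ≤ δ → |y| ≤ δ → (x, y) ∈ Metric.ball (0 : ℝ × ℝ) r :=
    fun hx hy => mem_ball_zero_iff.2 (max_lt (hx.trans_lt hδr) (hy.trans_lt hδr))
  refine ⟨M + 1, min c c₁, by positivity, ?_⟩
  filter_upwards [hside, Metric.closedBall_mem_nhds 0 (lt_min hδ one_pos)]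
    with ⟨x, y₀⟩ hx₁ hz hzS
  obtain ⟨hx, hy₀⟩ := max_le_iff.1 (mem_closedBall_zero_iff.1 hz)
  obtain ⟨hxδ, hx1⟩ := le_min_iff.1 hx
  obtain ⟨y, hyI, hyS, hle, hcases⟩ := exists_abs_le_and_deriv_eq_zero
    (f := fun y => h (x, y)) (f' := fun y => fderiv ℝ h (x, y) (0, 1))
    (hS.preimage (by fun_prop : Continuous fun y : ℝ => (x, y)))
    (fun y hy => (hball (x, y) (hbox hxδ (abs_le.2 hy))).2.2.2)
    (abs_le.1 (hy₀.trans (min_le_left _ _))) hzS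
  refine le_trans ?_ hle
  rcases eq_or_ne x 0 with rfl | hx0
  · simp
  have hbound : ∀ {c' : ℝ} {N : ℕ}, min c c₁ ≤ c' → 0 < c' → N ≤ M + 1 →
      c' * |x| ^ N ≤ |h (x, y)| → min c c₁ * |x| ^ (M + 1) ≤ |h (x, y)| :=
    fun hc' hpos hN hle => le_trans (mul_le_mul hc'
      (pow_le_pow_of_le_one (abs_nonneg _) hx1 hN) (by positivity) hpos.le) hle
  obtain ⟨hcrit, hSy, hzero, -⟩ := hball (x, y) (hbox hxδ (abs_le.2 hyI))
  have hhy : h (x, y) ≠ 0 := fun h' => hx0 (congrArg Prod.fst (hzero hyS h'))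
  have hQD : Q (x, y) = 0 ∨ fderiv ℝ h (x, y) (0, 1) = 0 →
      min c c₁ * |x| ^ (M + 1) ≤ |h (x, y)| := fun h' =>
    hbound (min_le_left _ _) hc M.le_succ ((hcrit h').resolve_left hhy)
  rcases hcases with rfl | rfl | hnhds | hhy0 | hD
  · exact hbound (min_le_right _ _) hc₁ (Nat.zero_le _)
      (by simpa using hx₁ _ (by rw [abs_neg, abs_of_pos hδ]))
  · exact hbound (min_le_right _ _) hc₁ (Nat.zero_le _)
      (by simpa using hx₁ _ (abs_of_pos hδ))
  · refine hQD (Or.inl ((hSy hyS).resolve_right fun hS' => hnhds ?_))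
    exact (by fun_prop : Continuous fun y : ℝ => (x, y)).continuousAt.preimage_mem_nhds hS'
  · exact absurd hhy0 hhy
  · exact hQD (Or.inr hD)

end SecondVariable

/-- The determinant of a pair of vectors of the plane. -/
def planeDet (q q' : ℝ × ℝ) : ℝ := q.1 * q'.2 - q.2 * q'.1

/-- The coordinate along `q` of `z` in the basis `q, q'` of the plane. -/
def coordAlong (q q' z : ℝ × ℝ) : ℝ := planeDet z q' / planeDet q q'

theorem planeDet_swap (q q' : ℝ × ℝ) : planeDet q' q = -planeDet q q' := by
  unfold planeDet; ring

theorem continuous_coordAlong (q q' : ℝ × ℝ) : Continuous (coordAlong q q') := by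
  unfold coordAlong planeDet; fun_prop

theorem coordAlong_zero (q q' : ℝ × ℝ) : coordAlong q q' 0 = 0 := by
  simp [coordAlong, planeDet]

theorem coordAlong_smul_add_smul {q q' : ℝ × ℝ} (hdet : planeDet q q' ≠ 0) (z : ℝ × ℝ) :
    coordAlong q q' z • q + coordAlong q' q z • q' = z := by
  rw [coordAlong, coordAlong, planeDet_swap q q']
  ext
  · simp only [Prod.fst_add, Prod.smul_fst, smul_eq_mul]
    field_simp
    unfold planeDet; ring
  · simp only [Prod.snd_add, Prod.smul_snd, smul_eq_mul]
    field_simp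
    unfold planeDet; ring

theorem coordAlong_left_smul_add_smul {q q' : ℝ × ℝ} (hdet : planeDet q q' ≠ 0) (x y : ℝ) :
    coordAlong q q' (x • q + y • q') = x := by
  rw [coordAlong, div_eq_iff hdet]
  simp only [planeDet, Prod.fst_add, Prod.snd_add, Prod.smul_fst, Prod.smul_snd, smul_eq_mul]
  ring

theorem exists_planeDet_ne_zero_and_regular {P : ℝ × ℝ → ℝ} (hP : AnalyticAt ℝ P 0)
    (hP0 : P 0 = 0) (hne : ¬ ∀ᶠ z in 𝓝 0, P z = 0) :
    ∃ q q' : ℝ × ℝ, planeDet q q' ≠ 0 ∧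
      (¬ ∀ᶠ t in 𝓝 (0 : ℝ), P (t • q) = 0) ∧ ¬ ∀ᶠ t in 𝓝 (0 : ℝ), P (t • q') = 0 := by
  obtain ⟨r, hr, hball⟩ := Metric.eventually_nhds_iff_ball.1 hP.eventually_analyticAt
  obtain ⟨q, hq, hPq⟩ : ∃ q ∈ Metric.ball (0 : ℝ × ℝ) r, P q ≠ 0 := by
    by_contra! hcon
    exact hne (by filter_upwards [Metric.ball_mem_nhds 0 hr] using hcon)
  have hline : Tendsto (fun s : ℝ => q + s • (-q.2, q.1)) (𝓝[≠] 0) (𝓝 q) :=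
    ((by fun_prop : Continuous fun s : ℝ => q + s • (-q.2, q.1)).tendsto' 0 q (by simp)).mono_left
      nhdsWithin_le_nhds
  obtain ⟨s, ⟨hs, hPs⟩, hs0⟩ := ((hline.eventually ((Metric.isOpen_ball.eventually_mem hq).and
    ((hball q hq).continuousAt.eventually_ne hPq))).and self_mem_nhdsWithin).exists
  refine ⟨q, _, ?_, not_eventually_smul_eq_zero hball hq hPq,
    not_eventually_smul_eq_zero hball hs hPs⟩
  have hsq : q.1 ^ 2 + q.2 ^ 2 ≠ 0 := fun h => hPq <| by
    rw [show q = 0 from Prod.ext ((pow_eq_zero_iff two_ne_zero).1 (by nlinarith [sq_nonneg q.2]))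
      ((pow_eq_zero_iff two_ne_zero).1 (by nlinarith only [h, sq_nonneg q.1, sq_nonneg q.2])), hP0]
  have hdet : planeDet q (q + s • (-q.2, q.1)) = s * (q.1 ^ 2 + q.2 ^ 2) := by
    simp only [planeDet, Prod.snd_add, Prod.fst_add, Prod.smul_mk, smul_eq_mul]; ring
  exact hdet ▸ mul_ne_zero hs0 hsq

theorem exists_eventually_mul_abs_coordAlong_pow_le {S : Set (ℝ × ℝ)} (hS : IsClosed S)
    {Q h : ℝ × ℝ → ℝ} (hQ : AnalyticAt ℝ Q 0) (hh : AnalyticAt ℝ h 0) {q q' : ℝ × ℝ}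
    (hdet : planeDet q q' ≠ 0)
    (hreg : ¬ ∀ᶠ y in 𝓝 (0 : ℝ), Q (y • q') * h (y • q') = 0)
    (h0 : h 0 = 0) (hloc : ∀ᶠ z in 𝓝 (0 : ℝ × ℝ), z ∈ S → Q z = 0 ∨ S ∈ 𝓝 z)
    (hne : ∀ᶠ z in 𝓝 (0 : ℝ × ℝ), z ∈ S → h z = 0 → z = 0) :
    ∃ (M : ℕ) (c : ℝ), 0 < c ∧ ∀ᶠ z in 𝓝 (0 : ℝ × ℝ), z ∈ S →
      c * |coordAlong q q' z| ^ M ≤ |h z| := by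
  let T : ℝ × ℝ → ℝ × ℝ := fun z => z.1 • q + z.2 • q'
  let T' : ℝ × ℝ → ℝ × ℝ := fun z => (coordAlong q q' z, coordAlong q' q z)
  have hTT' : ∀ z, T (T' z) = z := coordAlong_smul_add_smul hdet
  have hTc : Continuous T := by fun_prop
  have hT0 : T 0 = 0 := by simp [T]
  have hTan : AnalyticAt ℝ T 0 :=
    (analyticAt_fst.smul analyticAt_const).add (analyticAt_snd.smul analyticAt_const)
  have hTt : Tendsto T (𝓝 0) (𝓝 0) := hTc.tendsto' 0 0 hT0
  have hT'0 : T' 0 = 0 := Prod.ext (coordAlong_zero q q') (coordAlong_zero q' q)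
  have hT'T : ∀ z, T' (T z) = z := fun z => Prod.ext (coordAlong_left_smul_add_smul hdet _ _) <| by
    have := coordAlong_left_smul_add_smul (q := q') (q' := q)
      (by rw [planeDet_swap q q']; exact neg_ne_zero.2 hdet) z.2 z.1
    rwa [add_comm] at this
  have hTy : ∀ y : ℝ, T (0, y) = y • q' := fun y => by simp [T]
  obtain ⟨M, c, hc, hM⟩ := exists_eventually_mul_abs_fst_pow_le (hS.preimage hTc)
    (hQ.comp_of_eq hTan hT0) (hh.comp_of_eq hTan hT0)
    (fun hev => hreg (hev.mono fun y hy => by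
      rw [← hTy]; exact mul_eq_zero_of_left hy _))
    (fun hev => hreg (hev.mono fun y hy => by
      rw [← hTy]; exact mul_eq_zero_of_right _ hy))
    (by rw [Function.comp_apply, hT0, h0])
    ((hTt.eventually hloc).mono fun z hz hzS =>
      (hz hzS).imp id fun h' => hTc.continuousAt.preimage_mem_nhds h')
    ((hTt.eventually hne).mono fun z hz hzS hz0 => by rw [← hT'T z, hz hzS hz0, hT'0])
  refine ⟨M, c, hc, ?_⟩
  have hT'c : Continuous T' := (continuous_coordAlong q q').prodMk (continuous_coordAlong q' q)
  filter_upwards [(hT'c.tendsto' 0 0 hT'0).eventually hM] with z hz hzS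
  simpa only [Function.comp_apply, hTT'] using hz (by rwa [mem_preimage, hTT'])

theorem min_mul_max_pow_le {c₁ c₂ X Y t : ℝ} {M₁ M₂ : ℕ} (hc₁ : 0 ≤ c₁) (hc₂ : 0 ≤ c₂)
    (hX0 : 0 ≤ X) (hX1 : X ≤ 1) (hY0 : 0 ≤ Y) (hY1 : Y ≤ 1) (hX : c₁ * X ^ M₁ ≤ t)
    (hY : c₂ * Y ^ M₂ ≤ t) : min c₁ c₂ * max X Y ^ (M₁ + M₂) ≤ t := by
  rcases max_choice X Y with hmax | hmax <;> rw [hmax]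
  · exact (mul_le_mul (min_le_left _ _) (pow_le_pow_of_le_one hX0 hX1 (Nat.le_add_right _ _))
      (by positivity) hc₁).trans hX
  · exact (mul_le_mul (min_le_right _ _) (pow_le_pow_of_le_one hY0 hY1 (Nat.le_add_left _ _))
      (by positivity) hc₂).trans hY

theorem norm_le_mul_max_abs_coordAlong {q q' : ℝ × ℝ} (hdet : planeDet q q' ≠ 0) (z : ℝ × ℝ) :
    ‖z‖ ≤ (‖q‖ + ‖q'‖) * max |coordAlong q q' z| |coordAlong q' q z| :=
  calc ‖z‖ = ‖coordAlong q q' z • q + coordAlong q' q z • q'‖ := by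
        rw [coordAlong_smul_add_smul hdet]
    _ ≤ |coordAlong q q' z| * ‖q‖ + |coordAlong q' q z| * ‖q'‖ := by
        refine (norm_add_le _ _).trans_eq ?_
        rw [norm_smul, norm_smul, Real.norm_eq_abs, Real.norm_eq_abs]
    _ ≤ max |coordAlong q q' z| |coordAlong q' q z| * ‖q‖ +
          max |coordAlong q q' z| |coordAlong q' q z| * ‖q'‖ := by
        gcongr
        exacts [le_max_left _ _, le_max_right _ _]
    _ = _ := by ring

namespace IsSemianalytic

variable {S : Set (ℝ × ℝ)}

theorem exists_eq_zero_or_mem_nhds (hSA : IsSemianalytic S) (p : ℝ × ℝ) :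
    ∃ Q : ℝ × ℝ → ℝ, AnalyticAt ℝ Q p ∧ (¬ ∀ᶠ z in 𝓝 p, Q z = 0) ∧
      ∀ᶠ z in 𝓝 p, z ∈ S → Q z = 0 ∨ S ∈ 𝓝 z := by
  classical
  obtain ⟨W, hW, m, k, f, g, hf, hg, hdesc⟩ := hSA p
  have hpW : p ∈ W := mem_of_mem_nhds hW
  set I : Finset (Fin m) := Finset.univ.filter fun i => ¬ ∀ᶠ z in 𝓝 p, f i z = 0
  refine ⟨fun z => ∏ i ∈ I, f i z, Finset.analyticAt_fun_prod I fun i _ => hf i p hpW,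
    fun hev => ?_,
    ?_⟩
  · obtain ⟨i, hi, hfi⟩ := exists_eventually_eq_zero_of_prod_eq_zero (fun i _ => hf i p hpW) hev
    exact (Finset.mem_filter.1 hi).2 hfi
  have hall : ∀ᶠ z in 𝓝 p, ∀ i ∉ I, ∀ᶠ w in 𝓝 z, f i w = 0 := by
    refine eventually_all.2 fun i => ?_
    by_cases hi : i ∈ I
    · exact Eventually.of_forall fun z h' => absurd hi h'
    · have hfi : ∀ᶠ z in 𝓝 p, f i z = 0 := by simpa [I] using hi
      exact hfi.eventually_nhds.mono fun z hz _ => hz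
  filter_upwards [hall, eventually_mem_nhds_iff.2 hW] with z hz hzW hzS
  have hzW' := mem_of_mem_nhds hzW
  obtain ⟨i, hfi, hgi⟩ := (hdesc z hzW').1 hzS
  by_cases hi : i ∈ I
  · exact Or.inl (Finset.prod_eq_zero hi hfi)
  · right
    have hpos : ∀ᶠ w in 𝓝 z, ∀ j, 0 < g i j w :=
      eventually_all.2 fun j => (hg i j z hzW').continuousAt.eventually_const_lt (hgi j)
    filter_upwards [hz i hi, hpos, hzW] with w h1 h2 h3
    exact (hdesc w h3).2 ⟨i, h1, h2⟩

theorem exists_eventually_mul_norm_pow_le_zero (hSA : IsSemianalytic S) (hS : IsClosed S)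
    {h : ℝ × ℝ → ℝ} (hh : AnalyticAt ℝ h 0) (h0 : h 0 = 0)
    (hne : ∀ᶠ z in 𝓝 (0 : ℝ × ℝ), z ∈ S → h z = 0 → z = 0) :
    ∃ (M : ℕ) (c : ℝ), 0 < c ∧ ∀ᶠ z in 𝓝 (0 : ℝ × ℝ), z ∈ S → c * ‖z‖ ^ M ≤ |h z| := by
  by_cases hzero : ∀ᶠ z in 𝓝 (0 : ℝ × ℝ), h z = 0
  · refine ⟨1, 1, one_pos, ?_⟩
    filter_upwards [hzero, hne] with z h1 h2 h3
    simp [h2 h3 h1]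
  obtain ⟨Q, hQ, hQne, hloc⟩ := hSA.exists_eq_zero_or_mem_nhds 0
  obtain ⟨q, q', hdet, hq, hq'⟩ := exists_planeDet_ne_zero_and_regular (hQ.mul hh) (by simp [h0])
    fun hev => (eventually_eq_zero_or_of_mul_eq_zero hQ hh hev).elim hQne hzero
  obtain ⟨M₁, c₁, hc₁, hM₁⟩ :=
    exists_eventually_mul_abs_coordAlong_pow_le hS hQ hh hdet hq' h0 hloc hne
  obtain ⟨M₂, c₂, hc₂, hM₂⟩ := exists_eventually_mul_abs_coordAlong_pow_le hS hQ hh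
    (by rw [planeDet_swap q q']; exact neg_ne_zero.2 hdet) hq h0 hloc hne
  set K : ℝ := ‖q‖ + ‖q'‖
  have hK0 : 0 < K := by
    have hq0 : q ≠ 0 := fun h' => hdet (by simp [h', planeDet])
    positivity
  refine ⟨M₁ + M₂, min c₁ c₂ / K ^ (M₁ + M₂), by positivity, ?_⟩
  have hsmall : ∀ p p' : ℝ × ℝ, ∀ᶠ z in 𝓝 0, |coordAlong p p' z| ≤ 1 := fun p p' => by
    have := ((continuous_coordAlong p p').tendsto' 0 0 (coordAlong_zero p p')).eventually
      (Metric.closedBall_mem_nhds 0 one_pos)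
    simpa only [Metric.mem_closedBall, dist_zero_right, Real.norm_eq_abs] using this
  filter_upwards [hM₁, hM₂, hsmall q q', hsmall q' q] with z h1 h2 hX hY hzS
  rw [div_mul_eq_mul_div, div_le_iff₀' (by positivity)]
  calc min c₁ c₂ * ‖z‖ ^ (M₁ + M₂)
      ≤ min c₁ c₂ * (K * max |coordAlong q q' z| |coordAlong q' q z|) ^ (M₁ + M₂) := by
        gcongr
        exact norm_le_mul_max_abs_coordAlong hdet z
    _ = K ^ (M₁ + M₂) *
          (min c₁ c₂ * max |coordAlong q q' z| |coordAlong q' q z| ^ (M₁ + M₂)) := by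
        rw [mul_pow, mul_left_comm]
    _ ≤ K ^ (M₁ + M₂) * |h z| := by
        gcongr
        exact min_mul_max_pow_le hc₁.le hc₂.le (abs_nonneg _) hX (abs_nonneg _) hY (h1 hzS) (h2 hzS)

theorem preimage_add_right (hS : IsSemianalytic S) (p : ℝ × ℝ) :
    IsSemianalytic ((fun z => z + p) ⁻¹' S) := by
  intro z
  obtain ⟨W, hW, m, k, f, g, hf, hg, hdesc⟩ := hS (z + p)
  have hadd : ∀ w : ℝ × ℝ, AnalyticAt ℝ (fun z => z + p) w := fun w =>
    analyticAt_id.add analyticAt_const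
  refine ⟨(fun z => z + p) ⁻¹' W, (hadd z).continuousAt.preimage_mem_nhds hW, m, k,
    fun i z => f i (z + p), fun i j z => g i j (z + p), fun i w hw => ?_, fun i j w hw => ?_,
    fun w hw => hdesc _ hw⟩
  · exact (hf i _ hw).comp (f := fun z => z + p) (hadd w)
  · exact (hg i j _ hw).comp (f := fun z => z + p) (hadd w)

theorem exists_eventually_mul_norm_sub_pow_le (hSA : IsSemianalytic S) (hS : IsClosed S)
    {h : ℝ × ℝ → ℝ} {p : ℝ × ℝ} (hh : AnalyticAt ℝ h p) (h0 : h p = 0)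
    (hne : ∀ᶠ z in 𝓝 p, z ∈ S → h z = 0 → z = p) :
    ∃ (M : ℕ) (c : ℝ), 0 < c ∧ ∀ᶠ z in 𝓝 p, z ∈ S → c * ‖z - p‖ ^ M ≤ |h z| := by
  have hadd : AnalyticAt ℝ (fun z => z + p) 0 := analyticAt_id.add analyticAt_const
  have htadd : Tendsto (fun z => z + p) (𝓝 0) (𝓝 p) :=
    (by fun_prop : Continuous fun z : ℝ × ℝ => z + p).tendsto' 0 p (zero_add p)
  have htsub : Tendsto (fun z => z - p) (𝓝 p) (𝓝 0) :=
    (by fun_prop : Continuous fun z : ℝ × ℝ => z - p).tendsto' p 0 (sub_self p)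
  obtain ⟨M, c, hc, hM⟩ := (hSA.preimage_add_right p).exists_eventually_mul_norm_pow_le_zero
    (hS.preimage (by fun_prop : Continuous fun z => z + p))
    (hh.comp_of_eq hadd (zero_add p)) (by simp [h0])
    ((htadd.eventually hne).mono fun z hz hzS hz0 => by simpa using hz hzS hz0)
  refine ⟨M, c, hc, (htsub.eventually hM).mono fun z hz hzS => ?_⟩
  simpa using hz (by simpa using hzS)

end IsSemianalytic

/-! ### Families of increasing branches with a repelling fixed point -/

theorem tendsto_sum_range_of_dominated {ι : Type*} {𝓕 : Filter ι} {f : ι → ℕ → ℝ} {g bound : ℕ → ℝ}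
    {n : ι → ℕ} (hn : Tendsto n 𝓕 atTop) (hsum : Summable bound)
    (hlim : ∀ k, Tendsto (f · k) 𝓕 (𝓝 (g k)))
    (hbound : ∀ᶠ t in 𝓕, ∀ k < n t, |f t k| ≤ bound k) :
    Tendsto (fun t => ∑ k ∈ Finset.range (n t), f t k) 𝓕 (𝓝 (∑' k, g k)) := by
  have htrunc : ∀ k, Tendsto (fun t => if k < n t then f t k else 0) 𝓕 (𝓝 (g k)) := fun k =>
    (hlim k).congr' <| (hn.eventually (eventually_gt_atTop k)).mono fun t ht => (if_pos ht).symm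
  refine (tendsto_tsum_of_dominated_convergence hsum.abs htrunc ?_).congr fun t => ?_
  · filter_upwards [hbound] with t ht k
    split_ifs with hk
    · exact (ht k hk).trans (le_abs_self _)
    · simp
  · rw [tsum_eq_sum (s := Finset.range (n t)) fun k hk => if_neg (by simpa using hk)]
    exact Finset.sum_congr rfl fun k hk => if_pos (Finset.mem_range.1 hk)

theorem apply_iterate_sub_succ {β : Type*} (b : β → β) (x : β) {n k : ℕ} (hk : k + 1 ≤ n) :
    b (b^[n - (k + 1)] x) = b^[n - k] x := by
  rw [← Function.iterate_succ_apply' b, Nat.succ_eq_add_one, show n - (k + 1) + 1 = n - k by omega]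

/-- `OrbitIn b d n x y` says that `n` applications of `b` lead from `x` to `y`, all the points
before `y` lying in `[0, d]`. -/
def OrbitIn (b : ℝ → ℝ) (d : ℝ) (n : ℕ) (x y : ℝ) : Prop :=
  (∀ i < n, b^[i] x ∈ Icc 0 d) ∧ b^[n] x = y

namespace OrbitIn

variable {b : ℝ → ℝ} {d x y : ℝ} {n : ℕ}

theorem of_le {m : ℕ} (h : OrbitIn b d n x y) (hm : m ≤ n) : OrbitIn b d m x (b^[m] x) :=
  ⟨fun i hi => h.1 i (hi.trans_le hm), rfl⟩

theorem tail (h : OrbitIn b d (n + 1) x y) : OrbitIn b d n (b x) y :=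
  ⟨fun i hi => h.1 (i + 1) (Nat.succ_lt_succ hi), h.2⟩

theorem iterate_sub_le_pow_mul {ρ : ℝ} (h : OrbitIn b d n x y) (hρ : 0 ≤ ρ)
    (hb : ∀ x ∈ Icc 0 d, x ≤ ρ * b x) : ∀ k ≤ n, b^[n - k] x ≤ ρ ^ k * y
  | 0, _ => by simp [h.2]
  | k + 1, hk => by
    calc b^[n - (k + 1)] x ≤ ρ * b (b^[n - (k + 1)] x) := hb _ (h.1 _ (by omega))
      _ ≤ ρ * (ρ ^ k * y) := by
        rw [apply_iterate_sub_succ b x hk]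
        exact mul_le_mul_of_nonneg_left (h.iterate_sub_le_pow_mul hρ hb k (by omega)) hρ
      _ = ρ ^ (k + 1) * y := by ring

end OrbitIn

/-- A backward orbit of the end point `d` under a branch on `[0, d]`. -/
def IsBackwardOrbit (b : ℝ → ℝ) (d : ℝ) (w : ℕ → ℝ) : Prop :=
  w 0 = d ∧ ∀ k, w (k + 1) ∈ Ioo 0 d ∧ b (w (k + 1)) = w k

/-- The common domain of the branches of a family: the pairs of a parameter `p ∈ U` and a point of
`[0, c p]`. -/
def branchDomain {X : Type*} (U : Set X) (c : X → ℝ) : Set (X × ℝ) :=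
  {z | z.1 ∈ U ∧ z.2 ∈ Icc 0 (c z.1)}

/-- A continuous family, over a compact parameter set `U`, of increasing branches
`B p : [0, c p] → [0, 1]` fixing `0` and no interior point. The derivative `B' p` may vanish at
`c p` only, unless the branch is constant; near `0` its logarithm is Lipschitz, locally uniformly
in the parameter. -/
structure IsBranchFamily {X : Type*} [TopologicalSpace X] (U : Set X) (B B' : X → ℝ → ℝ)
    (c : X → ℝ) : Prop where
  isCompact : IsCompact U
  continuousOn_right : ContinuousOn c U
  right_mem : ∀ p ∈ U, c p ∈ Ioo (0 : ℝ) 1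
  continuousOn : ContinuousOn (fun z : X × ℝ => B z.1 z.2) (branchDomain U c)
  continuousOn_deriv : ContinuousOn (fun z : X × ℝ => B' z.1 z.2) (branchDomain U c)
  hasDerivWithinAt : ∀ p ∈ U, ∀ x ∈ Icc 0 (c p),
    HasDerivWithinAt (B p) (B' p x) (Icc 0 (c p)) x
  map_zero : ∀ p ∈ U, B p 0 = 0
  map_mem : ∀ p ∈ U, ∀ x ∈ Icc 0 (c p), B p x ∈ Icc (0 : ℝ) 1
  ne_self : ∀ p ∈ U, ∀ x ∈ Ioo 0 (c p), B p x ≠ x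
  deriv_pos : ∀ p ∈ U, 0 < B p (c p) → ∀ x ∈ Ico 0 (c p), 0 < B' p x
  exists_abs_log_deriv_sub_le : ∀ q ∈ U, 0 < B q (c q) → ∀ s ∈ Ioo 0 (c q), ∃ C : ℝ, 0 ≤ C ∧
    ∀ᶠ p in 𝓝[U] q, ∀ x ∈ Icc 0 s, |Real.log (B' p x) - Real.log (B' p 0)| ≤ C * x

namespace IsBranchFamily

variable {X : Type*} [TopologicalSpace X] {U : Set X} {B B' : X → ℝ → ℝ} {c : X → ℝ} {p q : X}

theorem continuousOn_apply (H : IsBranchFamily U B B' c) (hp : p ∈ U) :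
    ContinuousOn (B p) (Icc 0 (c p)) :=
  fun _ hx => (H.hasDerivWithinAt p hp _ hx).continuousWithinAt

theorem continuousOn_apply_right (H : IsBranchFamily U B B' c) :
    ContinuousOn (fun p => B p (c p)) U :=
  H.continuousOn.comp (continuousOn_id.prodMk H.continuousOn_right)
    fun _ hp => ⟨hp, right_mem_Icc.2 (H.right_mem _ hp).1.le⟩

theorem exists_sub_eq (H : IsBranchFamily U B B' c) (hp : p ∈ U) {x y : ℝ} (hx : 0 ≤ x)
    (hxy : x < y) (hy : y ≤ c p) : ∃ ξ ∈ Ioo x y, B p y - B p x = B' p ξ * (y - x) := by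
  have hsub : Icc x y ⊆ Icc 0 (c p) := Icc_subset_Icc hx hy
  obtain ⟨ξ, hξ, h⟩ := exists_hasDerivAt_eq_slope (B p) (B' p) hxy
    ((H.continuousOn_apply hp).mono hsub) fun z hz =>
      (H.hasDerivWithinAt p hp z (hsub (Ioo_subset_Icc_self hz))).hasDerivAt
        (Icc_mem_nhds (hx.trans_lt hz.1) (hz.2.trans_le hy))
  exact ⟨ξ, hξ, by rw [h, div_mul_cancel₀ _ (sub_pos.2 hxy).ne']⟩

theorem strictMonoOn (H : IsBranchFamily U B B' c) (hp : p ∈ U) (hval : 0 < B p (c p)) :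
    StrictMonoOn (B p) (Icc 0 (c p)) := fun x hx y hy hxy => by
  obtain ⟨ξ, hξ, h⟩ := H.exists_sub_eq hp hx.1 hxy hy.2
  have hpos := H.deriv_pos p hp hval ξ ⟨hx.1.trans hξ.1.le, hξ.2.trans_le hy.2⟩
  exact sub_pos.1 (h ▸ mul_pos hpos (sub_pos.2 hxy))

theorem lt_apply (H : IsBranchFamily U B B' c) (hp : p ∈ U) (hval : c p < B p (c p)) {x : ℝ}
    (hx : x ∈ Ioc 0 (c p)) : x < B p x := by
  by_contra! hle
  have hcont : ContinuousOn (fun y => B p y - y) (Icc x (c p)) :=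
    ((H.continuousOn_apply hp).mono (Icc_subset_Icc_left hx.1.le)).sub continuousOn_id
  obtain ⟨y, hy, hy0⟩ := intermediate_value_Icc hx.2 hcont
    (show (0 : ℝ) ∈ Icc _ _ from ⟨sub_nonpos.2 hle, sub_nonneg.2 hval.le⟩)
  have hfix : B p y = y := sub_eq_zero.1 hy0
  have hyc : y < c p := hy.2.lt_of_ne (by rintro rfl; exact hval.ne' hfix)
  exact H.ne_self p hp y ⟨hx.1.trans_le hy.1, hyc⟩ hfix

theorem exists_apply_eq (H : IsBranchFamily U B B' c) (hq : q ∈ U) (hval : B q (c q) = 1) {y : ℝ}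
    (hy : y ∈ Ioo (0 : ℝ) 1) : ∃ x ∈ Ioo 0 (c q), B q x = y := by
  obtain ⟨x, hx, hxy⟩ := intermediate_value_Ioo (H.right_mem q hq).1.le (H.continuousOn_apply hq)
    (show y ∈ Ioo _ _ by rwa [H.map_zero q hq, hval])
  exact ⟨x, hx, hxy⟩

theorem exists_log_sub_eq (H : IsBranchFamily U B B' c) (hp : p ∈ U) (hval : 0 < B p (c p))
    {x' y' : ℝ} : ∀ {n : ℕ} {x y : ℝ}, x < y → OrbitIn (B p) (c p) n x x' →
      OrbitIn (B p) (c p) n y y' → ∃ ζ : ℕ → ℝ,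
        (∀ k < n, ζ k ∈ Ioo ((B p)^[n - (k + 1)] x) ((B p)^[n - (k + 1)] y)) ∧
        Real.log (y' - x') = Real.log (y - x) + ∑ k ∈ Finset.range n, Real.log (B' p (ζ k))
  | 0, x, y, _, hx, hy => ⟨0, by simp, by simp [← hx.2, ← hy.2]⟩
  | n + 1, x, y, hxy, hx, hy => by
    have hx0 : x ∈ Icc 0 (c p) := hx.1 0 n.succ_pos
    have hy0 : y ∈ Icc 0 (c p) := hy.1 0 n.succ_pos
    obtain ⟨ζ, hζ, hlog⟩ := H.exists_log_sub_eq hp hval (H.strictMonoOn hp hval hx0 hy0 hxy)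
      hx.tail hy.tail
    obtain ⟨ξ, hξ, hmvt⟩ := H.exists_sub_eq hp hx0.1 hxy hy0.2
    have hpos := H.deriv_pos p hp hval ξ ⟨hx0.1.trans hξ.1.le, hξ.2.trans_le hy0.2⟩
    refine ⟨fun k => if k < n then ζ k else ξ, fun k hk => ?_, ?_⟩
    · rcases (Nat.lt_succ_iff.1 hk).lt_or_eq with hkn | rfl
      · simpa only [if_pos hkn, ← Function.iterate_succ_apply, Nat.succ_eq_add_one,
          show n - (k + 1) + 1 = n + 1 - (k + 1) by omega] using hζ k hkn
      · simpa using hξ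
    · have hsum : ∀ k ∈ Finset.range n, Real.log (B' p (if k < n then ζ k else ξ)) =
          Real.log (B' p (ζ k)) := fun k hk => by rw [if_pos (Finset.mem_range.1 hk)]
      simp only [Finset.sum_range_succ, Finset.sum_congr rfl hsum, lt_irrefl, if_false, hlog]
      rw [hmvt, Real.log_mul hpos.ne' (sub_pos.2 hxy).ne']
      ring

theorem exists_eventually_mul_le_apply (H : IsBranchFamily U B B' c) (hq : q ∈ U) {τ : ℝ}
    (hτ : τ < B' q 0) : ∃ r : ℝ, 0 < r ∧ ∀ᶠ p in 𝓝[U] q, ∀ x ∈ Icc 0 (c p), x < r →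
      τ * x ≤ B p x := by
  have hev : ∀ᶠ z in 𝓝[branchDomain U c] (q, (0 : ℝ)), τ < B' z.1 z.2 :=
    (H.continuousOn_deriv _ ⟨hq, left_mem_Icc.2 (H.right_mem q hq).1.le⟩).eventually
      (lt_mem_nhds hτ)
  obtain ⟨V, hV, W, hW, hVW⟩ := mem_nhds_prod_iff.1 (eventually_nhdsWithin_iff.1 hev)
  obtain ⟨r, hr, hball⟩ := Metric.mem_nhds_iff.1 hW
  refine ⟨r, hr, ?_⟩
  filter_upwards [self_mem_nhdsWithin, mem_nhdsWithin_of_mem_nhds hV] with p hp hpV x hx hxr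
  rcases hx.1.eq_or_lt with rfl | hx0
  · rw [H.map_zero p hp, mul_zero]
  obtain ⟨ξ, hξ, h⟩ := H.exists_sub_eq hp le_rfl hx0 hx.2
  rw [H.map_zero p hp, sub_zero, sub_zero] at h
  have hξW : ξ ∈ W := hball <| by
    rw [Metric.mem_ball, Real.dist_eq, sub_zero, abs_of_pos hξ.1]
    exact hξ.2.trans hxr
  have hderiv : τ < B' p ξ := hVW (mk_mem_prod hpV hξW) ⟨hp, hξ.1.le, hξ.2.le.trans hx.2⟩
  rw [h]
  exact mul_le_mul_of_nonneg_right hderiv.le hx.1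

theorem tendsto_apply {ι : Type*} {𝓕 : Filter ι} (H : IsBranchFamily U B B' c) (hq : q ∈ U)
    {p : ι → X} (hp : Tendsto p 𝓕 (𝓝[U] q)) {x : ι → ℝ} {y : ℝ} (hx : Tendsto x 𝓕 (𝓝 y))
    (hxc : ∀ᶠ t in 𝓕, x t ∈ Icc 0 (c (p t))) (hy : y ∈ Icc 0 (c q)) :
    Tendsto (fun t => B (p t) (x t)) 𝓕 (𝓝 (B q y)) :=
  (H.continuousOn (q, y) ⟨hq, hy⟩).tendsto.comp <| tendsto_nhdsWithin_iff.2
    ⟨(tendsto_nhdsWithin_iff.1 hp).1.prodMk_nhds hx, (tendsto_nhdsWithin_iff.1 hp).2.and hxc⟩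

theorem tendsto_deriv_apply {ι : Type*} {𝓕 : Filter ι} (H : IsBranchFamily U B B' c) (hq : q ∈ U)
    {p : ι → X} (hp : Tendsto p 𝓕 (𝓝[U] q)) {x : ι → ℝ} {y : ℝ} (hx : Tendsto x 𝓕 (𝓝 y))
    (hxc : ∀ᶠ t in 𝓕, x t ∈ Icc 0 (c (p t))) (hy : y ∈ Icc 0 (c q)) :
    Tendsto (fun t => B' (p t) (x t)) 𝓕 (𝓝 (B' q y)) :=
  (H.continuousOn_deriv (q, y) ⟨hq, hy⟩).tendsto.comp <| tendsto_nhdsWithin_iff.2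
    ⟨(tendsto_nhdsWithin_iff.1 hp).1.prodMk_nhds hx, (tendsto_nhdsWithin_iff.1 hp).2.and hxc⟩

theorem eventually_apply_right_pos (H : IsBranchFamily U B B' c) (hq : q ∈ U)
    (hval : 0 < B q (c q)) : ∀ᶠ p in 𝓝[U] q, 0 < B p (c p) :=
  (H.continuousOn_apply_right q hq).eventually (lt_mem_nhds hval)

theorem tendsto_of_tendsto_apply {ι : Type*} {𝓕 : Filter ι} (H : IsBranchFamily U B B' c)
    (hq : q ∈ U) (hval : 0 < B q (c q)) {p : ι → X} (hp : Tendsto p 𝓕 (𝓝[U] q)) {x : ι → ℝ}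
    {y : ℝ} (hxc : ∀ᶠ t in 𝓕, x t ∈ Icc 0 (c (p t))) (hy : y ∈ Ioc 0 (c q))
    (hB : Tendsto (fun t => B (p t) (x t)) 𝓕 (𝓝 (B q y))) : Tendsto x 𝓕 (𝓝 y) := by
  have hy' : y ∈ Icc 0 (c q) := Ioc_subset_Icc_self hy
  have hmono : ∀ᶠ t in 𝓕, StrictMonoOn (B (p t)) (Icc 0 (c (p t))) := by
    filter_upwards [hp.eventually (H.eventually_apply_right_pos hq hval),
      (tendsto_nhdsWithin_iff.1 hp).2] with t hpos hpU using H.strictMonoOn hpU hpos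
  have hmem : ∀ a ∈ Ioo 0 (c q), ∀ᶠ t in 𝓕, a ∈ Icc 0 (c (p t)) := fun a ha => by
    filter_upwards [hp.eventually ((H.continuousOn_right q hq).eventually (lt_mem_nhds ha.2))]
      with t ht using ⟨ha.1.le, ht.le⟩
  have hconst : ∀ a ∈ Ioo 0 (c q), Tendsto (fun t => B (p t) a) 𝓕 (𝓝 (B q a)) := fun a ha =>
    H.tendsto_apply hq hp tendsto_const_nhds (hmem a ha) ⟨ha.1.le, ha.2.le⟩
  refine tendsto_order.2 ⟨fun a ha => ?_, fun b hb => ?_⟩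
  · obtain ⟨a', haa', hay'⟩ := exists_between (max_lt ha hy.1)
    have ha' : a' ∈ Ioo 0 (c q) := ⟨(le_max_right _ _).trans_lt haa', hay'.trans_le hy.2⟩
    have hlt := H.strictMonoOn hq hval ⟨ha'.1.le, ha'.2.le⟩ hy' hay'
    filter_upwards [(hconst a' ha').eventually_lt hB hlt, hmem a' ha', hxc, hmono]
      with t hBt ha't hxt hmt
    exact ((le_max_left _ _).trans_lt haa').trans ((hmt.lt_iff_lt ha't hxt).1 hBt)
  · rcases hy.2.eq_or_lt with rfl | hyc
    · filter_upwards [hp.eventually ((H.continuousOn_right q hq).eventually (gt_mem_nhds hb)), hxc]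
        with t hbt hxt using hxt.2.trans_lt hbt
    obtain ⟨b', hyb', hbb'⟩ := exists_between (lt_min hb hyc)
    have hb' : b' ∈ Ioo 0 (c q) := ⟨hy.1.trans hyb', hbb'.trans_le (min_le_right _ _)⟩
    have hlt := H.strictMonoOn hq hval hy' ⟨hb'.1.le, hb'.2.le⟩ hyb'
    filter_upwards [hB.eventually_lt (hconst b' hb') hlt, hmem b' hb', hxc, hmono]
      with t hBt hb't hxt hmt
    exact ((hmt.lt_iff_lt hxt hb't).1 hBt).trans (hbb'.trans_le (min_le_left _ _))

theorem exists_isBackwardOrbit (H : IsBranchFamily U B B' c) (hq : q ∈ U) (hval : B q (c q) = 1) :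
    ∃ w, IsBackwardOrbit (B q) (c q) w := by
  have hinv : ∀ y : ℝ, ∃ x, y ∈ Ioo (0 : ℝ) 1 → x ∈ Ioo 0 (c q) ∧ B q x = y := fun y => by
    by_cases hy : y ∈ Ioo (0 : ℝ) 1
    · obtain ⟨x, hx⟩ := H.exists_apply_eq hq hval hy
      exact ⟨x, fun _ => hx⟩
    · exact ⟨0, fun h => absurd h hy⟩
  choose g hg using hinv
  have hmem : ∀ k, g^[k] (c q) ∈ Ioo (0 : ℝ) 1 := fun k => by
    induction k with
    | zero => exact H.right_mem q hq
    | succ k ih =>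
      rw [Function.iterate_succ_apply']
      exact ⟨(hg _ ih).1.1, (hg _ ih).1.2.trans (H.right_mem q hq).2⟩
  refine ⟨fun k => g^[k] (c q), rfl, fun k => ?_⟩
  simp only [Function.iterate_succ_apply']
  exact hg _ (hmem k)

theorem tendsto_iterate_sub {ι : Type*} {𝓕 : Filter ι} (H : IsBranchFamily U B B' c)
    (hq : q ∈ U) (hval : B q (c q) = 1) {p : ι → X} (hp : Tendsto p 𝓕 (𝓝[U] q)) {n : ι → ℕ}
    (hn : Tendsto n 𝓕 atTop) {x y : ι → ℝ}
    (hx : ∀ᶠ t in 𝓕, OrbitIn (B (p t)) (c (p t)) (n t) (x t) (y t))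
    (hy : Tendsto y 𝓕 (𝓝 (c q))) {w : ℕ → ℝ} (hw : IsBackwardOrbit (B q) (c q) w) (k : ℕ) :
    Tendsto (fun t => (B (p t))^[n t - k] (x t)) 𝓕 (𝓝 (w k)) := by
  induction k with
  | zero =>
    rw [hw.1]
    refine hy.congr' ?_
    filter_upwards [hx] with t ht using ht.2.symm
  | succ k ih =>
    have hk := hn.eventually (eventually_ge_atTop (k + 1))
    refine H.tendsto_of_tendsto_apply hq (hval ▸ one_pos) hp ?_ (Ioo_subset_Ioc_self (hw.2 k).1) ?_
    · filter_upwards [hk, hx] with t hkt hxt using hxt.1 _ (by omega)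
    · rw [(hw.2 k).2]
      refine ih.congr' ?_
      filter_upwards [hk] with t ht using (apply_iterate_sub_succ _ _ ht).symm

variable [T2Space X]

theorem isCompact_branchDomain (H : IsBranchFamily U B B' c) : IsCompact (branchDomain U c) := by
  have hK : IsCompact (U ×ˢ Icc (0 : ℝ) 1) := H.isCompact.prod isCompact_Icc
  have hsub : branchDomain U c ⊆ U ×ˢ Icc (0 : ℝ) 1 := fun z hz =>
    ⟨hz.1, hz.2.1, hz.2.2.trans (H.right_mem _ hz.1).2.le⟩
  have hcont : ContinuousOn (fun z : X × ℝ => c z.1 - z.2) (U ×ˢ Icc (0 : ℝ) 1) :=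
    (H.continuousOn_right.comp continuousOn_fst fun z hz => hz.1).sub continuousOn_snd
  refine hK.of_isClosed_subset ?_ hsub
  convert hcont.preimage_isClosed_of_isClosed hK.isClosed (isClosed_Ici (a := (0 : ℝ))) using 1
  ext z
  exact ⟨fun h => ⟨hsub h, sub_nonneg.2 h.2.2⟩, fun h => ⟨h.1.1, h.1.2.1, sub_nonneg.1 h.2⟩⟩

theorem exists_forall_add_le_apply (H : IsBranchFamily U B B' c) {s δ : ℝ} (hs : 0 < s)
    (hδ : 0 < δ) : ∃ η : ℝ, 0 < η ∧ ∀ p ∈ U, c p + s ≤ B p (c p) →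
      ∀ x ∈ Icc δ (c p), x + η ≤ B p x := by
  set K := branchDomain U c ∩ (fun z : X × ℝ => (B z.1 (c z.1) - c z.1, z.2)) ⁻¹' (Ici s ×ˢ Ici δ)
  have hfst : MapsTo Prod.fst (branchDomain U c) U := fun z hz => hz.1
  have hK : IsCompact K := H.isCompact_branchDomain.of_isClosed_subset
    ((((H.continuousOn_apply_right.sub H.continuousOn_right).comp continuousOn_fst hfst).prodMk
      continuousOn_snd).preimage_isClosed_of_isClosed H.isCompact_branchDomain.isClosed
        (isClosed_Ici.prod isClosed_Ici)) inter_subset_left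
  have hpos : ∀ z ∈ K, 0 < B z.1 z.2 - z.2 := fun z ⟨hz, hzs, hzδ⟩ =>
    sub_pos.2 (H.lt_apply hz.1 (sub_pos.1 (hs.trans_le hzs)) ⟨hδ.trans_le hzδ, hz.2.2⟩)
  obtain ⟨η, hη, hle⟩ := hK.exists_forall_le'
    ((H.continuousOn.sub continuousOn_snd).mono inter_subset_left) hpos
  refine ⟨η, hη, fun p hp hps x hx => ?_⟩
  have hmem : (p, x) ∈ K := ⟨⟨hp, hδ.le.trans hx.1, hx.2⟩, le_sub_iff_add_le'.2 hps, hx.1⟩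
  exact le_sub_iff_add_le'.1 (hle _ hmem)

theorem exists_forall_lt_of_orbitIn (H : IsBranchFamily U B B' c) {s δ : ℝ} (hs : 0 < s)
    (hδ : 0 < δ) : ∃ N : ℕ, ∀ p ∈ U, c p + s ≤ B p (c p) → ∀ n ≥ N, ∀ x y : ℝ,
      OrbitIn (B p) (c p) n x y → x < δ := by
  obtain ⟨η, hη, hstep⟩ := H.exists_forall_add_le_apply hs hδ
  obtain ⟨m, hm⟩ := exists_nat_gt (1 / η)
  refine ⟨m + 1, fun p hp hps n hn x y hx => ?_⟩
  by_contra! hδx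
  have hgrow : ∀ i ≤ m, x + i * η ≤ (B p)^[i] x := fun i => by
    induction i with
    | zero => simp
    | succ i ih =>
      intro hi
      have hprev := ih (by omega)
      have hnonneg : 0 ≤ (i : ℝ) * η := by positivity
      have hnext := hstep p hp hps _ ⟨by linarith, (hx.1 i (by omega)).2⟩
      rw [Function.iterate_succ_apply']
      push_cast
      linarith
  have hgrowm := hgrow m le_rfl
  have hxm := (hx.1 m (by omega)).2
  have hc := (H.right_mem p hp).2
  rw [div_lt_iff₀ hη] at hm
  linarith

theorem exists_eventually_le_mul_apply (H : IsBranchFamily U B B' c) (hq : q ∈ U)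
    (hval : c q < B q (c q)) (hexp : 1 < B' q 0) : ∃ ρ : ℝ, 0 < ρ ∧ ρ < 1 ∧
      ∀ᶠ p in 𝓝[U] q, ∀ x ∈ Icc 0 (c p), x ≤ ρ * B p x := by
  obtain ⟨τ, hτ1, hτ⟩ := exists_between hexp
  obtain ⟨r, hr, hnear⟩ := H.exists_eventually_mul_le_apply hq hτ
  obtain ⟨s, hs0, hs⟩ := exists_between (sub_pos.2 hval)
  obtain ⟨η, hη, hfar⟩ := H.exists_forall_add_le_apply hs0 hr
  have hgap : ∀ᶠ p in 𝓝[U] q, s < B p (c p) - c p :=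
    ((H.continuousOn_apply_right q hq).sub (H.continuousOn_right q hq)).eventually
      (lt_mem_nhds hs)
  refine ⟨max τ⁻¹ (1 + η)⁻¹, by positivity,
    max_lt (inv_lt_one_of_one_lt₀ hτ1) (inv_lt_one_of_one_lt₀ (by linarith)), ?_⟩
  filter_upwards [hnear, hgap, self_mem_nhdsWithin] with p hnearp hgapp hp x hx
  have hB := (H.map_mem p hp x hx).1
  rcases lt_or_ge x r with hxr | hxr
  · calc x ≤ τ⁻¹ * B p x := (le_inv_mul_iff₀ (by linarith)).2 (hnearp x hx hxr)
      _ ≤ _ := by gcongr; exact le_max_left _ _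
  · have hx1 : x * η ≤ η := mul_le_of_le_one_left hη.le (hx.2.trans (H.right_mem p hp).2.le)
    have hstep := hfar p hp (by linarith) x ⟨hxr, hx.2⟩
    calc x ≤ (1 + η)⁻¹ * B p x := (le_inv_mul_iff₀ (by linarith)).2 (by linarith)
      _ ≤ _ := by gcongr; exact le_max_right _ _

/-- The intermediate points `ζ t k`, read from the end of the orbits, are squeezed between two
orbits that follow the backward orbit of the end point `c q`. -/
theorem exists_eventually_log_sub_eq {ι : Type*} {𝓕 : Filter ι} (H : IsBranchFamily U B B' c)
    (hq : q ∈ U) (hval : B q (c q) = 1) (hexp : 1 < B' q 0) {p : ι → X}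
    (hp : Tendsto p 𝓕 (𝓝[U] q)) {n : ι → ℕ} (hn : Tendsto n 𝓕 atTop) {x y x' y' : ι → ℝ}
    (hxy : ∀ᶠ t in 𝓕, x t < y t)
    (hx : ∀ᶠ t in 𝓕, OrbitIn (B (p t)) (c (p t)) (n t) (x t) (x' t))
    (hy : ∀ᶠ t in 𝓕, OrbitIn (B (p t)) (c (p t)) (n t) (y t) (y' t))
    (hx' : Tendsto x' 𝓕 (𝓝 (c q))) (hy' : Tendsto y' 𝓕 (𝓝 (c q))) :
    ∃ ζ : ι → ℕ → ℝ, ∃ w : ℕ → ℝ, ∃ ρ ∈ Ioo (0 : ℝ) 1, ∃ s ∈ Ioo 0 (c q),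
      (∀ k, w k ∈ Ioo 0 (c q) ∧ Tendsto (ζ · k) 𝓕 (𝓝 (w k))) ∧
      ∀ᶠ t in 𝓕, (∀ k < n t, ζ t k ∈ Icc 0 (ρ ^ k * s)) ∧ Real.log (y' t - x' t) =
        Real.log (y t - x t) + ∑ k ∈ Finset.range (n t), Real.log (B' (p t) (ζ t k)) := by
  have hval0 : 0 < B q (c q) := hval ▸ one_pos
  obtain ⟨w, hw⟩ := H.exists_isBackwardOrbit hq hval
  have hwx := H.tendsto_iterate_sub hq hval hp hn hx hx' hw
  have hwy := H.tendsto_iterate_sub hq hval hp hn hy hy' hw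
  obtain ⟨ρ, hρ0, hρ1, hρ⟩ :=
    H.exists_eventually_le_mul_apply hq (hval ▸ (H.right_mem q hq).2) hexp
  obtain ⟨s, hws, hs⟩ := exists_between (hw.2 0).1.2
  have hlog : ∀ᶠ t in 𝓕, ∃ ζ : ℕ → ℝ, (∀ k < n t, ζ k ∈ Ioo ((B (p t))^[n t - (k + 1)] (x t))
      ((B (p t))^[n t - (k + 1)] (y t))) ∧ Real.log (y' t - x' t) =
        Real.log (y t - x t) + ∑ k ∈ Finset.range (n t), Real.log (B' (p t) (ζ k)) := by
    filter_upwards [hxy, hx, hy, (tendsto_nhdsWithin_iff.1 hp).2,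
      hp.eventually (H.eventually_apply_right_pos hq hval0)] with t hxyt hxt hyt hpU hpos
      using H.exists_log_sub_eq hpU hpos hxyt hxt hyt
  obtain ⟨ζ, hζ⟩ := skolem.1 hlog
  refine ⟨ζ, fun k => w (k + 1), ρ, ⟨hρ0, hρ1⟩, s, ⟨(hw.2 0).1.1.trans hws, hs⟩,
    fun k => ⟨(hw.2 k).1, ?_⟩, ?_⟩
  · have hk := hζ.and (hn.eventually (eventually_gt_atTop k))
    exact tendsto_of_tendsto_of_tendsto_of_le_of_le' (hwx (k + 1)) (hwy (k + 1))
      (hk.mono fun t ht => (ht.1.1 k ht.2).1.le) (hk.mono fun t ht => (ht.1.1 k ht.2).2.le)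
  · filter_upwards [hζ, hx, hy, hp.eventually hρ, (hwy 1).eventually (gt_mem_nhds hws)]
      with t hζt hxt hyt hρt hst
    refine ⟨fun k hk => ⟨(hxt.1 _ (by omega)).1.trans (hζt.1 k hk).1.le, ?_⟩, hζt.2⟩
    have hdecay := (hyt.of_le (Nat.sub_le _ 1)).iterate_sub_le_pow_mul hρ0.le hρt k (by omega)
    rw [show n t - 1 - k = n t - (k + 1) by omega] at hdecay
    exact (hζt.1 k hk).2.le.trans (hdecay.trans (by gcongr))

theorem exists_tendsto_log_sub_sub {ι : Type*} {𝓕 : Filter ι} (H : IsBranchFamily U B B' c)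
    (hq : q ∈ U) (hval : B q (c q) = 1) (hexp : 1 < B' q 0) {p : ι → X}
    (hp : Tendsto p 𝓕 (𝓝[U] q)) {n : ι → ℕ} (hn : Tendsto n 𝓕 atTop) {x y x' y' : ι → ℝ}
    (hxy : ∀ᶠ t in 𝓕, x t < y t)
    (hx : ∀ᶠ t in 𝓕, OrbitIn (B (p t)) (c (p t)) (n t) (x t) (x' t))
    (hy : ∀ᶠ t in 𝓕, OrbitIn (B (p t)) (c (p t)) (n t) (y t) (y' t))
    (hx' : Tendsto x' 𝓕 (𝓝 (c q))) (hy' : Tendsto y' 𝓕 (𝓝 (c q))) :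
    ∃ κ : ℝ, Tendsto (fun t => Real.log (y' t - x' t) - Real.log (y t - x t) -
      n t * Real.log (B' (p t) 0)) 𝓕 (𝓝 κ) := by
  have hval0 : 0 < B q (c q) := hval ▸ one_pos
  obtain ⟨ζ, w, ρ, hρ, s, hs, hlim, hlog⟩ :=
    H.exists_eventually_log_sub_eq hq hval hexp hp hn hxy hx hy hx' hy'
  obtain ⟨C, hC, hdist⟩ := H.exists_abs_log_deriv_sub_le q hq hval0 s hs
  have hpU := (tendsto_nhdsWithin_iff.1 hp).2
  have hle : ∀ k : ℕ, ρ ^ k * s ≤ s := fun k =>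
    mul_le_of_le_one_left hs.1.le (pow_le_one₀ hρ.1.le hρ.2.le)
  have hsc : ∀ᶠ t in 𝓕, s < c (p t) :=
    hp.eventually ((H.continuousOn_right q hq).eventually (lt_mem_nhds hs.2))
  have hzero : Tendsto (fun t => Real.log (B' (p t) 0)) 𝓕 (𝓝 (Real.log (B' q 0))) :=
    (H.tendsto_deriv_apply hq hp tendsto_const_nhds
      (hpU.mono fun t ht => left_mem_Icc.2 (H.right_mem _ ht).1.le)
      (left_mem_Icc.2 (H.right_mem q hq).1.le)).log (zero_lt_one.trans hexp).ne'
  have hterm : ∀ k, Tendsto (fun t => Real.log (B' (p t) (ζ t k)) - Real.log (B' (p t) 0)) 𝓕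
      (𝓝 (Real.log (B' q (w k)) - Real.log (B' q 0))) := fun k => by
    have hwk := (hlim k).1
    refine ((H.tendsto_deriv_apply hq hp (hlim k).2 ?_ ⟨hwk.1.le, hwk.2.le⟩).log
      (H.deriv_pos q hq hval0 _ ⟨hwk.1.le, hwk.2⟩).ne').sub hzero
    filter_upwards [hlog, hn.eventually (eventually_gt_atTop k), hsc] with t ht hkt hst
    exact ⟨(ht.1 k hkt).1, ((ht.1 k hkt).2.trans (hle k)).trans hst.le⟩
  have hbound : ∀ᶠ t in 𝓕, ∀ k < n t,
      |Real.log (B' (p t) (ζ t k)) - Real.log (B' (p t) 0)| ≤ C * (ρ ^ k * s) := by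
    filter_upwards [hlog, hp.eventually hdist] with t ht hdt k hk
    have hζ := ht.1 k hk
    exact (hdt _ ⟨hζ.1, hζ.2.trans (hle k)⟩).trans (mul_le_mul_of_nonneg_left hζ.2 hC)
  refine ⟨_, (tendsto_sum_range_of_dominated hn
    (((summable_geometric_of_lt_one hρ.1.le hρ.2).mul_right s).mul_left C) hterm hbound).congr' ?_⟩
  filter_upwards [hlog] with t ht
  rw [ht.2, Finset.sum_sub_distrib, Finset.sum_const, Finset.card_range, nsmul_eq_mul]
  ring

end IsBranchFamily

/-! ### Branches with a power-law critical point -/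

/-- The power-law part `u (1 - (1 - x / c) ^ α)` of a branch on `[0, c]`. -/
def powPart (α u c x : ℝ) : ℝ := u * (1 - (1 - x / c) ^ α)

/-- A branch on `[0, c]`, with power-law part of exponent `α` and diffeomorphic part `φ`. -/
def branch (α : ℝ) (φ : ℝ → ℝ) (u c x : ℝ) : ℝ := φ (powPart α u c x)

/-- The derivative of `branch α φ u c`. -/
def branchDeriv (α : ℝ) (φ : ℝ → ℝ) (u c x : ℝ) : ℝ :=
  deriv φ (powPart α u c x) * (u * (α * (1 - x / c) ^ (α - 1) / c))

/-- `φ` fixes `0` and `1`, and its derivative on `[0, 1]` is `ε`-Lipschitz and within `ε` of `1`.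
The derivative is two-sided also at the end points: in an analytic family the diffeomorphic parts
extend beyond `[0, 1]`. -/
structure IsC11CloseToId (ε : ℝ) (φ : ℝ → ℝ) : Prop where
  map_zero : φ 0 = 0
  map_one : φ 1 = 1
  differentiableAt : ∀ x ∈ Icc (0 : ℝ) 1, DifferentiableAt ℝ φ x
  abs_deriv_sub_one_le : ∀ x ∈ Icc (0 : ℝ) 1, |deriv φ x - 1| ≤ ε
  abs_deriv_sub_le : ∀ x ∈ Icc (0 : ℝ) 1, ∀ y ∈ Icc (0 : ℝ) 1,
    |deriv φ x - deriv φ y| ≤ ε * |x - y|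

section powPart

variable {α u c x : ℝ}

theorem powPart_zero (α u c : ℝ) : powPart α u c 0 = 0 := by
  simp [powPart]

theorem powPart_self (hα : α ≠ 0) (u : ℝ) (hc : c ≠ 0) : powPart α u c c = u := by
  rw [powPart, div_self hc, sub_self, Real.zero_rpow hα, sub_zero, mul_one]

theorem one_sub_div_mem_Icc (hc : 0 < c) (hx : x ∈ Icc 0 c) : 1 - x / c ∈ Icc (0 : ℝ) 1 :=
  ⟨sub_nonneg.2 ((div_le_one hc).2 hx.2), sub_le_self _ (div_nonneg hx.1 hc.le)⟩

theorem powPart_mem_Icc (hα : 0 ≤ α) (hu : u ∈ Icc (0 : ℝ) 1) (hc : 0 < c) (hx : x ∈ Icc 0 c) :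
    powPart α u c x ∈ Icc (0 : ℝ) 1 := by
  have h := one_sub_div_mem_Icc hc hx
  have h1 : (1 - x / c) ^ α ≤ 1 := Real.rpow_le_one h.1 h.2 hα
  have h0 : 0 ≤ (1 - x / c) ^ α := Real.rpow_nonneg h.1 _
  exact ⟨mul_nonneg hu.1 (by linarith), mul_le_one₀ hu.2 (by linarith) (by linarith)⟩

theorem sub_powPart (α u c x : ℝ) : u - powPart α u c x = u * (1 - x / c) ^ α := by
  rw [powPart]
  ring

theorem powPart_le (hα : 1 ≤ α) (hu : u ∈ Icc (0 : ℝ) 1) (hc : 0 < c) (hx : x ∈ Icc 0 c) :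
    powPart α u c x ≤ α * (x / c) := by
  have h := one_sub_div_mem_Icc hc hx
  have hle : (1 - x / c) ^ α ≤ 1 := Real.rpow_le_one h.1 h.2 (by linarith)
  have hbern : 1 + α * -(x / c) ≤ (1 + -(x / c)) ^ α :=
    one_add_mul_self_le_rpow_one_add (by linarith [h.1]) hα
  rw [← sub_eq_add_neg 1] at hbern
  calc powPart α u c x ≤ 1 * (1 - (1 - x / c) ^ α) :=
        mul_le_mul_of_nonneg_right hu.2 (by linarith)
    _ ≤ α * (x / c) := by linarith

theorem strictMonoOn_powPart (hα : 0 < α) (hu : 0 < u) (hc : 0 < c) :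
    StrictMonoOn (powPart α u c) (Icc 0 c) := fun x _ y hy hxy => by
  have h : (1 - y / c) ^ α < (1 - x / c) ^ α :=
    Real.rpow_lt_rpow (one_sub_div_mem_Icc hc hy).1 (by gcongr) hα
  exact mul_lt_mul_of_pos_left (by linarith) hu

theorem hasDerivAt_powPart (hα : 1 ≤ α) (u c x : ℝ) :
    HasDerivAt (powPart α u c) (u * (α * (1 - x / c) ^ (α - 1) / c)) x := by
  have h1 : HasDerivAt (fun x => 1 - x / c) (-(1 / c)) x :=
    ((hasDerivAt_id x).div_const c).const_sub 1
  exact (((h1.rpow_const (Or.inr hα)).const_sub 1).const_mul u).congr_deriv (by ring)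

end powPart

namespace IsC11CloseToId

variable {ε : ℝ} {φ : ℝ → ℝ}

theorem continuousOn (h : IsC11CloseToId ε φ) : ContinuousOn φ (Icc 0 1) := fun x hx =>
  (h.differentiableAt x hx).continuousAt.continuousWithinAt

theorem half_le_deriv (h : IsC11CloseToId ε φ) (hε : ε ≤ 1 / 2) {x : ℝ} (hx : x ∈ Icc (0 : ℝ) 1) :
    1 / 2 ≤ deriv φ x := by
  linarith [(abs_le.1 (h.abs_deriv_sub_one_le x hx)).1]

theorem strictMonoOn (h : IsC11CloseToId ε φ) (hε : ε ≤ 1 / 2) : StrictMonoOn φ (Icc 0 1) :=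
  strictMonoOn_of_deriv_pos (convex_Icc 0 1) h.continuousOn fun x hx => by
    linarith [h.half_le_deriv hε (interior_subset hx)]

theorem sub_le_two_mul_sub (h : IsC11CloseToId ε φ) (hε : ε ≤ 1) {x y : ℝ}
    (hx : x ∈ Icc (0 : ℝ) 1) (hy : y ∈ Icc (0 : ℝ) 1) (hxy : x ≤ y) :
    φ y - φ x ≤ 2 * (y - x) :=
  (convex_Icc 0 1).image_sub_le_mul_sub_of_deriv_le h.continuousOn
    (fun z hz => (h.differentiableAt z (interior_subset hz)).differentiableWithinAt)
    (fun z hz => by linarith [(abs_le.1 (h.abs_deriv_sub_one_le z (interior_subset hz))).2])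
    x hx y hy hxy

theorem exists_sub_eq (h : IsC11CloseToId ε φ) {x y : ℝ} (hx : 0 ≤ x) (hxy : x < y)
    (hy : y ≤ 1) : ∃ ζ ∈ Ioo x y, φ y - φ x = deriv φ ζ * (y - x) := by
  have hsub : Icc x y ⊆ Icc 0 1 := Icc_subset_Icc hx hy
  obtain ⟨ζ, hζ, heq⟩ := exists_deriv_eq_slope φ hxy (h.continuousOn.mono hsub) fun z hz =>
    (h.differentiableAt z (hsub (Ioo_subset_Icc_self hz))).differentiableWithinAt
  exact ⟨ζ, hζ, by rw [heq, div_mul_cancel₀ _ (sub_pos.2 hxy).ne']⟩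

theorem map_mem (h : IsC11CloseToId ε φ) (hε : ε ≤ 1 / 2) {x : ℝ} (hx : x ∈ Icc (0 : ℝ) 1) :
    φ x ∈ Icc (0 : ℝ) 1 := by
  have hmono := (h.strictMonoOn hε).monotoneOn
  constructor
  · simpa only [h.map_zero] using hmono (left_mem_Icc.2 zero_le_one) hx hx.1
  · simpa only [h.map_one] using hmono hx (right_mem_Icc.2 zero_le_one) hx.2

end IsC11CloseToId

theorem abs_log_sub_log_le {a b : ℝ} (ha : 1 / 2 ≤ a) (hb : 1 / 2 ≤ b) :
    |Real.log a - Real.log b| ≤ 2 * |a - b| := by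
  have log_sub_le : ∀ {a b : ℝ}, 1 / 2 ≤ a → 1 / 2 ≤ b →
      Real.log a - Real.log b ≤ 2 * |a - b| := fun {a b} ha hb => by
    have hb0 : 0 < b := by linarith
    have ha0 : 0 < a := by linarith
    rw [← Real.log_div ha0.ne' hb0.ne']
    refine (Real.log_le_sub_one_of_pos (div_pos ha0 hb0)).trans ?_
    rw [div_sub_one hb0.ne', div_le_iff₀ hb0]
    nlinarith [le_abs_self (a - b), abs_nonneg (a - b)]
  exact abs_sub_le_iff.2 ⟨log_sub_le ha hb, abs_sub_comm a b ▸ log_sub_le hb ha⟩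

theorem abs_log_one_sub_div_le {c s x : ℝ} (hs : s < c) (hx : x ∈ Icc 0 s) :
    |Real.log (1 - x / c)| ≤ x / (c - s) := by
  have hcx : 0 < c - x := by linarith [hx.2]
  have hc : 0 < c := by linarith [hx.1]
  have hform : 1 - x / c = (c - x) / c := by rw [sub_div, div_self hc.ne']
  have hinv : (1 - x / c)⁻¹ - 1 = x / (c - x) := by
    rw [hform, inv_div, div_sub_one hcx.ne', sub_sub_cancel]
  have hpos : 0 < 1 - x / c := hform ▸ div_pos hcx hc
  rw [abs_of_nonpos (Real.log_nonpos hpos.le (sub_le_self _ (div_nonneg hx.1 hc.le))),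
    ← Real.log_inv]
  calc Real.log (1 - x / c)⁻¹ ≤ (1 - x / c)⁻¹ - 1 := Real.log_le_sub_one_of_pos (inv_pos.2 hpos)
    _ = x / (c - x) := hinv
    _ ≤ x / (c - s) := div_le_div_of_nonneg_left hx.1 (by linarith) (by linarith [hx.2])

section branch

variable {α ε u c x : ℝ} {φ : ℝ → ℝ}

theorem hasDerivAt_branch (hφ : IsC11CloseToId ε φ) (hα : 1 ≤ α) (hu : u ∈ Icc (0 : ℝ) 1)
    (hc : 0 < c) (hx : x ∈ Icc 0 c) :
    HasDerivAt (branch α φ u c) (branchDeriv α φ u c x) x :=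
  (hφ.differentiableAt _ (powPart_mem_Icc (by linarith) hu hc hx)).hasDerivAt.comp x
    (hasDerivAt_powPart hα u c x)

theorem branchDeriv_pos (hφ : IsC11CloseToId ε φ) (hε : ε ≤ 1 / 2) (hα : 0 < α)
    (hu : u ∈ Ioc (0 : ℝ) 1) (hx : x ∈ Ico 0 c) : 0 < branchDeriv α φ u c x := by
  have hc : 0 < c := hx.1.trans_lt hx.2
  have hφ' := hφ.half_le_deriv hε
    (powPart_mem_Icc hα.le (Ioc_subset_Icc_self hu) hc (Ico_subset_Icc_self hx))
  have hpow : 0 < (1 - x / c) ^ (α - 1) :=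
    Real.rpow_pos_of_pos (sub_pos.2 ((div_lt_one hc).2 hx.2)) _
  have := hu.1
  exact mul_pos (by linarith) (by positivity)

theorem log_branchDeriv (hφ : IsC11CloseToId ε φ) (hε : ε ≤ 1 / 2) (hα : 0 < α)
    (hu : u ∈ Ioc (0 : ℝ) 1) (hx : x ∈ Ico 0 c) :
    Real.log (branchDeriv α φ u c x) = Real.log (deriv φ (powPart α u c x)) +
      (α - 1) * Real.log (1 - x / c) + Real.log (u * (α / c)) := by
  have hc : 0 < c := hx.1.trans_lt hx.2
  have hφ' := hφ.half_le_deriv hε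
    (powPart_mem_Icc hα.le (Ioc_subset_Icc_self hu) hc (Ico_subset_Icc_self hx))
  have hw : 0 < 1 - x / c := sub_pos.2 ((div_lt_one hc).2 hx.2)
  have hpow := Real.rpow_pos_of_pos hw (α - 1)
  have hform : branchDeriv α φ u c x =
      deriv φ (powPart α u c x) * (1 - x / c) ^ (α - 1) * (u * (α / c)) := by
    unfold branchDeriv
    ring
  rw [hform, Real.log_mul (mul_ne_zero (by linarith) hpow.ne')
    (mul_pos hu.1 (div_pos hα hc)).ne', Real.log_mul (by linarith) hpow.ne', Real.log_rpow hw]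

theorem abs_log_branchDeriv_sub_le {s : ℝ} (hφ : IsC11CloseToId ε φ) (hε : ε ≤ 1 / 2)
    (hα : 1 ≤ α) (hu : u ∈ Ioc (0 : ℝ) 1) (hs : s < c) (hx : x ∈ Icc 0 s) :
    |Real.log (branchDeriv α φ u c x) - Real.log (branchDeriv α φ u c 0)| ≤
      (2 * α - 1) / (c - s) * x := by
  have hα0 : 0 < α := by linarith
  have hxc : x ∈ Ico 0 c := ⟨hx.1, hx.2.trans_lt hs⟩
  have hc : 0 < c := hxc.1.trans_lt hxc.2
  have hu' := Ioc_subset_Icc_self hu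
  have hz := powPart_mem_Icc hα0.le hu' hc (Ico_subset_Icc_self hxc)
  have h0 : (0 : ℝ) ∈ Icc (0 : ℝ) 1 := left_mem_Icc.2 zero_le_one
  have hdiffeo : |Real.log (deriv φ (powPart α u c x)) - Real.log (deriv φ 0)| ≤
      α * (x / (c - s)) := by
    have hlip := hφ.abs_deriv_sub_le _ hz 0 h0
    rw [sub_zero, abs_of_nonneg hz.1] at hlip
    calc _ ≤ 2 * |deriv φ (powPart α u c x) - deriv φ 0| :=
          abs_log_sub_log_le (hφ.half_le_deriv hε hz) (hφ.half_le_deriv hε h0)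
      _ ≤ powPart α u c x := by nlinarith [hz.1]
      _ ≤ α * (x / c) := powPart_le hα hu' hc (Ico_subset_Icc_self hxc)
      _ ≤ α * (x / (c - s)) := mul_le_mul_of_nonneg_left
          (div_le_div_of_nonneg_left hx.1 (sub_pos.2 hs) (by linarith [hx.1, hx.2])) hα0.le
  have hpow : |(α - 1) * Real.log (1 - x / c)| ≤ (α - 1) * (x / (c - s)) := by
    rw [abs_mul, abs_of_nonneg (sub_nonneg.2 hα)]
    exact mul_le_mul_of_nonneg_left (abs_log_one_sub_div_le hs hx) (sub_nonneg.2 hα)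
  rw [log_branchDeriv hφ hε hα0 hu hxc, log_branchDeriv hφ hε hα0 hu ⟨le_rfl, hc⟩, powPart_zero,
    zero_div, sub_zero, Real.log_one, mul_zero, add_zero, add_sub_add_right_eq_sub,
    add_sub_right_comm]
  calc _ ≤ α * (x / (c - s)) + (α - 1) * (x / (c - s)) :=
        (abs_add_le _ _).trans (add_le_add hdiffeo hpow)
    _ = (2 * α - 1) / (c - s) * x := by ring

end branch

/-! ### The two branches of a Lorenz map -/

/-- The conjugate of `φ` by `x ↦ 1 - x`. -/
def flipMap (φ : ℝ → ℝ) (x : ℝ) : ℝ := 1 - φ (1 - x)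

theorem flipMap_flipMap (φ : ℝ → ℝ) : flipMap (flipMap φ) = φ :=
  funext fun x => by simp only [flipMap, sub_sub_cancel]

theorem deriv_flipMap (φ : ℝ → ℝ) (x : ℝ) : deriv (flipMap φ) x = deriv φ (1 - x) := by
  unfold flipMap
  rw [deriv_const_sub, deriv_comp_const_sub, neg_neg]

theorem one_sub_mem_Icc {x : ℝ} (hx : x ∈ Icc (0 : ℝ) 1) : 1 - x ∈ Icc (0 : ℝ) 1 :=
  ⟨sub_nonneg.2 hx.2, sub_le_self 1 hx.1⟩

theorem IsC11CloseToId.flipMap {ε : ℝ} {φ : ℝ → ℝ} (h : IsC11CloseToId ε φ) :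
    IsC11CloseToId ε (flipMap φ) where
  map_zero := by simp [_root_.flipMap, h.map_one]
  map_one := by simp [_root_.flipMap, h.map_zero]
  differentiableAt x hx := ((h.differentiableAt _ (one_sub_mem_Icc hx)).comp x
    (differentiableAt_id.const_sub 1)).const_sub 1
  abs_deriv_sub_one_le x hx := deriv_flipMap φ x ▸ h.abs_deriv_sub_one_le _ (one_sub_mem_Icc hx)
  abs_deriv_sub_le x hx y hy := by
    rw [deriv_flipMap, deriv_flipMap, abs_sub_comm x y, ← sub_sub_sub_cancel_left x y 1]
    exact h.abs_deriv_sub_le _ (one_sub_mem_Icc hx) _ (one_sub_mem_Icc hy)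

namespace LorenzData

/-- The conjugate of a Lorenz map by `x ↦ 1 - x`, which exchanges its two branches. Every notion
below is set up for the left branch only; its counterpart for the right branch of `f` is that notion
for `f.flip`. -/
def flip (f : LorenzData) : LorenzData := ⟨1 - f.c, f.v, f.u, flipMap f.phiR, flipMap f.phiL⟩

/-- The left branch of a Lorenz map, as a function on `[0, c]`. -/
def leftBranch (α : ℝ) (f : LorenzData) : ℝ → ℝ := branch α f.phiL f.u f.c

/-- The derivative of the left branch of a Lorenz map. -/
def leftDeriv (α : ℝ) (f : LorenzData) : ℝ → ℝ := branchDeriv α f.phiL f.u f.c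

/-- The multiplier of the fixed point `0` of a Lorenz map. -/
def leftMult (α : ℝ) (f : LorenzData) : ℝ := f.leftDeriv α 0

/-- `f` is a Lorenz map without fixed points other than `0` and `1`, whose diffeomorphic parts are
`ε`-close to the identity. -/
structure IsNearStandard (α ε : ℝ) (f : LorenzData) : Prop where
  c_mem : f.c ∈ Ioo (0 : ℝ) 1
  u_mem : f.u ∈ Icc (0 : ℝ) 1
  v_mem : f.v ∈ Icc (0 : ℝ) 1
  phiL : IsC11CloseToId ε f.phiL
  phiR : IsC11CloseToId ε f.phiR
  fixed : ∀ x ∈ Icc (0 : ℝ) 1, x ≠ f.c → f.map α x = x → x = 0 ∨ x = 1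

variable {α ε : ℝ} {f : LorenzData}

theorem flip_flip (f : LorenzData) : f.flip.flip = f := by
  simp only [flip, flipMap_flipMap, sub_sub_cancel]

theorem critValL_flip (f : LorenzData) : f.flip.critValL = 1 - f.critValR := rfl

theorem critValR_flip (f : LorenzData) : f.flip.critValR = 1 - f.critValL := by
  simp only [critValR, critValL, flip, flipMap, sub_sub_cancel]

theorem IsFull.flip (h : f.IsFull) : f.flip.IsFull :=
  ⟨by rw [critValL_flip, h.2, sub_zero], by rw [critValR_flip, h.1, sub_self]⟩

theorem map_of_lt (hc : 0 < f.c) {x : ℝ} (hx : x < f.c) : f.map α x = f.leftBranch α x := by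
  rw [map, if_pos hx, std, if_pos hx, leftBranch, branch, powPart, sub_div, div_self hc.ne']

theorem map_flip {x : ℝ} (hx : x ≠ f.c) : f.flip.map α (1 - x) = 1 - f.map α x := by
  rcases hx.lt_or_gt with h | h
  · have h' : ¬ 1 - x < 1 - f.c := by linarith
    simp only [map, std, flip, if_pos h, if_neg h', flipMap, sub_sub_cancel,
      sub_sub_sub_cancel_left]
    ring_nf
  · have h' : 1 - x < 1 - f.c := by linarith
    simp only [map, std, flip, if_neg h.not_gt, if_pos h', flipMap, sub_sub_sub_cancel_left]
    ring_nf

theorem iterate_map_flip {x : ℝ} : ∀ {n : ℕ}, (∀ i < n, (f.map α)^[i] x ≠ f.c) →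
    (f.flip.map α)^[n] (1 - x) = 1 - (f.map α)^[n] x
  | 0, _ => rfl
  | n + 1, h => by
    rw [Function.iterate_succ_apply', Function.iterate_succ_apply',
      iterate_map_flip fun i hi => h i (hi.trans n.lt_succ_self), map_flip (h n n.lt_succ_self)]

namespace IsNearStandard

theorem flip (hf : f.IsNearStandard α ε) : f.flip.IsNearStandard α ε where
  c_mem := ⟨sub_pos.2 hf.c_mem.2, sub_lt_self 1 hf.c_mem.1⟩
  u_mem := hf.v_mem
  v_mem := hf.u_mem
  phiL := hf.phiR.flipMap
  phiR := hf.phiL.flipMap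
  fixed x hx hxc hfix := by
    have hne : 1 - x ≠ f.c := fun h => hxc (by rw [LorenzData.flip, ← h, sub_sub_cancel])
    have hflip := map_flip (α := α) hne
    rw [sub_sub_cancel, hfix] at hflip
    rcases hf.fixed (1 - x) (one_sub_mem_Icc hx) hne (by linarith) with h | h
    · exact Or.inr (by linarith)
    · exact Or.inl (by linarith)

theorem leftBranch_self (hf : f.IsNearStandard α ε) (hα : α ≠ 0) :
    f.leftBranch α f.c = f.critValL := by
  rw [leftBranch, branch, powPart_self hα _ hf.c_mem.1.ne', critValL]

theorem leftBranch_zero (hf : f.IsNearStandard α ε) : f.leftBranch α 0 = 0 := by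
  rw [leftBranch, branch, powPart_zero, hf.phiL.map_zero]

theorem leftBranch_mem (hf : f.IsNearStandard α ε) (hε : ε ≤ 1 / 2) (hα : 0 ≤ α) {x : ℝ}
    (hx : x ∈ Icc 0 f.c) : f.leftBranch α x ∈ Icc (0 : ℝ) 1 :=
  hf.phiL.map_mem hε (powPart_mem_Icc hα hf.u_mem hf.c_mem.1 hx)

theorem hasDerivAt_leftBranch (hf : f.IsNearStandard α ε) (hα : 1 ≤ α) {x : ℝ}
    (hx : x ∈ Icc 0 f.c) : HasDerivAt (f.leftBranch α) (f.leftDeriv α x) x :=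
  hasDerivAt_branch hf.phiL hα hf.u_mem hf.c_mem.1 hx

theorem continuousOn_leftBranch (hf : f.IsNearStandard α ε) (hα : 1 ≤ α) :
    ContinuousOn (f.leftBranch α) (Icc 0 f.c) := fun _ hx =>
  (hf.hasDerivAt_leftBranch hα hx).continuousAt.continuousWithinAt

theorem leftBranch_ne_self (hf : f.IsNearStandard α ε) {x : ℝ} (hx : x ∈ Ioo 0 f.c) :
    f.leftBranch α x ≠ x := fun h => by
  have hx1 : x < 1 := hx.2.trans hf.c_mem.2
  rcases hf.fixed x ⟨hx.1.le, hx1.le⟩ hx.2.ne (by rwa [map_of_lt hf.c_mem.1 hx.2]) with h' | h'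
  · exact hx.1.ne' h'
  · exact hx1.ne h'

theorem u_pos (hf : f.IsNearStandard α ε) {x : ℝ} (hx : 0 < f.leftBranch α x) : 0 < f.u := by
  refine hf.u_mem.1.lt_of_ne fun h => hx.ne' ?_
  rw [leftBranch, branch, powPart, ← h, zero_mul, hf.phiL.map_zero]

theorem strictMonoOn_leftBranch (hf : f.IsNearStandard α ε) (hε : ε ≤ 1 / 2) (hα : 0 < α)
    (hu : 0 < f.u) : StrictMonoOn (f.leftBranch α) (Icc 0 f.c) :=
  (hf.phiL.strictMonoOn hε).comp (strictMonoOn_powPart hα hu hf.c_mem.1)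
    fun _ hx => powPart_mem_Icc hα.le hf.u_mem hf.c_mem.1 hx

end IsNearStandard

end LorenzData

/-! ### Analytic families of Lorenz maps -/

theorem hasDerivAt_of_analyticAt_uncurry {E : Type*} [NormedAddCommGroup E] [NormedSpace ℝ E]
    {φ : E → ℝ → ℝ} {p : E} {x : ℝ} (h : AnalyticAt ℝ (fun z : E × ℝ => φ z.1 z.2) (p, x)) :
    HasDerivAt (φ p) (fderiv ℝ (fun z : E × ℝ => φ z.1 z.2) (p, x) (0, 1)) x :=
  h.differentiableAt.hasFDerivAt.comp_hasDerivAt x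
    ((hasDerivAt_const x p).prodMk (hasDerivAt_id x))

theorem analyticAt_uncurry_deriv {E : Type*} [NormedAddCommGroup E] [NormedSpace ℝ E]
    {φ : E → ℝ → ℝ} {p : E} {x : ℝ} (h : AnalyticAt ℝ (fun z : E × ℝ => φ z.1 z.2) (p, x)) :
    AnalyticAt ℝ (fun z : E × ℝ => deriv (φ z.1) z.2) (p, x) := by
  refine AnalyticAt.congr (f := fun z => fderiv ℝ (fun z : E × ℝ => φ z.1 z.2) z (0, 1))
    (((ContinuousLinearMap.apply ℝ ℝ ((0 : E), (1 : ℝ))).analyticAt _).comp h.fderiv) ?_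
  filter_upwards [h.eventually_analyticAt] with z hz
  exact (hasDerivAt_of_analyticAt_uncurry hz).deriv.symm

/-- An analytic family, over a compact semianalytic set of parameters, of Lorenz maps whose
diffeomorphic parts are `ε`-close to the identity. -/
structure IsNearStandardFamily (α ε : ℝ) (U : Set (ℝ × ℝ)) (F : ℝ × ℝ → LorenzData) : Prop where
  isCompact : IsCompact U
  semianalytic : IsSemianalytic U
  isNearStandard : ∀ p ∈ U, (F p).IsNearStandard α ε
  analytic_c : AnalyticOnNhd ℝ (fun p => (F p).c) U
  analytic_u : AnalyticOnNhd ℝ (fun p => (F p).u) U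
  analytic_v : AnalyticOnNhd ℝ (fun p => (F p).v) U
  analytic_phiL :
    AnalyticOnNhd ℝ (fun z : (ℝ × ℝ) × ℝ => (F z.1).phiL z.2) (U ×ˢ Icc (0 : ℝ) 1)
  analytic_phiR :
    AnalyticOnNhd ℝ (fun z : (ℝ × ℝ) × ℝ => (F z.1).phiR z.2) (U ×ˢ Icc (0 : ℝ) 1)

theorem analyticOnNhd_flipMap {U : Set (ℝ × ℝ)} {φ : ℝ × ℝ → ℝ → ℝ}
    (h : AnalyticOnNhd ℝ (fun z : (ℝ × ℝ) × ℝ => φ z.1 z.2) (U ×ˢ Icc (0 : ℝ) 1)) :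
    AnalyticOnNhd ℝ (fun z : (ℝ × ℝ) × ℝ => flipMap (φ z.1) z.2) (U ×ˢ Icc (0 : ℝ) 1) :=
  fun z hz => analyticAt_const.sub <| (h (z.1, 1 - z.2) ⟨hz.1, one_sub_mem_Icc hz.2⟩).comp
    (f := fun z : (ℝ × ℝ) × ℝ => (z.1, 1 - z.2))
    (analyticAt_fst.prod (analyticAt_const.sub analyticAt_snd))

theorem IsC2CloseToId.isC11CloseToId {ε : ℝ} {φ : ℝ → ℝ} (h : IsC2CloseToId ε φ)
    (hφ : IsDiffeoPart φ) (hdiff : ∀ x ∈ Icc (0 : ℝ) 1, DifferentiableAt ℝ φ x) :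
    IsC11CloseToId ε φ := by
  have hderiv : ∀ x ∈ Icc (0 : ℝ) 1, iteratedDerivWithin 1 φ (Icc 0 1) x = deriv φ x :=
    fun x hx => by
      rw [iteratedDerivWithin_one]
      exact (hdiff x hx).derivWithin (uniqueDiffOn_Icc zero_lt_one x hx)
  refine ⟨hφ.map_zero, hφ.map_one, hdiff, fun x hx => hderiv x hx ▸ (h x hx).2.1,
    fun x hx y hy => ?_⟩
  have hdiff' : DifferentiableOn ℝ (iteratedDerivWithin 1 φ (Icc 0 1)) (Icc 0 1) :=
    hφ.contDiffOn.differentiableOn_iteratedDerivWithin (by norm_num) (uniqueDiffOn_Icc zero_lt_one)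
  rw [← hderiv x hx, ← hderiv y hy]
  exact (convex_Icc (0 : ℝ) 1).norm_image_sub_le_of_norm_derivWithin_le hdiff'
    (fun z hz => iteratedDerivWithin_succ (n := 1) (f := φ) ▸ (h z hz).2.2) hy hx

theorem IsAnalyticFamily.isNearStandardFamily {α ε : ℝ} {U : Set (ℝ × ℝ)} {F : ℝ × ℝ → LorenzData}
    (hF : IsAnalyticFamily α U F) (hclose : ∀ p ∈ U, (F p).IsCloseToStandard ε) :
    IsNearStandardFamily α ε U F where
  isCompact := hF.isCompact
  semianalytic := hF.semianalytic
  isNearStandard p hp :=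
    { c_mem := (hF.isLorenz p hp).c_mem
      u_mem := (hF.isLorenz p hp).u_mem
      v_mem := (hF.isLorenz p hp).v_mem
      phiL := (hclose p hp).1.isC11CloseToId (hF.isLorenz p hp).phiL fun x hx =>
        (hasDerivAt_of_analyticAt_uncurry (φ := fun p => (F p).phiL)
          (hF.analytic_phiL (p, x) ⟨hp, hx⟩)).differentiableAt
      phiR := (hclose p hp).2.isC11CloseToId (hF.isLorenz p hp).phiR fun x hx =>
        (hasDerivAt_of_analyticAt_uncurry (φ := fun p => (F p).phiR)
          (hF.analytic_phiR (p, x) ⟨hp, hx⟩)).differentiableAt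
      fixed := (hF.isLorenz p hp).fixed }
  analytic_c := hF.analytic_c
  analytic_u := hF.analytic_u
  analytic_v := hF.analytic_v
  analytic_phiL := hF.analytic_phiL
  analytic_phiR := hF.analytic_phiR

namespace IsNearStandardFamily

variable {α ε : ℝ} {U : Set (ℝ × ℝ)} {F : ℝ × ℝ → LorenzData}

theorem flip (hF : IsNearStandardFamily α ε U F) :
    IsNearStandardFamily α ε U fun p => (F p).flip where
  isCompact := hF.isCompact
  semianalytic := hF.semianalytic
  isNearStandard p hp := (hF.isNearStandard p hp).flip
  analytic_c := analyticOnNhd_const.sub hF.analytic_c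
  analytic_u := hF.analytic_v
  analytic_v := hF.analytic_u
  analytic_phiL := analyticOnNhd_flipMap (φ := fun p => (F p).phiR) hF.analytic_phiR
  analytic_phiR := analyticOnNhd_flipMap (φ := fun p => (F p).phiL) hF.analytic_phiL

theorem mapsTo_powPart (hF : IsNearStandardFamily α ε U F) (hα : 0 ≤ α) :
    MapsTo (fun z : (ℝ × ℝ) × ℝ => (z.1, powPart α (F z.1).u (F z.1).c z.2))
      (branchDomain U fun p => (F p).c) (U ×ˢ Icc (0 : ℝ) 1) := fun z hz =>
  ⟨hz.1, powPart_mem_Icc hα (hF.isNearStandard z.1 hz.1).u_mem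
    (hF.isNearStandard z.1 hz.1).c_mem.1 hz.2⟩

theorem continuousOn_one_sub_div (hF : IsNearStandardFamily α ε U F) :
    ContinuousOn (fun z : (ℝ × ℝ) × ℝ => 1 - z.2 / (F z.1).c)
      (branchDomain U fun p => (F p).c) :=
  continuousOn_const.sub (continuousOn_snd.div
    (hF.analytic_c.continuousOn.comp continuousOn_fst fun _ hz => hz.1)
    fun z hz => (hF.isNearStandard z.1 hz.1).c_mem.1.ne')

theorem continuousOn_u_fst (hF : IsNearStandardFamily α ε U F) :
    ContinuousOn (fun z : (ℝ × ℝ) × ℝ => (F z.1).u) (branchDomain U fun p => (F p).c) :=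
  hF.analytic_u.continuousOn.comp continuousOn_fst fun _ hz => hz.1

theorem continuousOn_powPart (hF : IsNearStandardFamily α ε U F) (hα : 0 ≤ α) :
    ContinuousOn (fun z : (ℝ × ℝ) × ℝ => (z.1, powPart α (F z.1).u (F z.1).c z.2))
      (branchDomain U fun p => (F p).c) :=
  continuousOn_fst.prodMk <| hF.continuousOn_u_fst.mul <| continuousOn_const.sub <|
    hF.continuousOn_one_sub_div.rpow_const fun _ _ => Or.inr hα

theorem continuousOn_leftBranch (hF : IsNearStandardFamily α ε U F) (hα : 0 ≤ α) :
    ContinuousOn (fun z : (ℝ × ℝ) × ℝ => (F z.1).leftBranch α z.2)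
      (branchDomain U fun p => (F p).c) :=
  hF.analytic_phiL.continuousOn.comp (hF.continuousOn_powPart hα) (hF.mapsTo_powPart hα)

theorem continuousOn_deriv_phiL (hF : IsNearStandardFamily α ε U F) :
    ContinuousOn (fun z : (ℝ × ℝ) × ℝ => deriv (F z.1).phiL z.2) (U ×ˢ Icc (0 : ℝ) 1) :=
  fun z hz => (analyticAt_uncurry_deriv (φ := fun p => (F p).phiL)
    (hF.analytic_phiL z hz)).continuousAt.continuousWithinAt

theorem continuousOn_leftDeriv (hF : IsNearStandardFamily α ε U F) (hα : 1 ≤ α) :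
    ContinuousOn (fun z : (ℝ × ℝ) × ℝ => (F z.1).leftDeriv α z.2)
      (branchDomain U fun p => (F p).c) := by
  have hα0 : 0 ≤ α := by linarith
  have hphi := hF.continuousOn_deriv_phiL.comp (hF.continuousOn_powPart hα0)
    (hF.mapsTo_powPart hα0)
  exact hphi.mul <| hF.continuousOn_u_fst.mul <| (continuousOn_const.mul
      (hF.continuousOn_one_sub_div.rpow_const fun _ _ => Or.inr (by linarith))).div
    (hF.analytic_c.continuousOn.comp continuousOn_fst fun _ hz => hz.1)
    fun z hz => (hF.isNearStandard z.1 hz.1).c_mem.1.ne'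

theorem isBranchFamily (hF : IsNearStandardFamily α ε U F) (hα : 1 ≤ α) (hε : ε ≤ 1 / 2) :
    IsBranchFamily U (fun p => (F p).leftBranch α) (fun p => (F p).leftDeriv α)
      fun p => (F p).c where
  isCompact := hF.isCompact
  continuousOn_right := hF.analytic_c.continuousOn
  right_mem p hp := (hF.isNearStandard p hp).c_mem
  continuousOn := hF.continuousOn_leftBranch (by linarith)
  continuousOn_deriv := hF.continuousOn_leftDeriv hα
  hasDerivWithinAt p hp x hx :=
    ((hF.isNearStandard p hp).hasDerivAt_leftBranch hα hx).hasDerivWithinAt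
  map_zero p hp := (hF.isNearStandard p hp).leftBranch_zero
  map_mem p hp x hx := (hF.isNearStandard p hp).leftBranch_mem hε (by linarith) hx
  ne_self p hp x hx := (hF.isNearStandard p hp).leftBranch_ne_self hx
  deriv_pos p hp hval x hx :=
    have hf := hF.isNearStandard p hp
    branchDeriv_pos hf.phiL hε (by linarith) ⟨hf.u_pos hval, hf.u_mem.2⟩ hx
  exists_abs_log_deriv_sub_le q hq hval s hs := by
    obtain ⟨s', hss', hs'⟩ := exists_between hs.2
    refine ⟨(2 * α - 1) / (s' - s), div_nonneg (by linarith) (by linarith), ?_⟩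
    have hu : ∀ᶠ p in 𝓝[U] q, 0 < (F p).u := (hF.analytic_u.continuousOn q hq).eventually
      (lt_mem_nhds ((hF.isNearStandard q hq).u_pos hval))
    filter_upwards [hu, self_mem_nhdsWithin,
      (hF.analytic_c.continuousOn q hq).eventually (lt_mem_nhds hs')] with p hup hp hcp x hx
    have hf := hF.isNearStandard p hp
    refine (abs_log_branchDeriv_sub_le hf.phiL hε hα ⟨hup, hf.u_mem.2⟩ (hss'.trans hcp) hx).trans ?_
    exact mul_le_mul_of_nonneg_right (div_le_div_of_nonneg_left (by linarith) (sub_pos.2 hss')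
      (sub_le_sub_right hcp.le s)) hx.1

end IsNearStandardFamily

/-! ### The return interval of a full renormalization -/

theorem OrbitIn.of_tendsto {b E G : ℝ → ℝ} {d e y : ℝ} {𝓛 : Filter ℝ} [𝓛.NeBot]
    (hb : ContinuousOn b (Icc 0 d)) (hE : Tendsto E 𝓛 (𝓝 e)) (hG : Tendsto G 𝓛 (𝓝 y)) {n : ℕ}
    (h : ∀ᶠ x in 𝓛, OrbitIn b d n (E x) (G x)) : OrbitIn b d n e y := by
  have mem_of_lim : ∀ i < n, Tendsto (fun x => b^[i] (E x)) 𝓛 (𝓝 (b^[i] e)) →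
      b^[i] e ∈ Icc 0 d := fun i hi ht =>
    isClosed_Icc.mem_of_tendsto ht (h.mono fun x hx => hx.1 i hi)
  have hlim : ∀ i ≤ n, Tendsto (fun x => b^[i] (E x)) 𝓛 (𝓝 (b^[i] e)) := fun i => by
    induction i with
    | zero => exact fun _ => hE
    | succ i ih =>
      intro hi
      have hlim_i := ih (Nat.le_of_succ_le hi)
      simp only [Function.iterate_succ_apply']
      exact (hb _ (mem_of_lim i hi hlim_i)).tendsto.comp
        (tendsto_nhdsWithin_iff.2 ⟨hlim_i, h.mono fun x hx => hx.1 i hi⟩)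
  exact ⟨fun i hi => mem_of_lim i hi (hlim i hi.le),
    tendsto_nhds_unique ((hlim n le_rfl).congr' (h.mono fun x hx => hx.2)) hG⟩

theorem tendsto_sub_div_nhdsLT (l c : ℝ) {d : ℝ} (hd : 0 < d) :
    Tendsto (fun x => (x - l) / d) (𝓝[<] c) (𝓝[<] ((c - l) / d)) := by
  have hcont : ContinuousAt (fun x => (x - l) / d) c := by fun_prop
  exact tendsto_nhdsWithin_iff.2 ⟨hcont.tendsto.mono_left nhdsWithin_le_nhds,
    eventually_mem_nhdsWithin.mono fun x hx =>
      div_lt_div_of_pos_right (sub_lt_sub_right (mem_Iio.1 hx) l) hd⟩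

theorem one_sub_sub_div {l r : ℝ} (h : l < r) (x : ℝ) :
    (1 - x - (1 - r)) / (1 - l - (1 - r)) = 1 - (x - l) / (r - l) := by
  rw [sub_sub_sub_cancel_left, sub_sub_sub_cancel_left, one_sub_div (sub_pos.2 h).ne',
    sub_sub_sub_cancel_right]

namespace LorenzData

/-- The left half of a full renormalization with return interval `[l, r]` and `a` steps on the
right: the critical value of the left branch and the image of the end point `l` are mapped to `r`
and to `l`, respectively, by `a` applications of the right branch. -/
structure IsHalfReturn (α : ℝ) (a : ℕ) (f : LorenzData) (l r : ℝ) : Prop where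
  left_mem : l ∈ Ico 0 f.c
  lt_leftBranch : f.c < f.leftBranch α f.c
  orbit_crit : OrbitIn (f.flip.leftBranch α) f.flip.c a (1 - f.leftBranch α f.c) (1 - r)
  orbit_end : OrbitIn (f.flip.leftBranch α) f.flip.c a (1 - f.leftBranch α l) (1 - l)

/-- `f` has a return interval `[l, r]` as in a full `(a,b)`-renormalization, and `x` is the relative
position of the critical point in it. -/
def HasFullReturn (α : ℝ) (a b : ℕ) (f : LorenzData) (x : ℝ) : Prop :=
  ∃ l r, f.IsHalfReturn α a l r ∧ f.flip.IsHalfReturn α b (1 - r) (1 - l) ∧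
    x = (f.c - l) / (r - l)

variable {α ε : ℝ} {f g : LorenzData} {a b : ℕ} {l r x : ℝ}

theorem HasFullReturn.flip (h : f.HasFullReturn α a b x) : f.flip.HasFullReturn α b a (1 - x) := by
  obtain ⟨l, r, hl, hr, rfl⟩ := h
  refine ⟨1 - r, 1 - l, hr, by rwa [flip_flip, sub_sub_cancel, sub_sub_cancel], ?_⟩
  have hlt := hl.left_mem.2
  have hgt : f.c < r := by
    have : 1 - r < 1 - f.c := hr.left_mem.2
    linarith
  exact (one_sub_sub_div (hlt.trans hgt) f.c).symm

theorem tendsto_map_left (hα : 1 ≤ α) (hc : 0 < g.c) (hu : g.u ∈ Icc (0 : ℝ) 1)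
    (hφ : ContinuousOn g.phiL (Icc 0 1)) : Tendsto (g.map α) (𝓝[<] g.c) (𝓝 g.critValL) := by
  have hpow : Tendsto (powPart α g.u g.c) (𝓝[<] g.c) (𝓝[Icc 0 1] g.u) := by
    refine tendsto_nhdsWithin_iff.2 ⟨?_, ?_⟩
    · have hcont := (hasDerivAt_powPart hα g.u g.c g.c).continuousAt.tendsto
      rw [powPart_self (by linarith) g.u hc.ne'] at hcont
      exact hcont.mono_left nhdsWithin_le_nhds
    · filter_upwards [Ioo_mem_nhdsLT hc] with x hx
      exact powPart_mem_Icc (by linarith) hu hc (Ioo_subset_Icc_self hx)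
  refine ((hφ g.u hu).tendsto.comp hpow).congr' ?_
  filter_upwards [self_mem_nhdsWithin] with x hx using (map_of_lt hc hx).symm

theorem map_zero (hc : 0 < g.c) (hφ : g.phiL 0 = 0) : g.map α 0 = 0 := by
  rw [map_of_lt hc hc, leftBranch, branch, powPart_zero, hφ]

theorem IsNearStandard.orbitIn_of_iterate_map (hf : f.IsNearStandard α ε) (hε : ε ≤ 1 / 2)
    (hα : 0 ≤ α) (hx : x ∈ Ico 0 f.c) (horb : ∀ i, 1 ≤ i → i ≤ a → f.c < (f.map α)^[i] x) :
    OrbitIn (f.flip.leftBranch α) f.flip.c a (1 - f.leftBranch α x) (1 - (f.map α)^[a + 1] x) := by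
  have hiter : ∀ i ≤ a, (f.flip.leftBranch α)^[i] (1 - f.leftBranch α x) =
      1 - (f.map α)^[i + 1] x ∧ (f.map α)^[i + 1] x ≤ 1 := fun i => by
    induction i with
    | zero =>
      intro _
      rw [zero_add, Function.iterate_one, map_of_lt hf.c_mem.1 hx.2]
      exact ⟨rfl, (hf.leftBranch_mem hε hα (Ico_subset_Icc_self hx)).2⟩
    | succ i ih =>
      intro hi
      obtain ⟨heq, hle⟩ := ih (Nat.le_of_succ_le hi)
      have hgt := horb (i + 1) i.succ_pos hi
      have hstep : f.flip.leftBranch α (1 - (f.map α)^[i + 1] x) = 1 - (f.map α)^[i + 2] x := by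
        rw [← map_of_lt hf.flip.c_mem.1 (sub_lt_sub_left hgt 1), map_flip hgt.ne',
          ← Function.iterate_succ_apply' (f.map α)]
      have hmem := hf.flip.leftBranch_mem hε hα (x := 1 - (f.map α)^[i + 1] x)
        ⟨sub_nonneg.2 hle, sub_le_sub_left hgt.le 1⟩
      rw [hstep] at hmem
      exact ⟨by rw [Function.iterate_succ_apply', heq, hstep], sub_nonneg.1 hmem.1⟩
  refine ⟨fun i hi => ?_, (hiter a le_rfl).1⟩
  rw [(hiter i hi.le).1]
  exact ⟨sub_nonneg.2 (hiter i hi.le).2, sub_le_sub_left (horb (i + 1) i.succ_pos hi).le 1⟩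

/-- The first return map on the left of `c` extends continuously to `[l, c]`, and the two orbits of
`IsHalfReturn` are those of the two end points of that interval. -/
theorem IsNearStandard.isHalfReturn (hf : f.IsNearStandard α ε) (hε : ε ≤ 1 / 2) (hα : 1 ≤ α)
    (ha : 1 ≤ a) (hl : l ∈ Ico 0 f.c) (hr : f.c < r) (hgc : g.c = (f.c - l) / (r - l))
    (hu : g.u ∈ Icc (0 : ℝ) 1) (hφ : ContinuousOn g.phiL (Icc 0 1)) (hφ0 : g.phiL 0 = 0)
    (hval : g.critValL = 1)
    (hret : ∀ x ∈ Ico l f.c, (∀ i, 1 ≤ i → i ≤ a → f.c < (f.map α)^[i] x) ∧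
      (f.map α)^[a + 1] x = l + (r - l) * g.map α ((x - l) / (r - l))) :
    f.IsHalfReturn α a l r := by
  have hα0 : 0 < α := by linarith
  have hrl : 0 < r - l := by linarith [hl.2]
  have hgc0 : 0 < g.c := hgc ▸ div_pos (sub_pos.2 hl.2) hrl
  have horb : ∀ x ∈ Ico l f.c, OrbitIn (f.flip.leftBranch α) f.flip.c a (1 - f.leftBranch α x)
      (1 - (l + (r - l) * g.map α ((x - l) / (r - l)))) := fun x hx => by
    rw [← (hret x hx).2]
    exact hf.orbitIn_of_iterate_map hε hα0.le ⟨hl.1.trans hx.1, hx.2⟩ (hret x hx).1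
  refine ⟨hl, ?_, ?_, ?_⟩
  · have hlt : f.c < f.leftBranch α l := by
      have := (hret l ⟨le_rfl, hl.2⟩).1 1 le_rfl ha
      rwa [Function.iterate_one, map_of_lt hf.c_mem.1 hl.2] at this
    have hu := hf.u_pos (hf.c_mem.1.trans hlt)
    exact hlt.trans (hf.strictMonoOn_leftBranch hε hα0 hu (Ico_subset_Icc_self hl)
      ⟨hf.c_mem.1.le, le_rfl⟩ hl.2)
  · have hE : Tendsto (fun x => 1 - f.leftBranch α x) (𝓝[<] f.c) (𝓝 (1 - f.leftBranch α f.c)) :=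
      ((hf.hasDerivAt_leftBranch hα ⟨hf.c_mem.1.le, le_rfl⟩).continuousAt.tendsto.mono_left
        nhdsWithin_le_nhds).const_sub 1
    have hscale := tendsto_sub_div_nhdsLT l f.c hrl
    rw [← hgc] at hscale
    have hG := ((((tendsto_map_left hα hgc0 hu hφ).comp hscale).const_mul
      (r - l)).const_add l).const_sub 1
    rw [hval, mul_one, add_sub_cancel] at hG
    refine OrbitIn.of_tendsto (hf.flip.continuousOn_leftBranch hα) hE hG ?_
    filter_upwards [Ico_mem_nhdsLT hl.2] with x hx using horb x hx
  · have h := horb l ⟨le_rfl, hl.2⟩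
    rwa [sub_self, zero_div, map_zero hgc0 hφ0, mul_zero, add_zero] at h

theorem iterate_map_flip_of_return (hlc : l < f.c) (hcr : f.c < r)
    (hgc : g.c = (f.c - l) / (r - l))
    (hret : ∀ x ∈ Ioc f.c r, (∀ i, 1 ≤ i → i ≤ b → (f.map α)^[i] x < f.c) ∧
      (f.map α)^[b + 1] x = l + (r - l) * g.map α ((x - l) / (r - l))) :
    ∀ x ∈ Ico (1 - r) f.flip.c, (∀ i, 1 ≤ i → i ≤ b → f.flip.c < (f.flip.map α)^[i] x) ∧
      (f.flip.map α)^[b + 1] x =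
        1 - r + (1 - l - (1 - r)) * g.flip.map α ((x - (1 - r)) / (1 - l - (1 - r))) := by
  intro x hx
  obtain ⟨y, rfl⟩ : ∃ y, x = 1 - y := ⟨1 - x, (sub_sub_cancel 1 x).symm⟩
  have hyc : 1 - y < 1 - f.c := hx.2
  have hy : y ∈ Ioc f.c r := ⟨by linarith, by linarith [hx.1]⟩
  have hrl : r - l ≠ 0 := by linarith
  have hiter : ∀ n ≤ b + 1, (f.flip.map α)^[n] (1 - y) = 1 - (f.map α)^[n] y := fun n hn =>
    iterate_map_flip fun i hi => by
      rcases i.eq_zero_or_pos with rfl | hpos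
      · exact hy.1.ne'
      · exact ((hret y hy).1 i hpos (by omega)).ne
  have hne : (y - l) / (r - l) ≠ g.c := fun h => hy.1.ne' <| by
    rw [hgc, div_left_inj' hrl] at h
    linarith
  refine ⟨fun i h1 hi => ?_, ?_⟩
  · rw [hiter i (by omega)]
    exact sub_lt_sub_left ((hret y hy).1 i h1 hi) 1
  · rw [hiter _ le_rfl, (hret y hy).2, one_sub_sub_div (hlc.trans hcr), map_flip hne]
    ring

theorem IsRenormalization.hasFullReturn (hren : f.IsRenormalization α a b g) (hg : g.IsFull)
    (hf : f.IsNearStandard α ε) (hε : ε ≤ 1 / 2) (hα : 1 ≤ α) : f.HasFullReturn α a b g.c := by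
  obtain ⟨ha, hb, hgL, -, l, r, hl, hlc, hcr, hr, -, hgc, hleft, hright⟩ := hren
  refine ⟨l, r, ?_, ?_, hgc⟩
  · exact hf.isHalfReturn hε hα ha ⟨hl, hlc⟩ hcr hgc hgL.u_mem hgL.phiL.contDiffOn.continuousOn
      hgL.phiL.map_zero hg.1 fun x hx => ⟨fun i h1 hi => ((hleft x hx).1 i h1 hi).1, (hleft x hx).2⟩
  · have hφ : ContinuousOn g.flip.phiL (Icc 0 1) := continuousOn_const.sub <|
      hgL.phiR.contDiffOn.continuousOn.comp (continuousOn_const.sub continuousOn_id)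
        fun x hx => one_sub_mem_Icc hx
    have hφ0 : g.flip.phiL 0 = 0 := by
      simp only [flip, flipMap, sub_zero, hgL.phiR.map_one, sub_self]
    have hgc' : g.flip.c = (f.flip.c - (1 - r)) / (1 - l - (1 - r)) := by
      simp only [flip, one_sub_sub_div (hlc.trans hcr), hgc]
    exact hf.flip.isHalfReturn hε hα hb ⟨sub_nonneg.2 hr, sub_lt_sub_left hcr 1⟩
      (sub_lt_sub_left hlc 1) hgc' hgL.v_mem hφ hφ0 hg.flip.1 <|
      iterate_map_flip_of_return hlc hcr hgc fun x hx =>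
        ⟨fun i h1 hi => ((hright x hx).1 i h1 hi).1, (hright x hx).2⟩

end LorenzData

/-! ### Full vertices with long return times -/

theorem exists_le_of_le_mul_rpow {α : ℝ} (hα : 1 < α) {C : ℝ} (hC : 0 < C) :
    ∃ s₀ : ℝ, 0 < s₀ ∧ ∀ s t : ℝ, 0 < s → 0 < t → s ≤ C * t ^ α → t ≤ C * s ^ α → s₀ ≤ s := by
  have hβ : 0 < α * α - 1 := by nlinarith
  have hK : 0 < C * C ^ α := mul_pos hC (Real.rpow_pos_of_pos hC _)
  refine ⟨(C * C ^ α)⁻¹ ^ (α * α - 1)⁻¹, Real.rpow_pos_of_pos (inv_pos.2 hK) _,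
    fun s t hs ht hst hts => ?_⟩
  have hself : s ≤ C * C ^ α * s ^ (α * α) := by
    calc s ≤ C * t ^ α := hst
      _ ≤ C * (C * s ^ α) ^ α := by gcongr
      _ = C * C ^ α * s ^ (α * α) := by
        rw [Real.mul_rpow hC.le (Real.rpow_nonneg hs.le _), ← Real.rpow_mul hs.le, mul_assoc]
  have hpow : (C * C ^ α)⁻¹ ≤ s ^ (α * α - 1) := by
    rw [Real.rpow_sub_one hs.ne', inv_le_iff_one_le_mul₀' hK, ← mul_div_assoc,
      one_le_div hs]
    exact hself
  calc (C * C ^ α)⁻¹ ^ (α * α - 1)⁻¹ ≤ (s ^ (α * α - 1)) ^ (α * α - 1)⁻¹ :=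
        Real.rpow_le_rpow (inv_pos.2 hK).le hpow (inv_pos.2 hβ).le
    _ = s := Real.rpow_rpow_inv hs.le hβ.ne'

namespace LorenzData

variable {α ε : ℝ} {f : LorenzData} {a b : ℕ} {l r x : ℝ}

theorem IsNearStandard.leftBranch_self_sub_le (hf : f.IsNearStandard α ε) (hε : ε ≤ 1)
    (hα : 0 < α) (hx : x ∈ Icc 0 f.c) :
    f.leftBranch α f.c - f.leftBranch α x ≤ 2 * (1 - x / f.c) ^ α := by
  have hpow := Real.rpow_nonneg (one_sub_div_mem_Icc hf.c_mem.1 hx).1 α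
  have hsub := sub_powPart α f.u f.c x
  have hle : powPart α f.u f.c x ≤ f.u := sub_nonneg.1 (hsub ▸ mul_nonneg hf.u_mem.1 hpow)
  rw [hf.leftBranch_self hα.ne']
  calc f.critValL - f.leftBranch α x ≤ 2 * (f.u - powPart α f.u f.c x) :=
        hf.phiL.sub_le_two_mul_sub hε (powPart_mem_Icc hα.le hf.u_mem hf.c_mem.1 hx) hf.u_mem hle
    _ ≤ 2 * (1 - x / f.c) ^ α := by
      rw [hsub]
      exact mul_le_mul_of_nonneg_left (mul_le_of_le_one_left hpow hf.u_mem.2) zero_le_two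

/-- The right branch maps the critical value of the left branch back to the right of `c`, and it is
at most of order `α` at its critical point. -/
theorem IsHalfReturn.leftBranch_flip_sub_le (h : f.IsHalfReturn α a l r) (ha : 2 ≤ a)
    (hf : f.IsNearStandard α ε) (hε : ε ≤ 1) (hα : 0 < α) :
    f.flip.leftBranch α f.flip.c - f.flip.c ≤
      2 * ((f.leftBranch α f.c - f.c) / f.flip.c) ^ α := by
  have hmem : 1 - f.leftBranch α f.c ∈ Icc 0 f.flip.c := h.orbit_crit.1 0 (by omega)
  have hle : f.flip.leftBranch α (1 - f.leftBranch α f.c) ≤ f.flip.c :=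
    (h.orbit_crit.1 1 (by omega)).2
  have hbound := hf.flip.leftBranch_self_sub_le hε hα hmem
  rw [one_sub_div hf.flip.c_mem.1.ne', show f.flip.c = 1 - f.c from rfl,
    sub_sub_sub_cancel_left] at hbound
  exact (sub_le_sub_left hle _).trans hbound

/-- The total distance of the critical values of a Lorenz map from those of a full map. -/
def defect (f : LorenzData) : ℝ := (1 - f.critValL) + (1 - f.flip.critValL)

theorem IsNearStandard.critValL_le_one (hf : f.IsNearStandard α ε) (hε : ε ≤ 1 / 2) :
    f.critValL ≤ 1 :=
  (hf.phiL.map_mem hε hf.u_mem).2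

theorem IsNearStandard.defect_nonneg (hf : f.IsNearStandard α ε) (hε : ε ≤ 1 / 2) :
    0 ≤ f.defect :=
  add_nonneg (sub_nonneg.2 (hf.critValL_le_one hε)) (sub_nonneg.2 (hf.flip.critValL_le_one hε))

theorem IsNearStandard.defect_eq_zero_iff (hf : f.IsNearStandard α ε) (hε : ε ≤ 1 / 2) :
    f.defect = 0 ↔ f.IsFull := by
  rw [defect, add_eq_zero_iff_of_nonneg (sub_nonneg.2 (hf.critValL_le_one hε))
    (sub_nonneg.2 (hf.flip.critValL_le_one hε)), critValL_flip, sub_sub_cancel, sub_eq_zero,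
    eq_comm, IsFull]

end LorenzData

namespace IsNearStandardFamily

variable {α ε : ℝ} {U : Set (ℝ × ℝ)} {F : ℝ × ℝ → LorenzData} {q : ℝ × ℝ}

theorem analyticOnNhd_critValL (hF : IsNearStandardFamily α ε U F) :
    AnalyticOnNhd ℝ (fun p => (F p).critValL) U := fun p hp =>
  (hF.analytic_phiL (p, (F p).u) ⟨hp, (hF.isNearStandard p hp).u_mem⟩).comp
    (f := fun p : ℝ × ℝ => (p, (F p).u)) (analyticAt_id.prod (hF.analytic_u p hp))

theorem analyticOnNhd_defect (hF : IsNearStandardFamily α ε U F) :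
    AnalyticOnNhd ℝ (fun p => (F p).defect) U :=
  (analyticOnNhd_const.sub hF.analyticOnNhd_critValL).add
    (analyticOnNhd_const.sub hF.flip.analyticOnNhd_critValL)

theorem exists_leftBranch_sub_le (hF : IsNearStandardFamily α ε U F) (hα : 0 < α) (hε : ε ≤ 1) :
    ∃ C : ℝ, 0 < C ∧ ∀ p ∈ U, ∀ (a : ℕ) (l r : ℝ), 2 ≤ a → (F p).flip.IsHalfReturn α a l r →
      (F p).leftBranch α (F p).c - (F p).c ≤
        C * ((F p).flip.leftBranch α (F p).flip.c - (F p).flip.c) ^ α := by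
  rcases U.eq_empty_or_nonempty with rfl | hne
  · exact ⟨1, one_pos, fun p hp => hp.elim⟩
  obtain ⟨q, hq, hmin⟩ := hF.isCompact.exists_isMinOn hne hF.analytic_c.continuousOn
  have hcq := (hF.isNearStandard q hq).c_mem.1
  have hpow := Real.rpow_pos_of_pos hcq α
  refine ⟨2 / (F q).c ^ α, div_pos two_pos hpow, fun p hp a l r ha h => ?_⟩
  have hbound := h.leftBranch_flip_sub_le ha (hF.isNearStandard p hp).flip hε hα
  rw [LorenzData.flip_flip] at hbound
  have hs : 0 ≤ (F p).flip.leftBranch α (F p).flip.c - (F p).flip.c :=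
    sub_nonneg.2 h.lt_leftBranch.le
  calc _ ≤ 2 * (((F p).flip.leftBranch α (F p).flip.c - (F p).flip.c) / (F p).c) ^ α := hbound
    _ ≤ 2 * (((F p).flip.leftBranch α (F p).flip.c - (F p).flip.c) / (F q).c) ^ α := by
      refine mul_le_mul_of_nonneg_left (Real.rpow_le_rpow ?_ ?_ ?_) zero_le_two
      · exact div_nonneg hs (hF.isNearStandard p hp).c_mem.1.le
      · exact div_le_div_of_nonneg_left hs hcq (hmin hp)
      · linarith
    _ = _ := by rw [Real.div_rpow hs hcq.le, div_mul_eq_mul_div, mul_div_assoc]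

theorem exists_forall_add_le_leftBranch (hF : IsNearStandardFamily α ε U F) (hα : 1 < α)
    (hε : ε ≤ 1) :
    ∃ s₀ : ℝ, 0 < s₀ ∧ ∀ p ∈ U, ∀ (a b : ℕ) (x : ℝ), 2 ≤ a → 2 ≤ b →
      (F p).HasFullReturn α a b x → (F p).c + s₀ ≤ (F p).leftBranch α (F p).c := by
  obtain ⟨C, hC, hle⟩ := hF.exists_leftBranch_sub_le (by linarith) hε
  obtain ⟨C', -, hle'⟩ := hF.flip.exists_leftBranch_sub_le (by linarith) hε
  obtain ⟨s₀, hs₀, hmin⟩ := exists_le_of_le_mul_rpow hα (lt_max_of_lt_left hC : 0 < max C C')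
  refine ⟨s₀, hs₀, fun p hp a b x ha hb ⟨l, r, hl, hr, _⟩ => ?_⟩
  have hs : 0 < (F p).leftBranch α (F p).c - (F p).c := sub_pos.2 hl.lt_leftBranch
  have ht : 0 < (F p).flip.leftBranch α (F p).flip.c - (F p).flip.c := sub_pos.2 hr.lt_leftBranch
  have hst := hle p hp b _ _ hb hr
  have hts := hle' p hp a l r ha (by rwa [LorenzData.flip_flip])
  rw [LorenzData.flip_flip] at hts
  refine le_sub_iff_add_le'.1 (hmin _ _ hs ht (hst.trans ?_) (hts.trans ?_))
  · exact mul_le_mul_of_nonneg_right (le_max_left _ _) (Real.rpow_nonneg ht.le _)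
  · exact mul_le_mul_of_nonneg_right (le_max_right _ _) (Real.rpow_nonneg hs.le _)

theorem exists_forall_one_sub_critValL_lt (hF : IsNearStandardFamily α ε U F) (hα : 1 < α)
    (hε : ε ≤ 1 / 2) {δ : ℝ} (hδ : 0 < δ) :
    ∃ N : ℕ, ∀ p ∈ U, ∀ a ≥ N, ∀ b ≥ N, ∀ x : ℝ,
      (F p).HasFullReturn α a b x → 1 - (F p).critValL < δ := by
  obtain ⟨s₀, hs₀, hgap⟩ := hF.flip.exists_forall_add_le_leftBranch hα (by linarith)
  obtain ⟨N, hN⟩ := (hF.flip.isBranchFamily hα.le hε).exists_forall_lt_of_orbitIn hs₀ hδ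
  refine ⟨max 2 N, fun p hp a ha b hb x hx => ?_⟩
  have hsep := hgap p hp b a _ ((le_max_left _ _).trans hb) ((le_max_left _ _).trans ha) hx.flip
  obtain ⟨l, r, hl, -, -⟩ := hx
  rw [← (hF.isNearStandard p hp).leftBranch_self (by linarith)]
  exact hN p hp hsep a ((le_max_right _ _).trans ha) _ _ hl.orbit_crit

variable {ι : Type*} {𝓕 : Filter ι} {p : ι → ℝ × ℝ} {a b : ι → ℕ} {x : ι → ℝ}

theorem tendsto_defect (hF : IsNearStandardFamily α ε U F) (hα : 1 < α) (hε : ε ≤ 1 / 2)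
    (ha : Tendsto a 𝓕 atTop) (hb : Tendsto b 𝓕 atTop) (hpU : ∀ᶠ t in 𝓕, p t ∈ U)
    (hret : ∀ᶠ t in 𝓕, (F (p t)).HasFullReturn α (a t) (b t) (x t)) :
    Tendsto (fun t => (F (p t)).defect) 𝓕 (𝓝 0) := by
  refine Metric.tendsto_nhds.2 fun δ hδ => ?_
  obtain ⟨N, hN⟩ := hF.exists_forall_one_sub_critValL_lt hα hε (half_pos hδ)
  obtain ⟨N', hN'⟩ := hF.flip.exists_forall_one_sub_critValL_lt hα hε (half_pos hδ)
  filter_upwards [hpU, hret, ha.eventually_ge_atTop (max N N'), hb.eventually_ge_atTop (max N N')]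
    with t hp hx hat hbt
  rw [Real.dist_0_eq_abs, abs_of_nonneg ((hF.isNearStandard _ hp).defect_nonneg hε),
    ← add_halves δ]
  exact add_lt_add
    (hN _ hp _ ((le_max_left _ _).trans hat) _ ((le_max_left _ _).trans hbt) _ hx)
    (hN' _ hp _ ((le_max_right _ _).trans hbt) _ ((le_max_right _ _).trans hat) _ hx.flip)

theorem tendsto_nhdsWithin_of_hasFullReturn (hF : IsNearStandardFamily α ε U F) (hα : 1 < α)
    (hε : ε ≤ 1 / 2) (hq : IsUniqueFullParam U F q) (ha : Tendsto a 𝓕 atTop)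
    (hb : Tendsto b 𝓕 atTop) (hpU : ∀ᶠ t in 𝓕, p t ∈ U)
    (hret : ∀ᶠ t in 𝓕, (F (p t)).HasFullReturn α (a t) (b t) (x t)) :
    Tendsto p 𝓕 (𝓝[U] q) := by
  refine tendsto_nhdsWithin_iff.2
    ⟨hF.isCompact.tendsto_nhds_of_unique_mapClusterPt hpU fun z hz hzcl => ?_, hpU⟩
  refine hq.2.2 z hz (((hF.isNearStandard z hz).defect_eq_zero_iff hε).1 ?_)
  have hcont : Tendsto (fun p => (F p).defect) (𝓝 z ⊓ map p 𝓕) (𝓝 (F z).defect) :=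
    (hF.analyticOnNhd_defect.continuousOn z hz).tendsto.mono_left
      (inf_le_inf_left _ (le_principal_iff.2 hpU))
  have hcl : ClusterPt (F z).defect (𝓝 0) :=
    ClusterPt.mono (hzcl.tendsto_comp' hcont) (hF.tendsto_defect hα hε ha hb hpU hret)
  exact eq_of_nhds_neBot hcl

end IsNearStandardFamily

/-! ### Asymptotics of the critical point at full vertices -/

theorem tendsto_nat_mul_of_pow_le {ι : Type*} {𝓕 : Filter ι} {f : ι → ℝ} {a b : ι → ℕ} {M : ℕ}
    {A C ρ : ℝ} (hC : 0 ≤ C) (hρ0 : 0 < ρ) (hρ1 : ρ < 1) (ha : Tendsto a 𝓕 atTop)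
    (hb : Tendsto b 𝓕 atTop) (hab : ∀ᶠ t in 𝓕, (a t : ℝ) ≤ A * b t) (hf : ∀ t, 0 ≤ f t)
    (hle : ∀ᶠ t in 𝓕, f t ^ M ≤ C * (ρ ^ a t + ρ ^ b t)) :
    Tendsto (fun t => a t * f t) 𝓕 (𝓝 0) := by
  have hgeo := tendsto_pow_const_mul_const_pow_of_abs_lt_one M (by rwa [abs_of_pos hρ0] : |ρ| < 1)
  have hbound := ((hgeo.comp ha).const_mul C).add ((hgeo.comp hb).const_mul (C * A ^ M))
  simp only [mul_zero, add_zero] at hbound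
  have hpow : Tendsto (fun t => (a t * f t) ^ M) 𝓕 (𝓝 0) := by
    refine tendsto_of_tendsto_of_tendsto_of_le_of_le' tendsto_const_nhds hbound
      (Eventually.of_forall fun t => pow_nonneg (mul_nonneg (Nat.cast_nonneg _) (hf t)) M) ?_
    filter_upwards [hle, hab] with t hft hat
    rw [mul_pow]
    calc (a t : ℝ) ^ M * f t ^ M
        ≤ (a t : ℝ) ^ M * (C * (ρ ^ a t + ρ ^ b t)) := by gcongr
      _ = C * ((a t : ℝ) ^ M * ρ ^ a t) + C * ((a t : ℝ) ^ M * ρ ^ b t) := by ring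
      _ ≤ C * ((a t : ℝ) ^ M * ρ ^ a t) + C * ((A * b t) ^ M * ρ ^ b t) := by gcongr
      _ = _ := by simp only [Function.comp]; ring
  refine Metric.tendsto_nhds.2 fun δ hδ => ?_
  filter_upwards [hpow.eventually (gt_mem_nhds (pow_pos hδ M))] with t ht
  rw [Real.dist_0_eq_abs, abs_of_nonneg (mul_nonneg (Nat.cast_nonneg _) (hf t))]
  exact lt_of_pow_lt_pow_left₀ M hδ.le ht

theorem tendsto_nat_mul_log_sub {E ι : Type*} [NormedAddCommGroup E] [NormedSpace ℝ E]
    {𝓕 : Filter ι} {p : ι → E} {q : E} {n : ι → ℕ} {m : E → ℝ} (hm : DifferentiableAt ℝ m q)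
    (h0 : m q ≠ 0) (hp : Tendsto p 𝓕 (𝓝 q)) (hn : Tendsto (fun t => n t * ‖p t - q‖) 𝓕 (𝓝 0)) :
    Tendsto (fun t => n t * (Real.log (m (p t)) - Real.log (m q))) 𝓕 (𝓝 0) := by
  obtain ⟨K, hK⟩ := (hm.log h0).isBigO_sub.bound
  have hKn := hn.const_mul K
  rw [mul_zero] at hKn
  refine squeeze_zero_norm' ?_ hKn
  filter_upwards [hp.eventually hK] with t ht
  rw [norm_mul, Real.norm_natCast, mul_left_comm]
  exact mul_le_mul_of_nonneg_left ht (Nat.cast_nonneg _)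

namespace LorenzData

variable {α ε : ℝ} {f : LorenzData} {a b : ℕ} {l r x : ℝ}

theorem leftMult_eq (α : ℝ) (f : LorenzData) :
    f.leftMult α = deriv f.phiL 0 * (f.u * (α / f.c)) := by
  rw [leftMult, leftDeriv, branchDeriv, powPart_zero, zero_div, sub_zero, Real.one_rpow, mul_one]

theorem IsHalfReturn.leftBranch_lt (h : f.IsHalfReturn α a l r) (hf : f.IsNearStandard α ε)
    (hε : ε ≤ 1 / 2) (hα : 0 < α) : f.leftBranch α l < f.leftBranch α f.c :=
  hf.strictMonoOn_leftBranch hε hα (hf.u_pos (hf.c_mem.1.trans h.lt_leftBranch))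
    (Ico_subset_Icc_self h.left_mem) ⟨hf.c_mem.1.le, le_rfl⟩ h.left_mem.2

theorem IsNearStandard.exists_log_leftBranch_self_sub_eq (hf : f.IsNearStandard α ε)
    (hε : ε ≤ 1 / 2) (hα : 0 < α) (hu : 0 < f.u) (hx : x ∈ Ico 0 f.c) :
    ∃ ζ ∈ Icc (powPart α f.u f.c x) f.u, Real.log (f.leftBranch α f.c - f.leftBranch α x) =
      Real.log (deriv f.phiL ζ) + Real.log f.u + α * (Real.log (f.c - x) - Real.log f.c) := by
  have hc := hf.c_mem.1
  have hmem := powPart_mem_Icc hα.le hf.u_mem hc (Ico_subset_Icc_self hx)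
  have hbase : 0 < (f.c - x) / f.c := div_pos (sub_pos.2 hx.2) hc
  have hsub : f.u - powPart α f.u f.c x = f.u * ((f.c - x) / f.c) ^ α := by
    rw [sub_powPart, one_sub_div hc.ne']
  have hlt : powPart α f.u f.c x < f.u :=
    sub_pos.1 (hsub ▸ mul_pos hu (Real.rpow_pos_of_pos hbase α))
  obtain ⟨ζ, hζ, heq⟩ := hf.phiL.exists_sub_eq hmem.1 hlt hf.u_mem.2
  have hderiv := hf.phiL.half_le_deriv hε ⟨hmem.1.trans hζ.1.le, hζ.2.le.trans hf.u_mem.2⟩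
  refine ⟨ζ, Ioo_subset_Icc_self hζ, ?_⟩
  rw [hf.leftBranch_self hα.ne', critValL, leftBranch, branch, heq, hsub,
    Real.log_mul (by linarith) (mul_pos hu (Real.rpow_pos_of_pos hbase α)).ne',
    Real.log_mul hu.ne' (Real.rpow_pos_of_pos hbase α).ne', Real.log_rpow hbase,
    Real.log_div (sub_pos.2 hx.2).ne' hc.ne', add_assoc]

theorem log_sub_log_one_sub_div {c l r : ℝ} (hl : l < c) (hr : c < r) :
    Real.log ((c - l) / (r - l)) - Real.log (1 - (c - l) / (r - l)) =
      Real.log (c - l) - Real.log (r - c) := by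
  have hrl : r - l ≠ 0 := by linarith
  rw [one_sub_div hrl, sub_sub_sub_cancel_right, Real.log_div (sub_pos.2 hl).ne' hrl,
    Real.log_div (sub_pos.2 hr).ne' hrl, sub_sub_sub_cancel_right]

end LorenzData

theorem IsUniqueFullParam.flip {U : Set (ℝ × ℝ)} {F : ℝ × ℝ → LorenzData} {q : ℝ × ℝ}
    (hq : IsUniqueFullParam U F q) : IsUniqueFullParam U (fun p => (F p).flip) q :=
  ⟨hq.1, hq.2.1.flip, fun p hp h => hq.2.2 p hp (by simpa only [LorenzData.flip_flip] using h.flip)⟩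

namespace IsNearStandardFamily

variable {α ε : ℝ} {U : Set (ℝ × ℝ)} {F : ℝ × ℝ → LorenzData} {q : ℝ × ℝ}

theorem analyticAt_leftMult (hF : IsNearStandardFamily α ε U F) (hq : q ∈ U) :
    AnalyticAt ℝ (fun p => (F p).leftMult α) q := by
  simp only [LorenzData.leftMult_eq]
  have hderiv : AnalyticAt ℝ (fun p => deriv (F p).phiL 0) q :=
    (analyticAt_uncurry_deriv (φ := fun p => (F p).phiL)
      (hF.analytic_phiL (q, 0) ⟨hq, le_rfl, zero_le_one⟩)).comp_of_eq
      (f := fun p : ℝ × ℝ => (p, (0 : ℝ))) (analyticAt_id.prod analyticAt_const) rfl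
  exact hderiv.mul ((hF.analytic_u q hq).mul
    (analyticAt_const.div (hF.analytic_c q hq) (hF.isNearStandard q hq).c_mem.1.ne'))

theorem exists_eventually_one_sub_leftBranch_le (hF : IsNearStandardFamily α ε U F) (hα : 1 ≤ α)
    (hε : ε ≤ 1 / 2) (hq : q ∈ U) (hfull : (F q).IsFull) (hR : 1 < (F q).flip.leftMult α) :
    ∃ ρ : ℝ, 0 < ρ ∧ ρ < 1 ∧ ∀ᶠ p in 𝓝[U] q, ∀ (a : ℕ) (l r : ℝ),
      (F p).IsHalfReturn α a l r → 1 - (F p).leftBranch α l ≤ ρ ^ a := by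
  have hf := (hF.isNearStandard q hq).flip
  have hval : (F q).flip.c < (F q).flip.leftBranch α (F q).flip.c := by
    rw [hf.leftBranch_self (by linarith), hfull.flip.1]
    exact hf.c_mem.2
  obtain ⟨ρ, hρ0, hρ1, hρ⟩ :=
    (hF.flip.isBranchFamily hα hε).exists_eventually_le_mul_apply hq hval hR
  refine ⟨ρ, hρ0, hρ1, hρ.mono fun p hp a l r h => ?_⟩
  have horbit := h.orbit_end.iterate_sub_le_pow_mul hρ0.le hp a le_rfl
  rw [Nat.sub_self] at horbit
  exact horbit.trans (mul_le_of_le_one_right (pow_nonneg hρ0.le a)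
    (sub_le_self 1 h.left_mem.1))

theorem exists_eventually_defect_le (hF : IsNearStandardFamily α ε U F) (hα : 1 ≤ α)
    (hε : ε ≤ 1 / 2) (hq : q ∈ U) (hfull : (F q).IsFull) (hL : 1 < (F q).leftMult α)
    (hR : 1 < (F q).flip.leftMult α) :
    ∃ ρ : ℝ, 0 < ρ ∧ ρ < 1 ∧ ∀ᶠ p in 𝓝[U] q, ∀ (a b : ℕ) (x : ℝ),
      (F p).HasFullReturn α a b x → (F p).defect ≤ ρ ^ a + ρ ^ b := by
  obtain ⟨ρ, hρ0, hρ1, hρ⟩ := hF.exists_eventually_one_sub_leftBranch_le hα hε hq hfull hR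
  obtain ⟨ρ', hρ0', hρ1', hρ'⟩ := hF.flip.exists_eventually_one_sub_leftBranch_le hα hε hq
    hfull.flip (by rwa [LorenzData.flip_flip])
  refine ⟨max ρ ρ', lt_max_of_lt_left hρ0, max_lt hρ1 hρ1', ?_⟩
  filter_upwards [hρ, hρ', self_mem_nhdsWithin] with p hp hp' hpU a b x ⟨l, r, hl, hr, _⟩
  have hf := hF.isNearStandard p hpU
  have hα0 : 0 < α := by linarith
  refine add_le_add ?_ ?_
  · rw [← hf.leftBranch_self hα0.ne']
    exact (sub_le_sub_left (hl.leftBranch_lt hf hε hα0).le 1).trans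
      ((hp a l r hl).trans (pow_le_pow_left₀ hρ0.le (le_max_left _ _) a))
  · rw [← hf.flip.leftBranch_self hα0.ne']
    exact (sub_le_sub_left (hr.leftBranch_lt hf.flip hε hα0).le 1).trans
      ((hp' b _ _ hr).trans (pow_le_pow_left₀ hρ0'.le (le_max_right _ _) b))

theorem exists_eventually_norm_sub_pow_le (hF : IsNearStandardFamily α ε U F) (hα : 1 ≤ α)
    (hε : ε ≤ 1 / 2) (hq : IsUniqueFullParam U F q) (hL : 1 < (F q).leftMult α)
    (hR : 1 < (F q).flip.leftMult α) :
    ∃ (M : ℕ) (C ρ : ℝ), 0 ≤ C ∧ 0 < ρ ∧ ρ < 1 ∧ ∀ᶠ p in 𝓝[U] q, ∀ (a b : ℕ) (x : ℝ),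
      (F p).HasFullReturn α a b x → ‖p - q‖ ^ M ≤ C * (ρ ^ a + ρ ^ b) := by
  obtain ⟨hqU, hfull, huniq⟩ := hq
  have hzero : ∀ p ∈ U, (F p).defect = 0 ↔ (F p).IsFull := fun p hp =>
    (hF.isNearStandard p hp).defect_eq_zero_iff hε
  obtain ⟨M, c, hc, hM⟩ := hF.semianalytic.exists_eventually_mul_norm_sub_pow_le
    hF.isCompact.isClosed (hF.analyticOnNhd_defect q hqU) ((hzero q hqU).2 hfull)
    (Eventually.of_forall fun p hp h => huniq p hp ((hzero p hp).1 h))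
  obtain ⟨ρ, hρ0, hρ1, hρ⟩ := hF.exists_eventually_defect_le hα hε hqU hfull hL hR
  refine ⟨M, c⁻¹, ρ, (inv_pos.2 hc).le, hρ0, hρ1, ?_⟩
  filter_upwards [eventually_nhdsWithin_of_eventually_nhds hM, hρ, self_mem_nhdsWithin]
    with p hp hpρ hpU a b x hx
  rw [abs_of_nonneg ((hF.isNearStandard p hpU).defect_nonneg hε)] at hp
  exact (le_inv_mul_iff₀ hc).2 ((hp hpU).trans (hpρ a b x hx))

variable {ι : Type*} {𝓕 : Filter ι} {p : ι → ℝ × ℝ} {a b : ι → ℕ} {l r x : ι → ℝ}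

/-- This is where the Łojasiewicz inequality enters. -/
theorem tendsto_nat_mul_norm_sub (hF : IsNearStandardFamily α ε U F) (hα : 1 ≤ α)
    (hε : ε ≤ 1 / 2) (hq : IsUniqueFullParam U F q) (hL : 1 < (F q).leftMult α)
    (hR : 1 < (F q).flip.leftMult α) (hp : Tendsto p 𝓕 (𝓝[U] q)) (ha : Tendsto a 𝓕 atTop)
    (hb : Tendsto b 𝓕 atTop) {A : ℝ} (hab : ∀ᶠ t in 𝓕, (a t : ℝ) ≤ A * b t)
    (hret : ∀ᶠ t in 𝓕, (F (p t)).HasFullReturn α (a t) (b t) (x t)) :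
    Tendsto (fun t => a t * ‖p t - q‖) 𝓕 (𝓝 0) := by
  obtain ⟨M, C, ρ, hC, hρ0, hρ1, hle⟩ := hF.exists_eventually_norm_sub_pow_le hα hε hq hL hR
  refine tendsto_nat_mul_of_pow_le (M := M) hC hρ0 hρ1 ha hb hab (fun t => norm_nonneg _) ?_
  filter_upwards [hp.eventually hle, hret] with t ht hx using ht _ _ _ hx

theorem tendsto_left_of_isHalfReturn (hF : IsNearStandardFamily α ε U F) (hα : 1 ≤ α)
    (hε : ε ≤ 1 / 2) (hq : q ∈ U) (hfull : (F q).IsFull) (hR : 1 < (F q).flip.leftMult α)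
    (hp : Tendsto p 𝓕 (𝓝[U] q)) (ha : Tendsto a 𝓕 atTop)
    (hhalf : ∀ᶠ t in 𝓕, (F (p t)).IsHalfReturn α (a t) (l t) (r t)) :
    Tendsto l 𝓕 (𝓝 (F q).c) := by
  have hf := hF.isNearStandard q hq
  have hval : (F q).leftBranch α (F q).c = 1 := by rw [hf.leftBranch_self (by linarith), hfull.1]
  obtain ⟨ρ, hρ0, hρ1, hρ⟩ := hF.exists_eventually_one_sub_leftBranch_le hα hε hq hfull hR
  have hone : Tendsto (fun t => 1 - (F (p t)).leftBranch α (l t)) 𝓕 (𝓝 0) := by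
    refine tendsto_of_tendsto_of_tendsto_of_le_of_le' tendsto_const_nhds
      ((tendsto_pow_atTop_nhds_zero_of_lt_one hρ0.le hρ1).comp ha) ?_ ?_
    · filter_upwards [hhalf, (tendsto_nhdsWithin_iff.1 hp).2] with t ht hpU
      exact sub_nonneg.2 ((hF.isNearStandard _ hpU).leftBranch_mem hε (by linarith)
        (Ico_subset_Icc_self ht.left_mem)).2
    · filter_upwards [hhalf, hp.eventually hρ] with t ht hpt using hpt _ _ _ ht
  refine (hF.isBranchFamily hα hε).tendsto_of_tendsto_apply hq (by rw [hval]; exact one_pos) hp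
    (hhalf.mono fun t ht => Ico_subset_Icc_self ht.left_mem) ⟨hf.c_mem.1, le_rfl⟩ ?_
  rw [hval]
  simpa only [sub_sub_cancel, sub_zero] using hone.const_sub 1

theorem tendsto_log_leftBranch_self_sub (hF : IsNearStandardFamily α ε U F) (hα : 1 ≤ α)
    (hε : ε ≤ 1 / 2) (hq : q ∈ U) (hu : 0 < (F q).u) (hp : Tendsto p 𝓕 (𝓝[U] q))
    (hx : ∀ᶠ t in 𝓕, x t ∈ Ico 0 (F (p t)).c) (hxlim : Tendsto x 𝓕 (𝓝 (F q).c)) :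
    Tendsto (fun t => Real.log ((F (p t)).leftBranch α (F (p t)).c - (F (p t)).leftBranch α (x t)) -
      α * Real.log ((F (p t)).c - x t)) 𝓕
      (𝓝 (Real.log (deriv (F q).phiL (F q).u) + Real.log (F q).u - α * Real.log (F q).c)) := by
  have hα0 : 0 < α := by linarith
  have hf := hF.isNearStandard q hq
  have hpU := (tendsto_nhdsWithin_iff.1 hp).2
  have hulim : Tendsto (fun t => (F (p t)).u) 𝓕 (𝓝 (F q).u) :=
    (hF.analytic_u.continuousOn q hq).tendsto.comp hp
  have hclim : Tendsto (fun t => (F (p t)).c) 𝓕 (𝓝 (F q).c) :=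
    (hF.analytic_c.continuousOn q hq).tendsto.comp hp
  have hpow : Tendsto (fun t => powPart α (F (p t)).u (F (p t)).c (x t)) 𝓕 (𝓝 (F q).u) := by
    have hbase := ((hxlim.div hclim hf.c_mem.1.ne').const_sub 1).rpow_const (Or.inr hα0.le)
    have h := hulim.mul (hbase.const_sub 1)
    rwa [div_self hf.c_mem.1.ne', sub_self, Real.zero_rpow hα0.ne', sub_zero, mul_one] at h
  have hex : ∀ t, p t ∈ U ∧ 0 < (F (p t)).u ∧ x t ∈ Ico 0 (F (p t)).c → ∃ ζ, _ := fun t ht =>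
    (hF.isNearStandard _ ht.1).exists_log_leftBranch_self_sub_eq hε hα0 ht.2.1 ht.2.2
  choose! ζ hζ hlog using hex
  have hev : ∀ᶠ t in 𝓕, p t ∈ U ∧ 0 < (F (p t)).u ∧ x t ∈ Ico 0 (F (p t)).c := by
    filter_upwards [hpU, hulim.eventually (lt_mem_nhds hu), hx] with t h₁ h₂ h₃ using ⟨h₁, h₂, h₃⟩
  have hζlim : Tendsto ζ 𝓕 (𝓝 (F q).u) := tendsto_of_tendsto_of_tendsto_of_le_of_le' hpow hulim
    (hev.mono fun t ht => (hζ t ht).1) (hev.mono fun t ht => (hζ t ht).2)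
  have hpζ : Tendsto (fun t => (p t, ζ t)) 𝓕 (𝓝[U ×ˢ Icc (0 : ℝ) 1] (q, (F q).u)) := by
    refine tendsto_nhdsWithin_iff.2 ⟨(tendsto_nhdsWithin_iff.1 hp).1.prodMk_nhds hζlim,
      hev.mono fun t ht => ⟨ht.1, ?_⟩⟩
    have hft := hF.isNearStandard _ ht.1
    exact ⟨(powPart_mem_Icc hα0.le hft.u_mem hft.c_mem.1
      (Ico_subset_Icc_self ht.2.2)).1.trans (hζ t ht).1, (hζ t ht).2.trans hft.u_mem.2⟩
  have hderiv := (hF.continuousOn_deriv_phiL (q, (F q).u) ⟨hq, hf.u_mem⟩).tendsto.comp hpζ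
  have hderiv_ne : deriv (F q).phiL (F q).u ≠ 0 := by
    linarith [hf.phiL.half_le_deriv hε hf.u_mem]
  refine (((hderiv.log hderiv_ne).add (hulim.log hu.ne')).sub
    ((hclim.log hf.c_mem.1.ne').const_mul α)).congr' (hev.mono fun t ht => ?_)
  simp only [hlog t ht, Function.comp_apply]
  ring

theorem exists_tendsto_log_sub_left (hF : IsNearStandardFamily α ε U F) (hα : 1 ≤ α)
    (hε : ε ≤ 1 / 2) (hq : q ∈ U) (hfull : (F q).IsFull) (hR : 1 < (F q).flip.leftMult α)
    (hp : Tendsto p 𝓕 (𝓝[U] q)) (ha : Tendsto a 𝓕 atTop)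
    (hap : Tendsto (fun t => a t * ‖p t - q‖) 𝓕 (𝓝 0))
    (hhalf : ∀ᶠ t in 𝓕, (F (p t)).IsHalfReturn α (a t) (l t) (r t))
    (hl : Tendsto l 𝓕 (𝓝 (F q).c)) (hr : Tendsto r 𝓕 (𝓝 (F q).c)) :
    ∃ κ : ℝ, Tendsto (fun t => Real.log (r t - l t) - α * Real.log ((F (p t)).c - l t) -
      a t * Real.log ((F q).flip.leftMult α)) 𝓕 (𝓝 κ) := by
  have hα0 : 0 < α := by linarith
  have hf := hF.isNearStandard q hq
  have hval : (F q).flip.leftBranch α (F q).flip.c = 1 := by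
    rw [hf.flip.leftBranch_self hα0.ne', hfull.flip.1]
  have hu : 0 < (F q).u := hf.u_pos (x := (F q).c) <| by
    rw [hf.leftBranch_self hα0.ne', hfull.1]
    exact one_pos
  have hlt : ∀ᶠ t in 𝓕, 1 - (F (p t)).leftBranch α (F (p t)).c <
      1 - (F (p t)).leftBranch α (l t) := by
    filter_upwards [hhalf, (tendsto_nhdsWithin_iff.1 hp).2] with t ht hpU
    exact sub_lt_sub_left (ht.leftBranch_lt (hF.isNearStandard _ hpU) hε hα0) 1
  obtain ⟨κ, hκ⟩ := (hF.flip.isBranchFamily hα hε).exists_tendsto_log_sub_sub hq hval hR hp ha hlt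
    (hhalf.mono fun t ht => ht.orbit_crit) (hhalf.mono fun t ht => ht.orbit_end)
    (hr.const_sub 1) (hl.const_sub 1)
  have hcrit := hF.tendsto_log_leftBranch_self_sub hα hε hq hu hp
    (hhalf.mono fun t ht => ht.left_mem) hl
  have hmult := tendsto_nat_mul_log_sub (hF.flip.analyticAt_leftMult hq).differentiableAt
    (zero_lt_one.trans hR).ne' (tendsto_nhdsWithin_iff.1 hp).1 hap
  refine ⟨_, ((hκ.add hcrit).add hmult).congr fun t => ?_⟩
  simp only [sub_sub_sub_cancel_left, LorenzData.leftMult]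
  ring

theorem exists_tendsto_log_odds (hF : IsNearStandardFamily α ε U F) (hα : 1 < α)
    (hε : ε ≤ 1 / 2) (hq : IsUniqueFullParam U F q) (hL : 1 < (F q).leftMult α)
    (hR : 1 < (F q).flip.leftMult α) (ha : Tendsto a 𝓕 atTop) (hb : Tendsto b 𝓕 atTop) {A : ℝ}
    (hab : ∀ᶠ t in 𝓕, (a t : ℝ) ≤ A * b t) (hba : ∀ᶠ t in 𝓕, (b t : ℝ) ≤ A * a t)
    (hpU : ∀ᶠ t in 𝓕, p t ∈ U)
    (hret : ∀ᶠ t in 𝓕, (F (p t)).HasFullReturn α (a t) (b t) (x t)) :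
    ∃ κ : ℝ, Tendsto (fun t => α * (Real.log (x t) - Real.log (1 - x t)) +
      a t * Real.log ((F q).flip.leftMult α) - b t * Real.log ((F q).leftMult α)) 𝓕 (𝓝 κ) := by
  have hp := hF.tendsto_nhdsWithin_of_hasFullReturn hα hε hq ha hb hpU hret
  have hL' : 1 < (F q).flip.flip.leftMult α := by rwa [LorenzData.flip_flip]
  have hap := hF.tendsto_nat_mul_norm_sub hα.le hε hq hL hR hp ha hb hab hret
  have hbp := hF.flip.tendsto_nat_mul_norm_sub hα.le hε hq.flip hR hL' hp hb ha hba
    (hret.mono fun t ht => ht.flip)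
  have hex : ∀ t, (F (p t)).HasFullReturn α (a t) (b t) (x t) → ∃ l r, _ := fun t ht => ht
  choose! l r hl hr hx using hex
  have hhalf := hret.mono hl
  have hhalf' := hret.mono hr
  have hllim := hF.tendsto_left_of_isHalfReturn hα.le hε hq.1 hq.2.1 hR hp ha hhalf
  have hrlim' := hF.flip.tendsto_left_of_isHalfReturn hα.le hε hq.1 hq.2.1.flip hL' hp hb hhalf'
  have hrlim : Tendsto r 𝓕 (𝓝 (F q).c) := by
    simpa only [LorenzData.flip, sub_sub_cancel] using hrlim'.const_sub 1
  obtain ⟨κ, hκ⟩ := hF.exists_tendsto_log_sub_left hα.le hε hq.1 hq.2.1 hR hp ha hap hhalf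
    hllim hrlim
  obtain ⟨κ', hκ'⟩ := hF.flip.exists_tendsto_log_sub_left hα.le hε hq.1 hq.2.1.flip hL' hp hb hbp
    hhalf' hrlim' (hllim.const_sub 1)
  refine ⟨κ' - κ, (hκ'.sub hκ).congr' (hret.mono fun t ht => ?_)⟩
  have hlc := (hl t ht).left_mem.2
  have hcr : (F (p t)).c < r t := (sub_lt_sub_iff_left 1).1 (hr t ht).left_mem.2
  simp only [hx t ht, LorenzData.log_sub_log_one_sub_div hlc hcr, LorenzData.flip_flip,
    show (F (p t)).flip.c = 1 - (F (p t)).c from rfl, sub_sub_sub_cancel_left]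
  ring

end IsNearStandardFamily

/-! ### The admissible distance to standard maps -/

section closeness

variable {α ε : ℝ}

theorem one_lt_thetaCrit (hα : 1 < α) : 1 < thetaCrit α :=
  lt_add_of_pos_right 1 (div_pos (Real.log_pos one_lt_two) (Real.log_pos (by linarith)))

theorem thetaCrit_lt_log_div_log (hα : 1 < α) :
    thetaCrit α < Real.log (3 * α) / Real.log (3 / 2 * α) := by
  have hlog : 0 < Real.log (3 / 2 * α) := Real.log_pos (by linarith)
  have htwo : 0 < Real.log 2 := Real.log_pos one_lt_two
  have hsum : Real.log (3 * α) = Real.log 2 + Real.log (3 / 2 * α) := by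
    rw [← Real.log_mul two_ne_zero (by linarith)]
    congr 1
    ring
  have hdiff (k L : ℝ) (hk : 0 < k) (hL : 0 < L) :
      k + L - (1 + k / (k + L)) * L = k ^ 2 / (k + L) := by
    field_simp
    ring
  rw [thetaCrit, hsum, lt_div_iff₀ hlog, ← sub_pos, hdiff _ _ htwo hlog]
  positivity

theorem two_mul_log_three_halves_mul_lt (hα : 1 < α) :
    2 * Real.log (3 / 2 * α) < α * (Real.log 7 - Real.log 2) := by
  have he := Real.exp_one_gt_d9
  have he' := Real.exp_one_lt_d9
  -- Both logarithms are compared with their tangents at `e`, where `log x / x` is largest.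
  have hupper : Real.log (3 / 2 * α) ≤ α * (3 / 5) := by
    have htangent := Real.log_le_sub_one_of_pos (x := 3 / 2 * α / Real.exp 1) (by positivity)
    rw [Real.log_div (by positivity) (Real.exp_pos 1).ne', Real.log_exp] at htangent
    have hslope : 3 / 2 * α / Real.exp 1 ≤ α * (3 / 5) := by
      rw [div_le_iff₀ (Real.exp_pos 1)]
      nlinarith
    linarith
  have hlower : 6 / 5 < Real.log 7 - Real.log 2 := by
    have htangent := Real.one_sub_inv_le_log_of_pos (x := 7 / 2 / Real.exp 1) (by positivity)
    rw [Real.log_div (by norm_num) (Real.exp_pos 1).ne', Real.log_exp,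
      Real.log_div (by norm_num) (by norm_num), inv_div] at htangent
    linarith
  nlinarith

/-- The constraints on the distance `ε` to standard maps under which the theorem is proved. When the
critical point of the full map is at least `2 / 3`, its multiplier at `0` is at most
`3 / 2 * α * (1 + ε)` and its multiplier at `1` at least `3 * α * (1 - ε)`; hence the quotient of
their logarithms exceeds `thetaCrit α`, and raising `b` by `2` changes the log-odds of the critical
point of the renormalization by less than `log (7 / 2)`, the gap between the log-odds of `1 / 8` and
`1 / 3`. -/
structure IsAdmissibleDist (α ε : ℝ) : Prop where
  pos : 0 < ε
  le_half : ε ≤ 1 / 2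
  one_lt_mul : 1 < (1 - ε) * α
  thetaCrit_lt :
    thetaCrit α < Real.log (3 * α * (1 - ε)) / Real.log (3 / 2 * α * (1 + ε))
  two_mul_log_lt : 2 * Real.log (3 / 2 * α * (1 + ε)) < α * (Real.log 7 - Real.log 2)

theorem exists_isAdmissibleDist (hα : 1 < α) : ∃ ε, IsAdmissibleDist α ε := by
  have hlog : Real.log (3 / 2 * α) ≠ 0 := (Real.log_pos (by linarith)).ne'
  have hden : ContinuousAt (fun ε : ℝ => Real.log (3 / 2 * α * (1 + ε))) 0 :=
    ContinuousAt.log (by fun_prop) (by simp only [add_zero, mul_one]; positivity)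
  have hnum : ContinuousAt (fun ε : ℝ => Real.log (3 * α * (1 - ε))) 0 :=
    ContinuousAt.log (by fun_prop) (by simp only [sub_zero, mul_one]; positivity)
  have hquot : ContinuousAt
      (fun ε : ℝ => Real.log (3 * α * (1 - ε)) / Real.log (3 / 2 * α * (1 + ε))) 0 :=
    hnum.div hden (by simpa only [add_zero, mul_one] using hlog)
  have hmul : ContinuousAt (fun ε : ℝ => (1 - ε) * α) 0 := by fun_prop
  have hnear : ∀ᶠ ε : ℝ in 𝓝 0, ε ≤ 1 / 2 ∧ 1 < (1 - ε) * α ∧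
      thetaCrit α < Real.log (3 * α * (1 - ε)) / Real.log (3 / 2 * α * (1 + ε)) ∧
      2 * Real.log (3 / 2 * α * (1 + ε)) < α * (Real.log 7 - Real.log 2) := by
    refine (ge_mem_nhds (by norm_num)).and <| (hmul.eventually (lt_mem_nhds ?_)).and <|
      (hquot.eventually (lt_mem_nhds ?_)).and <|
      (hden.const_mul 2).eventually (gt_mem_nhds ?_)
    · simpa only [sub_zero, one_mul] using hα
    · simpa only [sub_zero, add_zero, mul_one] using thetaCrit_lt_log_div_log hα
    · simpa only [add_zero, mul_one] using two_mul_log_three_halves_mul_lt hα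
  obtain ⟨ε, ⟨hhalf, hone, htheta, htwo⟩, hpos⟩ :=
    ((hnear.filter_mono nhdsWithin_le_nhds).and
      (self_mem_nhdsWithin : Ioi (0 : ℝ) ∈ 𝓝[>] 0)).exists
  exact ⟨ε, hpos, hhalf, hone, htheta, htwo⟩

theorem IsAdmissibleDist.thetaCrit_lt_log_div_log {x y : ℝ} (hε : IsAdmissibleDist α ε)
    (hx : 1 < x) (hxle : x ≤ 3 / 2 * α * (1 + ε)) (hley : 3 * α * (1 - ε) ≤ y) :
    thetaCrit α < Real.log y / Real.log x := by
  have hone : 1 ≤ 3 * α * (1 - ε) := by linarith [hε.one_lt_mul]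
  have hlog : Real.log (3 * α * (1 - ε)) ≤ Real.log y := Real.log_le_log (by linarith) hley
  exact hε.thetaCrit_lt.trans_le (div_le_div₀ ((Real.log_nonneg hone).trans hlog) hlog
    (Real.log_pos hx) (Real.log_le_log (by linarith) hxle))

end closeness

/-! ### Choosing the floors -/

section floor

variable {x : ℝ}

theorem log_sub_log_one_sub_le_log_iff (hx : x ∈ Ioo (0 : ℝ) 1) {k : ℝ} (hk : 0 < k) :
    Real.log x - Real.log (1 - x) ≤ Real.log k ↔ x ≤ k * (1 - x) := by
  have hx' : 0 < 1 - x := sub_pos.2 hx.2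
  rw [← Real.log_div hx.1.ne' hx'.ne', Real.log_le_log_iff (div_pos hx.1 hx') hk, div_le_iff₀ hx']

theorem log_le_log_sub_log_one_sub_iff (hx : x ∈ Ioo (0 : ℝ) 1) {k : ℝ} (hk : 0 < k) :
    Real.log k ≤ Real.log x - Real.log (1 - x) ↔ k * (1 - x) ≤ x := by
  have hx' : 0 < 1 - x := sub_pos.2 hx.2
  rw [← Real.log_div hx.1.ne' hx'.ne', Real.log_le_log_iff hk (div_pos hx.1 hx'), le_div_iff₀ hx']

theorem exists_int_mul_mem_Ico {Λ : ℝ} (hΛ : 0 < Λ) (y : ℝ) : ∃ n : ℤ, n * Λ ∈ Ico y (y + Λ) := by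
  obtain ⟨n, hn, -⟩ := existsUnique_add_zsmul_mem_Ico hΛ 0 y
  exact ⟨n, by simpa only [zero_add, zsmul_eq_mul] using hn⟩

theorem natCast_mem_Icc_of_eq_floor_sub {y : ℝ} {k : ℤ} {b : ℕ} (hb : (b : ℤ) = ⌊y⌋ - k) :
    (b : ℝ) ∈ Icc (y - 1 - k) (y - k) := by
  have hcast : (b : ℝ) = ⌊y⌋ - k := by exact_mod_cast congrArg (Int.cast : ℤ → ℝ) hb
  exact ⟨by linarith [Int.lt_floor_add_one y], by linarith [Int.floor_le y]⟩

theorem eventually_floor_sub_bounds {θ : ℝ} (hθ : 0 < θ) (k : ℤ) :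
    ∀ᶠ a : ℕ in atTop, 1 ≤ ⌊θ * (a : ℝ)⌋ - k ∧
      ∀ b : ℕ, (b : ℤ) = ⌊θ * (a : ℝ)⌋ - k → θ / 2 * a ≤ b ∧ (b : ℝ) ≤ 2 * θ * a := by
  filter_upwards [(tendsto_natCast_atTop_atTop.const_mul_atTop (half_pos hθ)).eventually_ge_atTop
    (1 + |(k : ℝ)|)] with a ha
  have hk := abs_le.1 (le_refl |(k : ℝ)|)
  refine ⟨?_, fun b hb => ?_⟩
  · have hfloor : k + 1 ≤ ⌊θ * (a : ℝ)⌋ := Int.le_floor.2 (by push_cast; linarith)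
    linarith
  · have hbmem := natCast_mem_Icc_of_eq_floor_sub hb
    constructor <;> linarith [hbmem.1, hbmem.2, abs_nonneg (k : ℝ)]

theorem mem_Icc_of_eq_floor_sub {W Λ₀ Λ₁ κ η : ℝ} {a b : ℕ} {k : ℤ} (h₀ : 0 < Λ₀)
    (hW : |W + a * Λ₁ - b * Λ₀ - κ| ≤ η) (hb : (b : ℤ) = ⌊Λ₁ / Λ₀ * (a : ℝ)⌋ - k) :
    W ∈ Icc (κ - η - (k + 1) * Λ₀) (κ + η - k * Λ₀) := by
  have hbmem := natCast_mem_Icc_of_eq_floor_sub hb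
  have hΛ : Λ₁ / Λ₀ * a * Λ₀ = a * Λ₁ := by
    field_simp
  have hlower := mul_le_mul_of_nonneg_right hbmem.1 h₀.le
  have hupper := mul_le_mul_of_nonneg_right hbmem.2 h₀.le
  have habs := abs_le.1 hW
  constructor <;> linarith

/-- The admissible values of the log-odds form intervals longer than `2 * Λ₀`, one `Λ₀` for the
rounding in the floor and one for the choice of the integer offset. -/
theorem exists_floor_sub_of_abs_log_odds_le {V : ℕ → ℕ → ℝ → Prop}
    (hV : ∀ a b x, V a b x → x ∈ Ioo (0 : ℝ) 1) {α Λ₀ Λ₁ κ : ℝ} (hα : 0 < α) (h₀ : 0 < Λ₀)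
    (h₁ : 0 < Λ₁) (hsmall : 2 * Λ₀ < α * (Real.log 7 - Real.log 2))
    (h : ∀ η > 0, ∀ᶠ a : ℕ in atTop, ∀ b x, V a b x →
      Λ₁ / Λ₀ / 2 * a ≤ b → b ≤ 2 * (Λ₁ / Λ₀) * a →
      |α * (Real.log x - Real.log (1 - x)) + a * Λ₁ - b * Λ₀ - κ| ≤ η) :
    ∃ n m : ℤ, ∀ᶠ a : ℕ in atTop,
      1 ≤ ⌊Λ₁ / Λ₀ * (a : ℝ)⌋ - n ∧ 1 ≤ ⌊Λ₁ / Λ₀ * (a : ℝ)⌋ - m ∧ ∀ b x, V a b x →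
        ((b : ℤ) = ⌊Λ₁ / Λ₀ * (a : ℝ)⌋ - n → 1 / 8 ≤ x ∧ x ≤ 1 / 3) ∧
        ((b : ℤ) = ⌊Λ₁ / Λ₀ * (a : ℝ)⌋ - m → 2 / 3 ≤ x) := by
  obtain ⟨η, hη, hη'⟩ : ∃ η > 0, 2 * Λ₀ + 2 * η = α * (Real.log 7 - Real.log 2) :=
    ⟨(α * (Real.log 7 - Real.log 2) - 2 * Λ₀) / 2, by linarith, by ring⟩
  obtain ⟨n, hn⟩ := exists_int_mul_mem_Ico h₀ (κ + η + α * Real.log 2)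
  obtain ⟨m, hm⟩ := exists_int_mul_mem_Ico h₀ (κ - η - α * Real.log 2 - 2 * Λ₀)
  have hθ : 0 < Λ₁ / Λ₀ := div_pos h₁ h₀
  refine ⟨n, m, ?_⟩
  filter_upwards [h η hη, eventually_floor_sub_bounds hθ n, eventually_floor_sub_bounds hθ m]
    with a ha han ham
  refine ⟨han.1, ham.1, fun b x hx => ⟨fun hb => ?_, fun hb => ?_⟩⟩
  · have hW := mem_Icc_of_eq_floor_sub h₀ (ha b x hx (han.2 b hb).1 (han.2 b hb).2) hb
    have hlower : Real.log 7⁻¹ ≤ Real.log x - Real.log (1 - x) :=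
      le_of_mul_le_mul_left (by rw [Real.log_inv]; linarith [hW.1, hn.2]) hα
    have hupper : Real.log x - Real.log (1 - x) ≤ Real.log 2⁻¹ :=
      le_of_mul_le_mul_left (by rw [Real.log_inv]; linarith [hW.2, hn.1]) hα
    rw [log_le_log_sub_log_one_sub_iff (hV _ _ _ hx) (by norm_num)] at hlower
    rw [log_sub_log_one_sub_le_log_iff (hV _ _ _ hx) (by norm_num)] at hupper
    constructor <;> linarith
  · have hW := mem_Icc_of_eq_floor_sub h₀ (ha b x hx (ham.2 b hb).1 (ham.2 b hb).2) hb
    have hlower : Real.log 2 ≤ Real.log x - Real.log (1 - x) :=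
      le_of_mul_le_mul_left (by linarith [hW.1, hm.2]) hα
    rw [log_le_log_sub_log_one_sub_iff (hV _ _ _ hx) two_pos] at hlower
    linarith

end floor

/-! ### Full vertices of prescribed type -/

section vertices

variable {α ε : ℝ} {f : LorenzData}

namespace LorenzData

theorem HasFullReturn.mem_Ioo {a b : ℕ} {x : ℝ} (h : f.HasFullReturn α a b x) :
    x ∈ Ioo (0 : ℝ) 1 := by
  obtain ⟨l, r, hl, hr, rfl⟩ := h
  have hlc := hl.left_mem.2
  have hcr : f.c < r := (sub_lt_sub_iff_left 1).1 hr.left_mem.2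
  exact ⟨div_pos (sub_pos.2 hlc) (by linarith), (div_lt_one (by linarith)).2 (by linarith)⟩

namespace IsNearStandard

theorem u_eq_one (hf : f.IsNearStandard α ε) (hε : ε ≤ 1 / 2) (hfull : f.IsFull) : f.u = 1 :=
  (hf.phiL.strictMonoOn hε).injOn hf.u_mem ⟨zero_le_one, le_rfl⟩
    (hfull.1.trans hf.phiL.map_one.symm)

theorem leftMult_mem_Icc (hf : f.IsNearStandard α ε) (hε : ε ≤ 1 / 2) (hα : 0 ≤ α)
    (hfull : f.IsFull) :
    f.leftMult α ∈ Icc ((1 - ε) * (α / f.c)) ((1 + ε) * (α / f.c)) := by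
  have hderiv := abs_le.1 (hf.phiL.abs_deriv_sub_one_le 0 ⟨le_rfl, zero_le_one⟩)
  have hdiv : 0 ≤ α / f.c := div_nonneg hα hf.c_mem.1.le
  rw [leftMult_eq, hf.u_eq_one hε hfull, one_mul]
  exact ⟨mul_le_mul_of_nonneg_right (by linarith) hdiv,
    mul_le_mul_of_nonneg_right (by linarith) hdiv⟩

theorem one_lt_leftMult (hf : f.IsNearStandard α ε) (hε : IsAdmissibleDist α ε) (hα : 0 ≤ α)
    (hfull : f.IsFull) : 1 < f.leftMult α :=
  hε.one_lt_mul.trans_le <|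
    (mul_le_mul_of_nonneg_left (le_div_self hα hf.c_mem.1 hf.c_mem.2.le)
      (by linarith [hε.le_half])).trans (hf.leftMult_mem_Icc hε.le_half hα hfull).1

theorem leftMult_le (hf : f.IsNearStandard α ε) (hε : IsAdmissibleDist α ε) (hα : 0 ≤ α)
    (hfull : f.IsFull) (hc : 2 / 3 ≤ f.c) : f.leftMult α ≤ 3 / 2 * α * (1 + ε) := by
  have hdiv : α / f.c ≤ 3 / 2 * α := by
    rw [div_le_iff₀ hf.c_mem.1]
    nlinarith
  refine (hf.leftMult_mem_Icc hε.le_half hα hfull).2.trans ?_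
  rw [mul_comm (3 / 2 * α)]
  exact mul_le_mul_of_nonneg_left hdiv (by linarith [hε.pos])

theorem le_leftMult (hf : f.IsNearStandard α ε) (hε : ε ≤ 1 / 2) (hα : 0 ≤ α)
    (hfull : f.IsFull) (hc : f.c ≤ 1 / 3) : 3 * α * (1 - ε) ≤ f.leftMult α := by
  have hdiv : 3 * α ≤ α / f.c := by
    rw [le_div_iff₀ hf.c_mem.1]
    nlinarith
  refine le_trans ?_ (hf.leftMult_mem_Icc hε hα hfull).1
  rw [mul_comm (3 * α)]
  exact mul_le_mul_of_nonneg_left hdiv (by linarith)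

end IsNearStandard

end LorenzData

namespace IsNearStandardFamily

variable {U : Set (ℝ × ℝ)} {F : ℝ × ℝ → LorenzData} {q : ℝ × ℝ}

theorem exists_eventually_abs_log_odds_le (hF : IsNearStandardFamily α ε U F) (hα : 1 < α)
    (hε : ε ≤ 1 / 2) (hq : IsUniqueFullParam U F q) (hL : 1 < (F q).leftMult α)
    (hR : 1 < (F q).flip.leftMult α) {θ : ℝ} (hθ : 0 < θ) :
    ∃ κ : ℝ, ∀ η > 0, ∀ᶠ a : ℕ in atTop, ∀ b x, (∃ p ∈ U, (F p).HasFullReturn α a b x) →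
      θ / 2 * a ≤ b → b ≤ 2 * θ * a →
      |α * (Real.log x - Real.log (1 - x)) + a * Real.log ((F q).flip.leftMult α) -
        b * Real.log ((F q).leftMult α) - κ| ≤ η := by
  set S : Set (ℕ × ℕ × (ℝ × ℝ) × ℝ) := {t | (t.2.2.1 ∈ U ∧
    (F t.2.2.1).HasFullReturn α t.1 t.2.1 t.2.2.2) ∧ θ / 2 * t.1 ≤ t.2.1 ∧ t.2.1 ≤ 2 * θ * t.1}
  set 𝓕 := comap (fun t : ℕ × ℕ × (ℝ × ℝ) × ℝ => t.1) atTop ⊓ 𝓟 S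
  have hS : ∀ᶠ t in 𝓕, t ∈ S := mem_inf_of_right (mem_principal_self S)
  have ha : Tendsto (fun t : ℕ × ℕ × (ℝ × ℝ) × ℝ => t.1) 𝓕 atTop :=
    tendsto_comap.mono_left inf_le_left
  have hb : Tendsto (fun t : ℕ × ℕ × (ℝ × ℝ) × ℝ => t.2.1) 𝓕 atTop :=
    tendsto_natCast_atTop_iff.1 <| tendsto_atTop_mono' 𝓕 (hS.mono fun t ht => ht.2.1)
      ((tendsto_natCast_atTop_iff.2 ha).const_mul_atTop (half_pos hθ))
  have hab : ∀ᶠ t in 𝓕, (t.1 : ℝ) ≤ max (2 / θ) (2 * θ) * t.2.1 := hS.mono fun t ht => by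
    refine le_trans ?_ (mul_le_mul_of_nonneg_right (le_max_left _ _) (Nat.cast_nonneg _))
    rw [div_mul_eq_mul_div, le_div_iff₀ hθ]
    linarith [ht.2.1]
  have hba : ∀ᶠ t in 𝓕, (t.2.1 : ℝ) ≤ max (2 / θ) (2 * θ) * t.1 := hS.mono fun t ht =>
    ht.2.2.trans (mul_le_mul_of_nonneg_right (le_max_right _ _) (Nat.cast_nonneg _))
  obtain ⟨κ, hκ⟩ := hF.exists_tendsto_log_odds hα hε hq hL hR ha hb hab hba
    (hS.mono fun t ht => ht.1.1) (hS.mono fun t ht => ht.1.2)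
  refine ⟨κ, fun η hη => ?_⟩
  have hclose := hκ.eventually (Metric.closedBall_mem_nhds κ hη)
  rw [eventually_inf_principal, eventually_comap] at hclose
  filter_upwards [hclose] with a haclose
  rintro b x ⟨p, hp, hret⟩ hle hge
  exact haclose (a, b, p, x) rfl ⟨⟨hp, hret⟩, hle, hge⟩

theorem exists_floor_sub (hF : IsNearStandardFamily α ε U F) (hα : 1 < α)
    (hε : IsAdmissibleDist α ε) (hq : IsUniqueFullParam U F q) (hc : 2 / 3 ≤ (F q).c) :
    ∃ θ : ℝ, thetaCrit α < θ ∧ ∃ N n m : ℤ, ∀ a : ℕ, N ≤ (a : ℤ) →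
      1 ≤ ⌊θ * (a : ℝ)⌋ - n ∧ 1 ≤ ⌊θ * (a : ℝ)⌋ - m ∧
      ∀ b x, (∃ p ∈ U, (F p).HasFullReturn α a b x) →
        ((b : ℤ) = ⌊θ * (a : ℝ)⌋ - n → 1 / 8 ≤ x ∧ x ≤ 1 / 3) ∧
        ((b : ℤ) = ⌊θ * (a : ℝ)⌋ - m → 2 / 3 ≤ x) := by
  have hα0 : 0 ≤ α := by linarith
  have hf := hF.isNearStandard q hq.1
  have hL := hf.one_lt_leftMult hε hα0 hq.2.1
  have hR := hf.flip.one_lt_leftMult hε hα0 hq.2.1.flip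
  have hLle := hf.leftMult_le hε hα0 hq.2.1 hc
  have hleR := hf.flip.le_leftMult hε.le_half hα0 hq.2.1.flip
    (by rw [LorenzData.flip]; linarith)
  have hΛL := Real.log_pos hL
  have hΛR := Real.log_pos hR
  obtain ⟨κ, hκ⟩ := hF.exists_eventually_abs_log_odds_le hα hε.le_half hq hL hR (div_pos hΛR hΛL)
  have hlog := Real.log_le_log (zero_lt_one.trans hL) hLle
  obtain ⟨n, m, h⟩ := exists_floor_sub_of_abs_log_odds_le
    (fun _ _ _ ⟨_, _, hret⟩ => hret.mem_Ioo) (by linarith) hΛL hΛR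
    (by linarith [hε.two_mul_log_lt]) hκ
  obtain ⟨N, hN⟩ := eventually_atTop.1 h
  exact ⟨_, hε.thetaCrit_lt_log_div_log hL hLle hleR, N, n, m,
    fun a ha => hN a (Int.ofNat_le.1 ha)⟩

theorem hasFullReturn_of_isFullVertex (hF : IsNearStandardFamily α ε U F) (hα : 1 ≤ α)
    (hε : ε ≤ 1 / 2) {a b : ℕ} {p : ℝ × ℝ} {g : LorenzData} (h : IsFullVertex α U F a b p g) :
    (F p).HasFullReturn α a b g.c :=
  h.2.1.hasFullReturn h.2.2 (hF.isNearStandard p h.1) hε hα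

end IsNearStandardFamily

end vertices

theorem mainTheorem4_general (α : ℝ) (hα : 1 < α) :
    ∃ ε : ℝ, 0 < ε ∧
      ∀ (U : Set (ℝ × ℝ)) (F : ℝ × ℝ → LorenzData) (pfull : ℝ × ℝ),
        IsNearStandardFamily α ε U F →
        IsUniqueFullParam U F pfull →
        (2 / 3 ≤ (F pfull).c →
          ∃ θ : ℝ, thetaCrit α < θ ∧ 1 < thetaCrit α ∧ ∃ N n m : ℤ,
            ∀ a : ℕ, N ≤ (a : ℤ) →
              1 ≤ ⌊θ * (a : ℝ)⌋ - n ∧ 1 ≤ ⌊θ * (a : ℝ)⌋ - m ∧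
              ∀ (b : ℕ) (p : ℝ × ℝ) (g : LorenzData), IsFullVertex α U F a b p g →
                ((b : ℤ) = ⌊θ * (a : ℝ)⌋ - n → 1 / 8 ≤ g.c ∧ g.c ≤ 1 / 3) ∧
                ((b : ℤ) = ⌊θ * (a : ℝ)⌋ - m → 2 / 3 ≤ g.c)) ∧
        ((F pfull).c ≤ 1 / 3 →
          ∃ θ : ℝ, thetaCrit α < θ ∧ 1 < thetaCrit α ∧ ∃ N n m : ℤ,
            ∀ b : ℕ, N ≤ (b : ℤ) →
              1 ≤ ⌊θ * (b : ℝ)⌋ - n ∧ 1 ≤ ⌊θ * (b : ℝ)⌋ - m ∧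
              ∀ (a : ℕ) (p : ℝ × ℝ) (g : LorenzData), IsFullVertex α U F a b p g →
                ((a : ℤ) = ⌊θ * (b : ℝ)⌋ - n → 2 / 3 ≤ g.c ∧ g.c ≤ 7 / 8) ∧
                ((a : ℤ) = ⌊θ * (b : ℝ)⌋ - m → g.c ≤ 1 / 3)) := by
  obtain ⟨ε, hε⟩ := exists_isAdmissibleDist hα
  refine ⟨ε, hε.pos, fun U F q hF hq => ⟨fun hc => ?_, fun hc => ?_⟩⟩
  · obtain ⟨θ, hθ, N, n, m, h⟩ := hF.exists_floor_sub hα hε hq hc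
    refine ⟨θ, hθ, one_lt_thetaCrit hα, N, n, m, fun a ha => ?_⟩
    obtain ⟨hn, hm, hvertex⟩ := h a ha
    exact ⟨hn, hm, fun b p g hg =>
      hvertex b g.c ⟨p, hg.1, hF.hasFullReturn_of_isFullVertex hα.le hε.le_half hg⟩⟩
  · obtain ⟨θ, hθ, N, n, m, h⟩ := hF.flip.exists_floor_sub hα hε hq.flip
      (by rw [LorenzData.flip]; linarith)
    refine ⟨θ, hθ, one_lt_thetaCrit hα, N, n, m, fun b hb => ?_⟩
    obtain ⟨hn, hm, hvertex⟩ := h b hb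
    refine ⟨hn, hm, fun a p g hg => ?_⟩
    obtain ⟨hinner, houter⟩ := hvertex a (1 - g.c)
      ⟨p, hg.1, (hF.hasFullReturn_of_isFullVertex hα.le hε.le_half hg).flip⟩
    exact ⟨fun ha => ⟨by linarith [hinner ha], by linarith [hinner ha]⟩,
      fun ha => by linarith [houter ha]⟩

end

theorem mainTheorem4 (α : ℝ) (hα : 1 < α) :
    ∃ ε : ℝ, 0 < ε ∧
      ∀ (U : Set (ℝ × ℝ)) (F : ℝ × ℝ → LorenzData) (pfull : ℝ × ℝ),
        IsAnalyticFamily α U F →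
        (∀ p ∈ U, (F p).IsCloseToStandard ε) →
        IsUniqueFullParam U F pfull →
        (2 / 3 ≤ (F pfull).c →
          ∃ θ : ℝ, thetaCrit α < θ ∧ 1 < thetaCrit α ∧ ∃ N n m : ℤ,
            ∀ a : ℕ, N ≤ (a : ℤ) →
              1 ≤ ⌊θ * (a : ℝ)⌋ - n ∧ 1 ≤ ⌊θ * (a : ℝ)⌋ - m ∧
              ∀ (b : ℕ) (p : ℝ × ℝ) (g : LorenzData), IsFullVertex α U F a b p g →
                ((b : ℤ) = ⌊θ * (a : ℝ)⌋ - n → 1 / 8 ≤ g.c ∧ g.c ≤ 1 / 3) ∧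
                ((b : ℤ) = ⌊θ * (a : ℝ)⌋ - m → 2 / 3 ≤ g.c)) ∧
        ((F pfull).c ≤ 1 / 3 →
          ∃ θ : ℝ, thetaCrit α < θ ∧ 1 < thetaCrit α ∧ ∃ N n m : ℤ,
            ∀ b : ℕ, N ≤ (b : ℤ) →
              1 ≤ ⌊θ * (b : ℝ)⌋ - n ∧ 1 ≤ ⌊θ * (b : ℝ)⌋ - m ∧
              ∀ (a : ℕ) (p : ℝ × ℝ) (g : LorenzData), IsFullVertex α U F a b p g →
                ((a : ℤ) = ⌊θ * (b : ℝ)⌋ - n → 2 / 3 ≤ g.c ∧ g.c ≤ 7 / 8) ∧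
                ((a : ℤ) = ⌊θ * (b : ℝ)⌋ - m → g.c ≤ 1 / 3)) := by
  obtain ⟨ε, hε, h⟩ := mainTheorem4_general α hα
  exact ⟨ε, hε, fun U F q hF hclose => h U F q (hF.isNearStandardFamily hclose)⟩
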